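/- **Notation.** Let $R$ be a commutative ring with $1$ and $\mathfrak g$ an $R$-Lie algebra which is projective as an $R$-module; unadorned tensor products are over $R$. *The cone.* $C\mathfrak g=\mathfrak g\oplus s\mathfrak g$ is the cone on $\mathfrak g$: the elements $x\in\mathfrak g$ have degree $0$, the elements $sy$ ($y\in\mathfrak g$) have degree $1$, and $[x,sy]=s[x,y]$, $[sx,sy]=0$, $d(sy)=y$. Its universal enveloping algebra $A=\mathrm U[C\mathfrak g]$ is the augmented differential graded algebra generated by $\mathfrak g$ and $s\mathfrak g$ subject to $xy-yx=[x,y]$, $x(sy)-(sy)x=s[x,y]$, $(sy)^2=0$; it contains the images of $S=\mathrm U[\mathfrak g]$ and of $\Lambda[s\mathfrak g]$. A right $A$-complex is a differential graded right $A$-module concentrated in degrees $\ge 0$. *The relative bar resolution.* $\beta_S(R,A,A)$ is the simplicial right $A$-complex which in simplicial degree $n$ is $R\otimes_S A\otimes_S\cdots\otimes_S A$ with $n+1$ factors $A$; here $A$ acts by right multiplication on the last factor and, on elements $1\otimes a_0\otimes\cdots\otimes a_n$, the face $d_0$ applies the augmentation to $a_0$, the face $d_j$ ($1\le j\le n$)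 multiplies $a_{j-1}$ and $a_j$, and the degeneracy $s_j$ ($0\le j\le n$) inserts $1$ as the factor with index $j$. It is augmented, in simplicial degree $0$, by $1\otimes a\mapsto\varepsilon(a)$. *The simplicial Weil coalgebra.* For a Lie algebra $\mathfrak h$ let $\Lambda'_\partial[s\mathfrak h]$ be the exterior coalgebra on $s\mathfrak h$ with the Cartan–Chevalley–Eilenberg differential, normalized by $\partial(sx\wedge sy)=s[y,x]$. It is a right $\mathrm U[C\mathfrak h]$-complex, where $x\in\mathfrak h$ acts by $w\cdot x=-\mathrm{ad}_x w$ and $sy$ acts by $w\cdot sy=w\wedge sy$. Let $E\mathfrak g$ be the simplicial Lie algebra with $(E\mathfrak g)_n=\mathfrak g^{n+1}$, whose faces omit a component and whose degeneracies repeat a component. The simplicial Weil coalgebra $\Lambda'_\partial[sE\mathfrak g]$ is, in simplicial degree $n$, the complex $\Lambda'_\partial[s(\mathfrak g^{n+1})]$, on which $A$ acts through the diagonal $\mathfrak g\to\mathfrak g^{n+1}$. It is augmented, in simplicial degree $0$, by the projection $\Lambda'_\partial[s\mathfrak g]\to R$. *The isomorphism $\Phi$.* Let $(E\mathfrak g)^{\mathrm{right}}$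 be the nonhomogeneous form of $E\mathfrak g$: the simplicial $R$-module which is $\mathfrak g^{n+1}$ in degree $n$, with $$d_0(x_0,\dots,x_n)=(x_1,\dots,x_n),\qquad d_j(x_0,\dots,x_n)=(x_0,\dots,x_{j-1}+x_j,\dots,x_n)\ (1\le j\le n),$$ $$s_j(x_0,\dots,x_n)=(x_0,\dots,x_{j-1},0,x_j,\dots,x_n)\ (0\le j\le n).$$ Let $\Phi\colon(E\mathfrak g)^{\mathrm{right}}\to E\mathfrak g$ be the isomorphism of simplicial $R$-modules given in degree $n$ by $$\Phi_n(x_0,\dots,x_n)=(x_0+x_1+\cdots+x_n,\ \dots,\ x_{n-1}+x_n,\ x_n).$$ **Theorem 4.5.** The isomorphism $\Phi$ induces an isomorphism $$\Psi\colon\beta_{\mathrm U[\mathfrak g]}(R,\mathrm U[C\mathfrak g],\mathrm U[C\mathfrak g])\longrightarrow\Lambda'_\partial[sE\mathfrak g]$$ of simplicial right $\mathrm U[C\mathfrak g]$-complexes: for all $n\ge 0$ and $w_0,\dots,w_n\in\Lambda[s\mathfrak g]$, $$\Psi_n(1\otimes w_0\otimes\cdots\otimes w_n)=\Lambda(s\Phi_n)\bigl(\mathrm{in}_0(w_0)\wedge\cdots\wedge\mathrm{in}_n(w_n)\bigr),$$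 where $\mathrm{in}_i\colon\Lambda[s\mathfrak g]\to\Lambda[s(\mathfrak g^{n+1})]$ is induced by the inclusion of $\mathfrak g$ as the component with index $i$ of $\mathfrak g^{n+1}$. The isomorphism $\Psi$ is compatible with the augmentations to $R$. Consequently $\Psi$ induces an isomorphism of chain complexes of right $\mathrm U[C\mathfrak g]$-complexes from the normalized chain complex (quotient by the degenerate elements) of $\beta_{\mathrm U[\mathfrak g]}(R,\mathrm U[C\mathfrak g],\mathrm U[C\mathfrak g])$, that is, from the normalized relative bar resolution of $R$, onto the normalized chain complex $|\Lambda'_\partial[sE\mathfrak g]|$; in this sense $|\Lambda'_\partial[sE\mathfrak g]|$ is the homogeneous form of the normalized relative bar resolution of $R$ in the category of right $\mathrm U[C\mathfrak g]$-modules. -/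

import Mathlib

open CategoryTheory Opposite
open scoped TensorProduct

universe u v w

namespace WeilBar

noncomputable section

/-! ### Graded modules -/

/-- A family of submodules that spans and has a family of projections is an internal grading. -/
theorem isInternal_of_proj {R : Type*} [CommRing R] {V : Type*} [AddCommGroup V] [Module R V]
    (D : ℕ → Submodule R V) (P : ℕ → V →ₗ[R] V) (hP : ∀ k, ∀ x ∈ D k, P k x = x)
    (hP' : ∀ k l, k ≠ l → ∀ x ∈ D l, P k x = 0) (htop : ⨆ k, D k = ⊤) :
    DirectSum.IsInternal D := by
  classical
  refine DirectSum.isInternal_submodule_of_iSupIndep_of_iSup_eq_top ?_ htop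
  intro k
  rw [Submodule.disjoint_def]
  intro x hx hx'
  have h0 : (⨆ j, ⨆ (_ : j ≠ k), D j) ≤ LinearMap.ker (P k) := by
    refine iSup_le fun j => iSup_le fun hj y hy => ?_
    exact hP' k j (Ne.symm hj) y hy
  rw [← hP k x hx]
  exact h0 hx'

/-! ### Finite powers of a Lie algebra -/

/-- The power `𝔤^I` of a Lie algebra, with the componentwise bracket. -/
instance powLieRing {I : Type*} {g : Type v} [LieRing g] : LieRing (I → g) where
  bracket x y := fun i => ⁅x i, y i⁆
  add_lie x y z := funext fun i => add_lie (x i) (y i) (z i)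
  lie_add x y z := funext fun i => lie_add (x i) (y i) (z i)
  lie_self x := funext fun i => lie_self (x i)
  leibniz_lie x y z := funext fun i => leibniz_lie (x i) (y i) (z i)

theorem pow_lie_apply {I : Type*} {g : Type v} [LieRing g] (x y : I → g) (i : I) :
    ⁅x, y⁆ i = ⁅x i, y i⁆ := rfl

instance powLieAlgebra {I : Type*} {R : Type u} [CommRing R] {g : Type v} [LieRing g]
    [LieAlgebra R g] : LieAlgebra R (I → g) where
  lie_smul t x y := funext fun i => lie_smul t (x i) (y i)

/-- The map `𝔤^J → 𝔤^I` of Lie algebras given by reindexing along `f : I → J`. -/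
def reindexLie (R : Type u) [CommRing R] (g : Type v) [LieRing g] [LieAlgebra R g] {I J : Type*}
    (f : I → J) : (J → g) →ₗ⁅R⁆ (I → g) where
  toLinearMap := LinearMap.funLeft R g f
  map_lie' := rfl

@[simp] theorem reindexLie_apply (R : Type u) [CommRing R] (g : Type v) [LieRing g]
    [LieAlgebra R g] {I J : Type*} (f : I → J) (x : J → g) (i : I) :
    reindexLie R g f x i = x (f i) := rfl

/-- The diagonal `𝔤 → 𝔤^I`. -/
def diagLie (R : Type u) [CommRing R] (g : Type v) [LieRing g] [LieAlgebra R g] (I : Type*) :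
    g →ₗ⁅R⁆ (I → g) where
  toFun x := fun _ => x
  map_add' _ _ := rfl
  map_smul' _ _ := rfl
  map_lie' := rfl

@[simp] theorem diagLie_apply (R : Type u) [CommRing R] (g : Type v) [LieRing g]
    [LieAlgebra R g] (I : Type*) (x : g) (i : I) : diagLie R g I x i = x := rfl

theorem countP_inr {g : Type*} (y : g) (l : List (g ⊕ g)) :
    (Sum.inr y :: l).countP Sum.isRight = l.countP Sum.isRight + 1 := by
  rw [List.countP_cons]; rfl

theorem countP_inl {g : Type*} (y : g) (l : List (g ⊕ g)) :
    (Sum.inl y :: l).countP Sum.isRight = l.countP Sum.isRight := by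
  rw [List.countP_cons]; rfl

/-! ### The universal enveloping algebra of the cone -/

section Cone

variable (R : Type u) [CommRing R] (g : Type v) [LieRing g] [LieAlgebra R g]

/-- The defining relations of `U[C𝔤]`. An element `(x, y)` of `𝔤 × 𝔤` stands for the element
`x + s y` of the cone `C𝔤 = 𝔤 ⊕ s𝔤`; the elements `x` have degree `0`, the elements `s y` have
degree `1`, and the brackets are `[x, y]`, `[x, s y] = s [x, y]`, `[s x, s y] = 0`. The last
relation, `(s y)(s y) = 0`, gives `(s x)(s y) + (s y)(s x) = 0` by polarization, and it is
equivalent to this when `2` is invertible. -/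
inductive ConeRel : TensorAlgebra R (g × g) → TensorAlgebra R (g × g) → Prop
  | lie_lie (x y : g) : ConeRel
      (TensorAlgebra.ι R (x, (0 : g)) * TensorAlgebra.ι R (y, (0 : g)))
      (TensorAlgebra.ι R (y, (0 : g)) * TensorAlgebra.ι R (x, (0 : g)) +
        TensorAlgebra.ι R (⁅x, y⁆, (0 : g)))
  | lie_sus (x y : g) : ConeRel
      (TensorAlgebra.ι R (x, (0 : g)) * TensorAlgebra.ι R ((0 : g), y))
      (TensorAlgebra.ι R ((0 : g), y) * TensorAlgebra.ι R (x, (0 : g)) +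
        TensorAlgebra.ι R ((0 : g), ⁅x, y⁆))
  | sus_sus (y : g) : ConeRel
      (TensorAlgebra.ι R ((0 : g), y) * TensorAlgebra.ι R ((0 : g), y)) 0

/-- The universal enveloping algebra `U[C𝔤]` of the cone `C𝔤` on the Lie algebra `𝔤`. -/
def UCone : Type max u v := RingQuot (ConeRel R g)

instance : Ring (UCone R g) := inferInstanceAs (Ring (RingQuot (ConeRel R g)))
instance : Algebra R (UCone R g) := inferInstanceAs (Algebra R (RingQuot (ConeRel R g)))

namespace UCone

/-- The projection of the tensor algebra. -/
def mk : TensorAlgebra R (g × g) →ₐ[R] UCone R g := RingQuot.mkAlgHom R (ConeRel R g)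

/-- The inclusion of `𝔤 = (C𝔤)₀` into `U[C𝔤]`. -/
def lie : g →ₗ[R] UCone R g :=
  (mk R g).toLinearMap ∘ₗ TensorAlgebra.ι R ∘ₗ LinearMap.inl R g g

/-- The inclusion `y ↦ s y` of `s𝔤 = (C𝔤)₁` into `U[C𝔤]`. -/
def sus : g →ₗ[R] UCone R g :=
  (mk R g).toLinearMap ∘ₗ TensorAlgebra.ι R ∘ₗ LinearMap.inr R g g

variable {R g}

theorem lie_mul_lie (x y : g) :
    lie R g x * lie R g y = lie R g y * lie R g x + lie R g ⁅x, y⁆ := by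
  have := RingQuot.mkAlgHom_rel R (ConeRel.lie_lie (R := R) x y)
  rw [map_mul, map_add, map_mul] at this
  exact this

theorem lie_mul_sus (x y : g) :
    lie R g x * sus R g y = sus R g y * lie R g x + sus R g ⁅x, y⁆ := by
  have := RingQuot.mkAlgHom_rel R (ConeRel.lie_sus (R := R) x y)
  rw [map_mul, map_add, map_mul] at this
  exact this

theorem sus_mul_sus (y : g) : sus R g y * sus R g y = 0 := by
  have := RingQuot.mkAlgHom_rel R (ConeRel.sus_sus (R := R) y)
  rw [map_mul, map_zero] at this
  exact this

/-- The universal property of `U[C𝔤]`. -/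
def lift {B : Type*} [Ring B] [Algebra R B] (a b : g →ₗ[R] B)
    (h₁ : ∀ x y, a x * a y = a y * a x + a ⁅x, y⁆)
    (h₂ : ∀ x y, a x * b y = b y * a x + b ⁅x, y⁆)
    (h₃ : ∀ y, b y * b y = 0) : UCone R g →ₐ[R] B :=
  RingQuot.liftAlgHom R ⟨TensorAlgebra.lift R (a.coprod b), by
    intro p q hpq
    induction hpq with
    | lie_lie x y => simpa using h₁ x y
    | lie_sus x y => simpa using h₂ x y
    | sus_sus y => simpa using h₃ y⟩

section
variable {B : Type*} [Ring B] [Algebra R B] (a b : g →ₗ[R] B)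
    (h₁ : ∀ x y, a x * a y = a y * a x + a ⁅x, y⁆)
    (h₂ : ∀ x y, a x * b y = b y * a x + b ⁅x, y⁆)
    (h₃ : ∀ y, b y * b y = 0)

@[simp] theorem lift_lie (x : g) : lift a b h₁ h₂ h₃ (lie R g x) = a x := by
  have := RingQuot.liftAlgHom_mkAlgHom_apply R (TensorAlgebra.lift R (a.coprod b)) (by
    intro p q hpq
    induction hpq with
    | lie_lie x y => simpa using h₁ x y
    | lie_sus x y => simpa using h₂ x y
    | sus_sus y => simpa using h₃ y : ∀ ⦃p q⦄, ConeRel R g p q → _) (TensorAlgebra.ι R (x, (0 : g)))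
  exact this.trans (by simp)

@[simp] theorem lift_sus (y : g) : lift a b h₁ h₂ h₃ (sus R g y) = b y := by
  have := RingQuot.liftAlgHom_mkAlgHom_apply R (TensorAlgebra.lift R (a.coprod b)) (by
    intro p q hpq
    induction hpq with
    | lie_lie x y => simpa using h₁ x y
    | lie_sus x y => simpa using h₂ x y
    | sus_sus y => simpa using h₃ y : ∀ ⦃p q⦄, ConeRel R g p q → _) (TensorAlgebra.ι R ((0 : g), y))
  exact this.trans (by simp)
end

theorem mk_surjective : Function.Surjective (mk R g) := RingQuot.mkAlgHom_surjective R _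

@[elab_as_elim]
theorem induction {P : UCone R g → Prop} (algebraMap : ∀ r : R, P (algebraMap R _ r))
    (lie : ∀ x, P (lie R g x)) (sus : ∀ y, P (sus R g y))
    (mul : ∀ a b, P a → P b → P (a * b)) (add : ∀ a b, P a → P b → P (a + b)) (a : UCone R g) :
    P a := by
  obtain ⟨t, rfl⟩ := mk_surjective a
  induction t using TensorAlgebra.induction with
  | algebraMap r => rw [AlgHom.commutes]; exact algebraMap r
  | ι z =>
    have : z = (z.1, 0) + (0, z.2) := by simp
    rw [this, map_add, map_add]
    exact add _ _ (lie z.1) (sus z.2)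
  | mul a b ha hb => rw [map_mul]; exact mul _ _ ha hb
  | add a b ha hb => rw [map_add]; exact add _ _ ha hb

theorem hom_ext {B : Type*} [Semiring B] [Algebra R B] {φ ψ : UCone R g →ₐ[R] B}
    (h₁ : ∀ x, φ (lie R g x) = ψ (lie R g x)) (h₂ : ∀ y, φ (sus R g y) = ψ (sus R g y)) :
    φ = ψ := by
  ext a
  induction a using UCone.induction with
  | algebraMap r => simp
  | lie x => exact h₁ x
  | sus y => exact h₂ y
  | mul a b ha hb => simp [ha, hb]
  | add a b ha hb => simp [ha, hb]

variable (R g)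

/-- The augmentation of `U[C𝔤]`. -/
def counit : UCone R g →ₐ[R] R := lift 0 0 (by simp) (by simp) (by simp)

@[simp] theorem counit_lie (x : g) : counit R g (lie R g x) = 0 := by simp [counit]
@[simp] theorem counit_sus (x : g) : counit R g (sus R g x) = 0 := by simp [counit]

/-- The inclusion `U[𝔤] → U[C𝔤]`. -/
def incl : UniversalEnvelopingAlgebra R g →ₐ[R] UCone R g :=
  letI : LieRing (UCone R g) := LieRing.ofAssociativeRing
  letI : LieAlgebra R (UCone R g) := LieAlgebra.ofAssociativeAlgebra
  UniversalEnvelopingAlgebra.lift R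
    { lie R g with
      map_lie' := fun {x y} => by
        have := lie_mul_lie (R := R) x y
        simp [LieRing.of_associative_ring_bracket, this] }

@[simp] theorem incl_ι (x : g) : incl R g (UniversalEnvelopingAlgebra.ι R x) = lie R g x := by
  rw [incl, UniversalEnvelopingAlgebra.lift_ι_apply]; rfl

/-- The inclusion `Λ[s𝔤] → U[C𝔤]` of algebras. -/
def inclExt : ExteriorAlgebra R g →ₐ[R] UCone R g :=
  ExteriorAlgebra.lift R ⟨sus R g, sus_mul_sus⟩

@[simp] theorem inclExt_ι (y : g) : inclExt R g (ExteriorAlgebra.ι R y) = sus R g y := by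
  simp [inclExt]

/-- The algebra automorphism `a ↦ (-1)^|a| a`. -/
def par : UCone R g →ₐ[R] UCone R g :=
  lift (lie R g) (-sus R g) lie_mul_lie
    (fun x y => by
      simp only [LinearMap.neg_apply, mul_neg, neg_mul, lie_mul_sus x y]; abel)
    (fun y => by simp [sus_mul_sus])

@[simp] theorem par_lie (x : g) : par R g (lie R g x) = lie R g x := by simp [par]
@[simp] theorem par_sus (x : g) : par R g (sus R g x) = -sus R g x := by simp [par]

/-- Auxiliary homomorphism `a ↦ [[(-1)^|a| a, d a], [0, a]]` which encodes the differential. -/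
def rho : UCone R g →ₐ[R] Matrix (Fin 2) (Fin 2) (UCone R g) :=
  lift
    { toFun := fun x => !![lie R g x, 0; 0, lie R g x]
      map_add' := fun x y => by ext i j; fin_cases i <;> fin_cases j <;> simp
      map_smul' := fun r x => by ext i j; fin_cases i <;> fin_cases j <;> simp }
    { toFun := fun y => !![-sus R g y, lie R g y; 0, sus R g y]
      map_add' := fun x y => by ext i j; fin_cases i <;> fin_cases j <;> simp [add_comm]
      map_smul' := fun r x => by ext i j; fin_cases i <;> fin_cases j <;> simp }
    (fun x y => by
      simp [lie_mul_lie x y])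
    (fun x y => by
      simp [lie_mul_sus x y, lie_mul_lie x y]; abel)
    (fun y => by
      ext i j
      fin_cases i <;> fin_cases j <;> simp [sus_mul_sus, lie_mul_sus y y])

theorem rho_lie (x : g) : rho R g (lie R g x) = !![lie R g x, 0; 0, lie R g x] := by
  simp [rho]

theorem rho_sus (y : g) : rho R g (sus R g y) = !![-sus R g y, lie R g y; 0, sus R g y] := by
  simp [rho]

/-- The differential of `U[C𝔤]`: the derivation of degree `-1` with `d x = 0` and `d (s y) = y`
(see `d_lie`, `d_sus`, `d_mul`). -/
def d : UCone R g →ₗ[R] UCone R g where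
  toFun a := rho R g a 0 1
  map_add' a b := by simp
  map_smul' r a := by simp

variable {R g}

theorem rho_eq (a : UCone R g) : rho R g a = !![par R g a, d R g a; 0, a] := by
  have key : rho R g a 0 0 = par R g a ∧ rho R g a 1 0 = 0 ∧ rho R g a 1 1 = a := by
    induction a using UCone.induction with
    | algebraMap r => simp [Matrix.algebraMap_matrix_apply]
    | lie x => simp [rho_lie]
    | sus y => simp [rho_sus]
    | mul a b ha hb =>
      simp [Matrix.mul_apply, Fin.sum_univ_two, ha, hb]
    | add a b ha hb => simp [ha, hb]
  ext i j
  fin_cases i <;> fin_cases j <;> simp [key, d]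

theorem d_lie (x : g) : d R g (lie R g x) = 0 := by simp [d, rho_lie]

theorem d_sus (y : g) : d R g (sus R g y) = lie R g y := by simp [d, rho_sus]

theorem d_mul (a b : UCone R g) : d R g (a * b) = d R g a * b + par R g a * d R g b := by
  have : d R g (a * b) = (rho R g a * rho R g b) 0 1 := by rw [← map_mul]; rfl
  rw [this, rho_eq a, rho_eq b]
  simp [Matrix.mul_apply, Fin.sum_univ_two, add_comm]

theorem d_algebraMap (r : R) : d R g (algebraMap R _ r) = 0 := by
  have : d R g (algebraMap R _ r) = rho R g (algebraMap R _ r) 0 1 := rfl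
  rw [this, AlgHom.commutes]
  simp [Matrix.algebraMap_matrix_apply]

theorem d_one : d R g 1 = 0 := by simpa using d_algebraMap (g := g) (1 : R)

theorem d_par (a : UCone R g) : d R g (par R g a) = -par R g (d R g a) := by
  induction a using UCone.induction with
  | algebraMap r => simp [d_algebraMap]
  | lie x => simp [d_lie]
  | sus y => simp [d_sus]
  | mul a b ha hb => simp [d_mul, ha, hb]; abel
  | add a b ha hb => simp [ha, hb]; abel

theorem d_d (a : UCone R g) : d R g (d R g a) = 0 := by
  induction a using UCone.induction with
  | algebraMap r => simp [d_algebraMap]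
  | lie x => simp [d_lie]
  | sus y => simp [d_sus, d_lie]
  | mul a b ha hb => simp [d_mul, ha, hb, d_par]
  | add a b ha hb => simp [ha, hb]

theorem counit_par (a : UCone R g) : counit R g (par R g a) = counit R g a := by
  have : (counit R g).comp (par R g) = counit R g := hom_ext (by simp) (by simp)
  exact DFunLike.congr_fun this a

theorem counit_d (a : UCone R g) : counit R g (d R g a) = 0 := by
  induction a using UCone.induction with
  | algebraMap r => simp [d_algebraMap]
  | lie x => simp [d_lie]
  | sus y => simp [d_sus]
  | mul a b ha hb => simp [d_mul, ha, hb]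
  | add a b ha hb => simp [ha, hb]

theorem env_induction {P : UniversalEnvelopingAlgebra R g → Prop}
    (algebraMap : ∀ r : R, P (algebraMap R _ r))
    (ι : ∀ x, P (UniversalEnvelopingAlgebra.ι R x))
    (mul : ∀ a b, P a → P b → P (a * b)) (add : ∀ a b, P a → P b → P (a + b))
    (s : UniversalEnvelopingAlgebra R g) : P s := by
  have hs : Function.Surjective (UniversalEnvelopingAlgebra.mkAlgHom R g) :=
    RingCon.mkₐ_surjective _
  obtain ⟨t, rfl⟩ := hs s
  induction t using TensorAlgebra.induction with
  | algebraMap r => rw [AlgHom.commutes]; exact algebraMap r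
  | ι z => exact ι z
  | mul a b ha hb => rw [map_mul]; exact mul _ _ ha hb
  | add a b ha hb => rw [map_add]; exact add _ _ ha hb

theorem par_incl (s : UniversalEnvelopingAlgebra R g) : par R g (incl R g s) = incl R g s := by
  induction s using env_induction with
  | algebraMap r => simp
  | ι x => rw [incl_ι, par_lie]
  | mul a b ha hb => simp [ha, hb]
  | add a b ha hb => simp [ha, hb]

theorem d_incl (s : UniversalEnvelopingAlgebra R g) : d R g (incl R g s) = 0 := by
  induction s using env_induction with
  | algebraMap r => simp [d_algebraMap]
  | ι x => rw [incl_ι, d_lie]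
  | mul a b ha hb => simp [ha, hb, d_mul]
  | add a b ha hb => simp [ha, hb]

variable (R g)

/-- The degree `k` part of `U[C𝔤]`, spanned by the products of elements of `𝔤` and of `s𝔤` with
exactly `k` factors in `s𝔤`. -/
def deg (k : ℕ) : Submodule R (UCone R g) :=
  Submodule.span R {a | ∃ l : List (g ⊕ g), l.countP Sum.isRight = k ∧
    a = (l.map (Sum.elim (lie R g) (sus R g))).prod}

/-- Auxiliary homomorphism `a ↦ a X^|a|` which encodes the grading. -/
def wt : UCone R g →ₐ[R] Polynomial (UCone R g) :=
  lift
    { toFun := fun x => Polynomial.C (lie R g x)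
      map_add' := fun x y => by simp
      map_smul' := fun r x => by simp }
    { toFun := fun y => Polynomial.monomial 1 (sus R g y)
      map_add' := fun x y => by simp
      map_smul' := fun r x => by rw [map_smul, RingHom.id_apply, Polynomial.smul_monomial] }
    (fun x y => by
      simp [← map_mul, lie_mul_lie x y])
    (fun x y => by
      simp [lie_mul_sus x y, Polynomial.C_mul_monomial, Polynomial.monomial_mul_C])
    (fun y => by
      simp [sus_mul_sus, Polynomial.monomial_mul_monomial])

@[simp] theorem wt_lie (x : g) : wt R g (lie R g x) = Polynomial.C (lie R g x) := by simp [wt]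
@[simp] theorem wt_sus (x : g) : wt R g (sus R g x) = Polynomial.monomial 1 (sus R g x) := by
  simp [wt]

/-- The projection of `U[C𝔤]` onto its degree `k` part. -/
def proj (k : ℕ) : UCone R g →ₗ[R] UCone R g where
  toFun a := (wt R g a).coeff k
  map_add' a b := by simp
  map_smul' r a := by simp

variable {R g}

theorem wt_incl (s : UniversalEnvelopingAlgebra R g) :
    wt R g (incl R g s) = Polynomial.C (incl R g s) := by
  induction s using env_induction with
  | algebraMap r => simp [Polynomial.algebraMap_apply]
  | ι x => rw [incl_ι, wt_lie]
  | mul a b ha hb => simp [ha, hb]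
  | add a b ha hb => simp [ha, hb]

theorem wt_of_mem {k : ℕ} {a : UCone R g} (ha : a ∈ deg R g k) :
    wt R g a = Polynomial.monomial k a := by
  induction ha using Submodule.span_induction with
  | mem a h =>
    obtain ⟨l, rfl, rfl⟩ := h
    induction l with
    | nil => simp
    | cons z l ih =>
      rcases z with x | y
      · simp [ih, Polynomial.C_mul_monomial]
      · simp [ih, Polynomial.monomial_mul_monomial, countP_inr, add_comm]
  | zero => simp
  | add a b _ _ ha hb => simp [ha, hb]
  | smul r a _ ha => rw [map_smul, ha, Polynomial.smul_monomial]

theorem proj_of_mem {k : ℕ} {a : UCone R g} (ha : a ∈ deg R g k) : proj R g k a = a := by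
  simp [proj, wt_of_mem ha]

theorem proj_of_mem_ne {k l : ℕ} (h : k ≠ l) {a : UCone R g} (ha : a ∈ deg R g l) :
    proj R g k a = 0 := by
  simp [proj, wt_of_mem ha, Polynomial.coeff_monomial, h.symm]

theorem proj_incl_mul (k : ℕ) (s : UniversalEnvelopingAlgebra R g) (a : UCone R g) :
    proj R g k (incl R g s * a) = incl R g s * proj R g k a := by
  simp [proj, wt_incl]

theorem proj_mul_incl (k : ℕ) (s : UniversalEnvelopingAlgebra R g) (a : UCone R g) :
    proj R g k (a * incl R g s) = proj R g k a * incl R g s := by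
  simp [proj, wt_incl]

theorem mul_mem {i j : ℕ} {a b : UCone R g} (ha : a ∈ deg R g i) (hb : b ∈ deg R g j) :
    a * b ∈ deg R g (i + j) := by
  induction ha using Submodule.span_induction with
  | mem a h =>
    obtain ⟨l, rfl, rfl⟩ := h
    induction hb using Submodule.span_induction with
    | mem b h =>
      obtain ⟨l', rfl, rfl⟩ := h
      exact Submodule.subset_span ⟨l ++ l', by simp, by simp⟩
    | zero => simp
    | add a b _ _ ha hb => rw [mul_add]; exact add_mem ha hb
    | smul r a _ ha => rw [mul_smul_comm]; exact Submodule.smul_mem _ _ ha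
  | zero => simp
  | add a b _ _ ha hb => rw [add_mul]; exact add_mem ha hb
  | smul r a _ ha => rw [smul_mul_assoc]; exact Submodule.smul_mem _ _ ha

theorem lie_mem (x : g) : lie R g x ∈ deg R g 0 :=
  Submodule.subset_span ⟨[Sum.inl x], by simp, by simp⟩

theorem sus_mem (y : g) : sus R g y ∈ deg R g 1 :=
  Submodule.subset_span ⟨[Sum.inr y], by simp, by simp⟩

theorem one_mem : (1 : UCone R g) ∈ deg R g 0 :=
  Submodule.subset_span ⟨[], by simp, by simp⟩

theorem iSup_deg : ⨆ k, deg R g k = ⊤ := by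
  rw [eq_top_iff]
  rintro a -
  induction a using UCone.induction with
  | algebraMap r =>
    rw [Algebra.algebraMap_eq_smul_one]
    exact Submodule.smul_mem _ _ (Submodule.mem_iSup_of_mem 0 one_mem)
  | lie x => exact Submodule.mem_iSup_of_mem 0 (lie_mem x)
  | sus y => exact Submodule.mem_iSup_of_mem 1 (sus_mem y)
  | mul a b ha hb =>
    induction ha using Submodule.iSup_induction' with
    | mem i a ha =>
      induction hb using Submodule.iSup_induction' with
      | mem j b hb => exact Submodule.mem_iSup_of_mem (i + j) (mul_mem ha hb)
      | zero => simp
      | add _ _ _ _ h h' => rw [mul_add]; exact add_mem h h'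
    | zero => simp
    | add _ _ _ _ h h' => rw [add_mul]; exact add_mem h h'
  | add a b ha hb => exact add_mem ha hb

/-- `U[C𝔤]` is a graded `R`-module. -/
theorem isInternal_deg : DirectSum.IsInternal (deg R g) :=
  isInternal_of_proj _ (proj R g) (fun _ _ h => proj_of_mem h)
    (fun _ _ h _ hx => proj_of_mem_ne h hx) iSup_deg

theorem par_of_mem {k : ℕ} {a : UCone R g} (ha : a ∈ deg R g k) :
    par R g a = (-1 : R) ^ k • a := by
  induction ha using Submodule.span_induction with
  | mem a h =>
    obtain ⟨l, rfl, rfl⟩ := h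
    induction l with
    | nil => simp
    | cons z l ih =>
      rcases z with x | y
      · simp [ih]
      · simp [ih, countP_inr, pow_succ]
  | zero => simp
  | add a b _ _ ha hb => simp [ha, hb]
  | smul r a _ ha => rw [map_smul, ha, smul_comm]

theorem d_mem_aux {k : ℕ} {a : UCone R g} (ha : a ∈ deg R g k) :
    (∀ j, k = j + 1 → d R g a ∈ deg R g j) ∧ (k = 0 → d R g a = 0) := by
  induction ha using Submodule.span_induction with
  | mem a h =>
    obtain ⟨l, rfl, rfl⟩ := h
    induction l with
    | nil => simp [d_one]
    | cons z l ih =>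
      rcases z with x | y
      · refine ⟨fun j hj => ?_, fun h0 => ?_⟩
        · have := mul_mem (lie_mem x) (ih.1 j (by simpa using hj))
          simpa [d_mul, d_lie] using this
        · simp [d_mul, d_lie, ih.2 (by simpa using h0)]
      · refine ⟨fun j hj => ?_, fun h0 => by rw [countP_inr] at h0; omega⟩
        have hj' : l.countP Sum.isRight = j := by rw [countP_inr] at hj; omega
        have h1 : lie R g y * (l.map (Sum.elim (lie R g) (sus R g))).prod ∈ deg R g j := by
          have := mul_mem (R := R) (lie_mem y)
            (Submodule.subset_span ⟨l, hj', rfl⟩ :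
              (l.map (Sum.elim (lie R g) (sus R g))).prod ∈ deg R g j)
          simpa using this
        have h2 : sus R g y * d R g (l.map (Sum.elim (lie R g) (sus R g))).prod ∈ deg R g j := by
          rcases j with _ | j
          · rw [ih.2 hj']; simp
          · have := mul_mem (sus_mem y) (ih.1 j hj')
            rwa [add_comm] at this
        simpa [d_mul, d_sus] using add_mem h1 (neg_mem h2)
  | zero => simp
  | add a b _ _ ha hb =>
    refine ⟨fun j hj => ?_, fun h0 => by simp [ha.2 h0, hb.2 h0]⟩
    rw [map_add]; exact add_mem (ha.1 j hj) (hb.1 j hj)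
  | smul r a _ ha =>
    refine ⟨fun j hj => ?_, fun h0 => by simp [ha.2 h0]⟩
    rw [map_smul]; exact Submodule.smul_mem _ _ (ha.1 j hj)

theorem d_mem {k : ℕ} {a : UCone R g} (ha : a ∈ deg R g (k + 1)) : d R g a ∈ deg R g k :=
  (d_mem_aux ha).1 k rfl

theorem d_mem_zero {a : UCone R g} (ha : a ∈ deg R g 0) : d R g a = 0 := (d_mem_aux ha).2 rfl

theorem counit_of_mem {k : ℕ} (hk : k ≠ 0) {a : UCone R g} (ha : a ∈ deg R g k) :
    counit R g a = 0 := by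
  induction ha using Submodule.span_induction with
  | mem a h =>
    obtain ⟨l, rfl, rfl⟩ := h
    rcases l with _ | ⟨z, l⟩
    · simp at hk
    · rcases z with x | y <;> simp
  | zero => simp
  | add a b _ _ ha hb => simp [ha, hb]
  | smul r a _ ha => simp [ha]

variable {h : Type w} [LieRing h] [LieAlgebra R h]

/-- The map `U[C𝔤] → U[C𝔥]` induced by a morphism `𝔤 → 𝔥` of Lie algebras. -/
def map (φ : g →ₗ⁅R⁆ h) : UCone R g →ₐ[R] UCone R h :=
  lift (lie R h ∘ₗ (φ : g →ₗ[R] h)) (sus R h ∘ₗ (φ : g →ₗ[R] h))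
    (fun x y => by simp [lie_mul_lie (φ x) (φ y)])
    (fun x y => by simp [lie_mul_sus (φ x) (φ y)])
    (fun y => by simp [sus_mul_sus])

@[simp] theorem map_lie (φ : g →ₗ⁅R⁆ h) (x : g) : map φ (lie R g x) = lie R h (φ x) := by
  simp [map]
@[simp] theorem map_sus (φ : g →ₗ⁅R⁆ h) (x : g) : map φ (sus R g x) = sus R h (φ x) := by
  simp [map]

theorem map_par (φ : g →ₗ⁅R⁆ h) (a : UCone R g) : map φ (par R g a) = par R h (map φ a) := by
  have : (map φ).comp (par R g) = (par R h).comp (map φ) := hom_ext (by simp) (by simp)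
  exact DFunLike.congr_fun this a

theorem map_d (φ : g →ₗ⁅R⁆ h) (a : UCone R g) : map φ (d R g a) = d R h (map φ a) := by
  induction a using UCone.induction with
  | algebraMap r => simp [d_algebraMap]
  | lie x => simp [d_lie]
  | sus y => simp [d_sus]
  | mul a b ha hb => simp [d_mul, ha, hb, map_par]
  | add a b ha hb => simp [ha, hb]

theorem map_mem (φ : g →ₗ⁅R⁆ h) {k : ℕ} {a : UCone R g} (ha : a ∈ deg R g k) :
    map φ a ∈ deg R h k := by
  induction ha using Submodule.span_induction with
  | mem a ha =>
    obtain ⟨l, rfl, rfl⟩ := ha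
    refine Submodule.subset_span ⟨l.map (Sum.map φ φ), ?_, ?_⟩
    · rw [List.countP_map]; congr 1; ext z; cases z <;> rfl
    · rw [map_list_prod, List.map_map, List.map_map]; congr 2; ext z; cases z <;> simp
  | zero => simp
  | add a b _ _ ha hb => rw [map_add]; exact add_mem ha hb
  | smul r a _ ha => rw [map_smul]; exact Submodule.smul_mem _ _ ha

end UCone
end Cone

/-! ### Right differential graded modules over `U[C𝔤]` -/

section DGMod

variable (R : Type u) [CommRing R] (g : Type v) [LieRing g] [LieAlgebra R g]

/-- A right `U[C𝔤]`-complex: a differential graded right module over the differential graded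
algebra `U[C𝔤]`, concentrated in degrees `≥ 0`; `act x a` is the product `x · a`. -/
structure DGMod where
  /-- the underlying `R`-module -/
  carrier : Type (max u v)
  [addCommGroup : AddCommGroup carrier]
  [module : Module R carrier]
  /-- the homogeneous parts -/
  deg : ℕ → Submodule R carrier
  isInternal : DirectSum.IsInternal deg
  /-- the differential -/
  d : carrier →ₗ[R] carrier
  d_mem : ∀ (k : ℕ) (x : carrier), x ∈ deg (k + 1) → d x ∈ deg k
  d_zero : ∀ x : carrier, x ∈ deg 0 → d x = 0
  d_d : ∀ x : carrier, d (d x) = 0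
  /-- the right action -/
  act : carrier →ₗ[R] UCone R g →ₗ[R] carrier
  act_one : ∀ x : carrier, act x 1 = x
  act_mul : ∀ (x : carrier) (a b : UCone R g), act x (a * b) = act (act x a) b
  act_mem : ∀ (i j : ℕ) (x : carrier) (a : UCone R g), x ∈ deg i → a ∈ UCone.deg R g j →
    act x a ∈ deg (i + j)
  d_act : ∀ (i : ℕ) (x : carrier) (a : UCone R g), x ∈ deg i →
    d (act x a) = act (d x) a + (-1 : R) ^ i • act x (UCone.d R g a)

namespace DGMod

variable {R g}

attribute [instance] addCommGroup module

/-- Morphisms of right `U[C𝔤]`-complexes. -/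
@[ext]
structure Hom (V W : DGMod R g) where
  /-- the underlying linear map -/
  lin : V.carrier →ₗ[R] W.carrier
  map_deg : ∀ (k : ℕ) (x : V.carrier), x ∈ V.deg k → lin x ∈ W.deg k
  map_d : ∀ x : V.carrier, lin (V.d x) = W.d (lin x)
  map_act : ∀ (x : V.carrier) (a : UCone R g), lin (V.act x a) = W.act (lin x) a

/-- The category of right `U[C𝔤]`-complexes. -/
instance : Category (DGMod R g) where
  Hom := Hom
  id V := ⟨LinearMap.id, fun _ _ h => h, fun _ => rfl, fun _ _ => rfl⟩
  comp f f' := ⟨f'.lin ∘ₗ f.lin, fun k x h => f'.map_deg k _ (f.map_deg k x h),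
    fun x => by simp [f.map_d, f'.map_d], fun x a => by simp [f.map_act, f'.map_act]⟩

variable {V W Z : DGMod R g}

@[ext] theorem hom_ext {f f' : V ⟶ W} (h : f.lin = f'.lin) : f = f' := Hom.ext h

@[simp] theorem id_lin : (𝟙 V : V ⟶ V).lin = LinearMap.id := rfl
@[simp] theorem comp_lin (f : V ⟶ W) (f' : W ⟶ Z) : (f ≫ f').lin = f'.lin ∘ₗ f.lin := rfl

instance : Zero (V ⟶ W) := ⟨⟨0, fun _ _ _ => zero_mem _, fun _ => by simp, fun _ _ => by simp⟩⟩
instance : Add (V ⟶ W) := ⟨fun f f' => ⟨f.lin + f'.lin,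
  fun k x h => add_mem (f.map_deg k x h) (f'.map_deg k x h),
  fun x => by simp [f.map_d, f'.map_d], fun x a => by simp [f.map_act, f'.map_act]⟩⟩
instance : Neg (V ⟶ W) := ⟨fun f => ⟨-f.lin,
  fun k x h => neg_mem (f.map_deg k x h),
  fun x => by simp [f.map_d], fun x a => by simp [f.map_act]⟩⟩

@[simp] theorem zero_lin : (0 : V ⟶ W).lin = 0 := rfl
@[simp] theorem add_lin (f f' : V ⟶ W) : (f + f').lin = f.lin + f'.lin := rfl
@[simp] theorem neg_lin (f : V ⟶ W) : (-f).lin = -f.lin := rfl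

instance : AddCommGroup (V ⟶ W) where
  add_assoc a b c := hom_ext (add_assoc _ _ _)
  zero_add a := hom_ext (zero_add _)
  add_zero a := hom_ext (add_zero _)
  add_comm a b := hom_ext (add_comm _ _)
  neg_add_cancel a := hom_ext (neg_add_cancel _)
  nsmul := nsmulRec
  zsmul := zsmulRec

instance : Preadditive (DGMod R g) where
  add_comp P Q S f f' h := hom_ext (by ext x; simp)
  comp_add P Q S f h h' := hom_ext (by ext x; simp)

/-- The underlying linear map, as an additive map. -/
def linHom (V W : DGMod R g) : (V ⟶ W) →+ (V.carrier →ₗ[R] W.carrier) where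
  toFun f := f.lin
  map_zero' := rfl
  map_add' _ _ := rfl

theorem linHom_apply (f : V ⟶ W) : linHom V W f = f.lin := rfl

/-- The projection of a graded module to its degree `k` part. -/
def proj (V : DGMod R g) (k : ℕ) : V.carrier →ₗ[R] V.carrier :=
  (V.deg k).subtype ∘ₗ DirectSum.component R ℕ (fun k => V.deg k) k ∘ₗ
    (LinearEquiv.ofBijective (DirectSum.coeLinearMap V.deg)
      (show Function.Bijective (DirectSum.coeLinearMap V.deg) from V.isInternal)).symm.toLinearMap

theorem proj_of_mem_aux {k l : ℕ} {x : V.carrier} (hx : x ∈ V.deg l) :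
    V.proj k x = if l = k then x else 0 := by
  have hb : Function.Bijective (DirectSum.coeLinearMap V.deg) := V.isInternal
  have : (LinearEquiv.ofBijective (DirectSum.coeLinearMap V.deg) hb).symm x =
      DirectSum.lof R ℕ (fun k => V.deg k) l ⟨x, hx⟩ := by
    rw [LinearEquiv.symm_apply_eq, LinearEquiv.ofBijective_apply, DirectSum.coeLinearMap_lof]
  simp only [proj, LinearMap.comp_apply, LinearEquiv.coe_coe, this]
  split_ifs with h
  · subst h; rw [DirectSum.component.lof_self]; rfl
  · rw [DirectSum.component.of, dif_neg h]; simp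

/-- The quotient of a right `U[C𝔤]`-complex by a homogeneous subcomplex. -/
def quot (V : DGMod R g) (N : Submodule R V.carrier) (hN : N ≤ ⨆ k, N ⊓ V.deg k)
    (hd : ∀ x ∈ N, V.d x ∈ N) (hact : ∀ x ∈ N, ∀ a, V.act x a ∈ N) : DGMod R g where
  carrier := V.carrier ⧸ N
  deg k := (V.deg k).map N.mkQ
  isInternal := by
    have hp : ∀ k, N ≤ N.comap (V.proj k) := by
      intro k
      refine hN.trans (iSup_le fun l x hx => ?_)
      rw [Submodule.mem_comap, proj_of_mem_aux hx.2]
      split_ifs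
      · exact hx.1
      · exact zero_mem _
    refine isInternal_of_proj _ (fun k => N.mapQ N (V.proj k) (hp k)) ?_ ?_ ?_
    · rintro k _ ⟨x, hx, rfl⟩
      simp [proj_of_mem_aux hx]
    · rintro k l hkl _ ⟨x, hx, rfl⟩
      simp [proj_of_mem_aux hx, hkl.symm]
    · rw [← Submodule.map_iSup, V.isInternal.submodule_iSup_eq_top, Submodule.map_top,
        Submodule.range_mkQ]
  d := N.mapQ N V.d hd
  d_mem := by
    rintro k _ ⟨x, hx, rfl⟩
    exact ⟨V.d x, V.d_mem k x hx, rfl⟩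
  d_zero := by
    rintro _ ⟨x, hx, rfl⟩
    simp [V.d_zero x hx]
  d_d x := by
    obtain ⟨x, rfl⟩ := N.mkQ_surjective x
    simp [V.d_d x]
  act := N.liftQ
    { toFun := fun x => N.mkQ ∘ₗ V.act x
      map_add' := fun x y => by ext a; simp
      map_smul' := fun r x => by ext a; simp } (by
        intro x hx
        rw [LinearMap.mem_ker]
        ext a
        simpa using hact x hx a)
  act_one x := by
    obtain ⟨x, rfl⟩ := N.mkQ_surjective x
    simp [V.act_one]
  act_mul x a b := by
    obtain ⟨x, rfl⟩ := N.mkQ_surjective x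
    simp [V.act_mul]
  act_mem := by
    rintro i j _ a ⟨x, hx, rfl⟩ ha
    exact ⟨V.act x a, V.act_mem i j x a hx ha, rfl⟩
  d_act := by
    rintro i _ a ⟨x, hx, rfl⟩
    simp [V.d_act i x a hx]

/-- The map of quotients induced by a morphism. -/
def quotMap (V W : DGMod R g) {N hN hd hact} {N' hN' hd' hact'} (f : V ⟶ W)
    (hf : ∀ x ∈ N, f.lin x ∈ N') :
    V.quot N hN hd hact ⟶ W.quot N' hN' hd' hact' :=
  { lin := N.mapQ N' f.lin hf
    map_deg := by
      rintro k _ ⟨x, hx, rfl⟩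
      exact ⟨f.lin x, f.map_deg k x hx, rfl⟩
    map_d := by
      intro x
      obtain ⟨x, rfl⟩ := N.mkQ_surjective x
      exact congrArg N'.mkQ (f.map_d x)
    map_act := by
      intro x a
      obtain ⟨x, rfl⟩ := N.mkQ_surjective x
      exact congrArg N'.mkQ (f.map_act x a) }

end DGMod

/-! ### Normalization -/

open DGMod

variable {R g}

/-- The submodule of degenerate elements, spanned by the images of the degeneracies. -/
def degen (X : SimplicialObject (DGMod R g)) :
    ∀ n : ℕ, Submodule R (X.obj (op (SimplexCategory.mk n))).carrier
  | 0 => ⊥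
  | n + 1 => ⨆ j : Fin (n + 1), LinearMap.range (X.σ j).lin

theorem range_le_iSup {V W : DGMod R g} (f : V ⟶ W) :
    LinearMap.range f.lin ≤ ⨆ k, LinearMap.range f.lin ⊓ W.deg k := by
  rw [LinearMap.range_eq_map, ← V.isInternal.submodule_iSup_eq_top, Submodule.map_iSup]
  refine iSup_mono fun k => le_inf ?_ ?_
  · rw [← Submodule.map_iSup]
    exact Submodule.map_mono (le_iSup _ k)
  · rintro _ ⟨x, hx, rfl⟩
    exact f.map_deg k x hx

theorem degen_homogeneous (X : SimplicialObject (DGMod R g)) (n : ℕ) :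
    degen X n ≤ ⨆ k, degen X n ⊓ (X.obj (op (SimplexCategory.mk n))).deg k := by
  cases n with
  | zero => exact bot_le
  | succ n =>
    refine iSup_le fun j => (range_le_iSup (X.σ j)).trans (iSup_mono fun k => ?_)
    exact inf_le_inf_right _ (le_iSup (fun j => LinearMap.range (X.σ j).lin) j)

theorem degen_d (X : SimplicialObject (DGMod R g)) (n : ℕ) :
    ∀ x ∈ degen X n, (X.obj (op (SimplexCategory.mk n))).d x ∈ degen X n := by
  cases n with
  | zero =>
    intro x hx
    rw [(Submodule.mem_bot R).1 hx, map_zero]; exact zero_mem _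
  | succ n =>
    have : degen X (n + 1) ≤
        (degen X (n + 1)).comap (X.obj (op (SimplexCategory.mk (n + 1)))).d := by
      refine iSup_le fun j => ?_
      rintro _ ⟨y, rfl⟩
      rw [Submodule.mem_comap, ← (X.σ j).map_d]
      exact Submodule.mem_iSup_of_mem j ⟨_, rfl⟩
    exact this

theorem degen_act (X : SimplicialObject (DGMod R g)) (n : ℕ) :
    ∀ x ∈ degen X n, ∀ a, (X.obj (op (SimplexCategory.mk n))).act x a ∈ degen X n := by
  cases n with
  | zero =>
    intro x hx a
    rw [(Submodule.mem_bot R).1 hx, map_zero]; exact zero_mem _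
  | succ n =>
    intro x hx a
    have : degen X (n + 1) ≤
        (degen X (n + 1)).comap ((X.obj (op (SimplexCategory.mk (n + 1)))).act.flip a) := by
      refine iSup_le fun j => ?_
      rintro _ ⟨y, rfl⟩
      rw [Submodule.mem_comap, LinearMap.flip_apply, ← (X.σ j).map_act]
      exact Submodule.mem_iSup_of_mem j ⟨_, rfl⟩
    exact this hx

theorem degen_map {X Y : SimplicialObject (DGMod R g)} (f : X ⟶ Y) (n : ℕ) :
    ∀ x ∈ degen X n, (f.app (op (SimplexCategory.mk n))).lin x ∈ degen Y n := by
  cases n with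
  | zero =>
    intro x hx
    rw [(Submodule.mem_bot R).1 hx, map_zero]; exact zero_mem _
  | succ n =>
    have : degen X (n + 1) ≤
        (degen Y (n + 1)).comap (f.app (op (SimplexCategory.mk (n + 1)))).lin := by
      refine iSup_le fun j => ?_
      rintro _ ⟨y, rfl⟩
      have h := congrArg (fun q => q.lin y) (SimplicialObject.σ_naturality f j)
      exact Submodule.mem_iSup_of_mem j ⟨_, h.symm⟩
    exact this

theorem degen_face (X : SimplicialObject (DGMod R g)) {n : ℕ} (j : Fin (n + 1)) (i : Fin (n + 2))
    (hi : i ≠ j.castSucc) (hi' : i ≠ j.succ) (y : (X.obj (op (SimplexCategory.mk n))).carrier) :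
    (X.δ i).lin ((X.σ j).lin y) ∈ degen X n := by
  cases n with
  | zero => exfalso; fin_cases j; fin_cases i <;> simp_all
  | succ n =>
    rcases lt_or_gt_of_ne hi with h | h
    · obtain ⟨j, rfl⟩ := Fin.exists_succ_eq.2 (fun h0 : j = 0 => by subst h0; simp at h)
      obtain ⟨i, rfl⟩ := Fin.exists_castSucc_eq.2 (Fin.ne_last_of_lt h)
      have h1 : i ≤ j.castSucc := by
        rw [Fin.lt_def] at h; rw [Fin.le_def]; simp at h ⊢; omega
      have := congrArg (fun q => q.lin y) (X.δ_comp_σ_of_le h1)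
      simp only [comp_lin, LinearMap.comp_apply] at this
      rw [this]
      exact Submodule.mem_iSup_of_mem j ⟨_, rfl⟩
    · have h' : j.succ < i := by
        rw [Fin.lt_def] at h ⊢
        have := fun h => hi' (Fin.ext h)
        simp at h this ⊢; omega
      obtain ⟨i, rfl⟩ := Fin.exists_succ_eq.2 (Fin.ne_zero_of_lt h')
      obtain ⟨j, rfl⟩ := Fin.exists_castSucc_eq.2 (fun h0 : j = Fin.last _ => by
        subst h0; rw [Fin.lt_def] at h'; simp at h'; omega)
      have h1 : j.castSucc < i := by
        rw [Fin.lt_def] at h' ⊢; simp at h' ⊢; omega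
      have := congrArg (fun q => q.lin y) (X.δ_comp_σ_of_gt h1)
      simp only [comp_lin, LinearMap.comp_apply] at this
      rw [this]
      exact Submodule.mem_iSup_of_mem j ⟨_, rfl⟩

theorem degen_objD (X : SimplicialObject (DGMod R g)) (n : ℕ) :
    ∀ x ∈ degen X (n + 1), (AlgebraicTopology.AlternatingFaceMapComplex.objD X n).lin x ∈
      degen X n := by
  have : degen X (n + 1) ≤
      (degen X n).comap (AlgebraicTopology.AlternatingFaceMapComplex.objD X n).lin := by
    refine iSup_le fun j => ?_
    rintro _ ⟨y, rfl⟩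
    rw [Submodule.mem_comap, ← linHom_apply, AlgebraicTopology.AlternatingFaceMapComplex.objD,
      map_sum, LinearMap.sum_apply]
    have hne : j.castSucc ≠ j.succ := (Fin.castSucc_lt_succ).ne
    rw [← Finset.add_sum_erase _ _ (Finset.mem_univ j.castSucc),
      ← Finset.add_sum_erase _ _ (Finset.mem_erase.2 ⟨hne.symm, Finset.mem_univ j.succ⟩),
      ← add_assoc]
    refine add_mem ?_ (sum_mem fun i hi => ?_)
    · have h1 := congrArg (fun q => q.lin y) (X.δ_comp_σ_self (i := j))
      have h2 := congrArg (fun q => q.lin y) (X.δ_comp_σ_succ (i := j))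
      simp only [comp_lin, LinearMap.comp_apply, id_lin, LinearMap.id_apply] at h1 h2
      have : (linHom _ _ ((-1) ^ (j.castSucc : ℕ) • X.δ j.castSucc)) ((X.σ j).lin y) +
          (linHom _ _ ((-1) ^ (j.succ : ℕ) • X.δ j.succ)) ((X.σ j).lin y) = 0 := by
        simp only [map_zsmul, LinearMap.smul_apply, linHom_apply, h1, h2, Fin.val_castSucc,
          Fin.val_succ, pow_succ]
        simp
      rw [this]; exact zero_mem _
    · simp only [Finset.mem_erase] at hi
      simp only [map_zsmul, LinearMap.smul_apply, linHom_apply]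
      exact zsmul_mem (degen_face X j i hi.2.1 hi.1 y) _
  exact this

/-- The degree `n` part of the normalized chain complex: the quotient by the degenerate
elements. -/
def normX (X : SimplicialObject (DGMod R g)) (n : ℕ) : DGMod R g :=
  (X.obj (op (SimplexCategory.mk n))).quot (degen X n) (degen_homogeneous X n) (degen_d X n)
    (degen_act X n)

/-- The operator `Σ (-1)^i d_i` on the normalized chain complex. -/
def normD (X : SimplicialObject (DGMod R g)) (n : ℕ) : normX X (n + 1) ⟶ normX X n :=
  quotMap _ _ (AlgebraicTopology.AlternatingFaceMapComplex.objD X n) (degen_objD X n)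

theorem normD_normD (X : SimplicialObject (DGMod R g)) (n : ℕ) :
    normD X (n + 1) ≫ normD X n = 0 := by
  apply hom_ext
  refine LinearMap.ext fun x => ?_
  obtain ⟨x, rfl⟩ := (degen X (n + 2)).mkQ_surjective x
  have := congrArg (fun q => q.lin x) (AlgebraicTopology.AlternatingFaceMapComplex.d_squared X n)
  exact congrArg (degen X n).mkQ this

/-- The normalized chain complex of a simplicial right `U[C𝔤]`-complex, as a chain complex in
the category of right `U[C𝔤]`-complexes. -/
def normalized (X : SimplicialObject (DGMod R g)) : ChainComplex (DGMod R g) ℕ :=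
  ChainComplex.of (normX X) (normD X) (normD_normD X)

theorem normalized_d (X : SimplicialObject (DGMod R g)) (n : ℕ) :
    (normalized X).d (n + 1) n = normD X n :=
  ChainComplex.of_d (normX X) (normD X) n

/-- The map of normalized chain complexes induced by a simplicial map, in degree `n`. -/
def normMap {X Y : SimplicialObject (DGMod R g)} (f : X ⟶ Y) (n : ℕ) : normX X n ⟶ normX Y n :=
  quotMap _ _ (f.app (op (SimplexCategory.mk n))) (degen_map f n)

theorem normMap_comm {X Y : SimplicialObject (DGMod R g)} (f : X ⟶ Y) (n : ℕ) :
    normMap f (n + 1) ≫ normD Y n = normD X n ≫ normMap f n := by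
  apply hom_ext
  refine LinearMap.ext fun x => ?_
  obtain ⟨x, rfl⟩ := (degen X (n + 1)).mkQ_surjective x
  have := congrArg (fun q => q.lin x) ((AlgebraicTopology.AlternatingFaceMapComplex.map f).comm
    (n + 1) n)
  simp only [AlgebraicTopology.AlternatingFaceMapComplex.obj_d_eq] at this
  exact congrArg (degen Y n).mkQ this

theorem normMap_id (X : SimplicialObject (DGMod R g)) (n : ℕ) : normMap (𝟙 X) n = 𝟙 _ := by
  apply hom_ext
  refine LinearMap.ext fun x => ?_
  obtain ⟨x, rfl⟩ := (degen X n).mkQ_surjective x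
  rfl

theorem normMap_comp {X Y Z : SimplicialObject (DGMod R g)} (f : X ⟶ Y) (f' : Y ⟶ Z) (n : ℕ) :
    normMap (f ≫ f') n = normMap f n ≫ normMap f' n := by
  apply hom_ext
  refine LinearMap.ext fun x => ?_
  obtain ⟨x, rfl⟩ := (degen X n).mkQ_surjective x
  rfl

variable (R g) in
/-- Normalization, as a functor. -/
def normalization : SimplicialObject (DGMod R g) ⥤ ChainComplex (DGMod R g) ℕ where
  obj X := normalized X
  map {X Y} f := ChainComplex.ofHom (X := normalized X) (Y := normalized Y) (normMap f) (by
    intro n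
    rw [normalized_d, normalized_d]
    exact normMap_comm f n)
  map_id X := HomologicalComplex.hom_ext _ _ fun n => normMap_id X n
  map_comp f f' := HomologicalComplex.hom_ext _ _ fun n => normMap_comp f f' n

end DGMod

/-! ### The Cartan-Chevalley-Eilenberg coalgebra -/

section CCE

variable (R : Type u) [CommRing R] (h : Type v) [LieRing h] [LieAlgebra R h]

/-- The derivation `ad_x` of the exterior algebra extending `y ↦ [x, y]`
(see `ad_ι_mul`, `ad_one`, `ad_mul`). -/
def adLin (x : h) : ExteriorAlgebra R h →ₗ[R] (ExteriorAlgebra R h) :=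
  CliffordAlgebra.foldr' (0 : QuadraticForm R h)
    (LinearMap.mk₂ R (fun (m : h) (p : ExteriorAlgebra R h × ExteriorAlgebra R h) => ExteriorAlgebra.ι R ⁅x, m⁆ * p.1 + ExteriorAlgebra.ι R m * p.2)
      (fun m m' p => by simp [add_mul]; abel) (fun r m p => by simp)
      (fun m p p' => by simp [mul_add]; abel) (fun r m p => by simp))
    (fun m w fw => by
      have h1 := ExteriorAlgebra.ι_add_mul_swap (R := R) ⁅x, m⁆ m
      have h2 := ExteriorAlgebra.ι_sq_zero (R := R) m
      change ExteriorAlgebra.ι R ⁅x, m⁆ * (ExteriorAlgebra.ι R m * w) + ExteriorAlgebra.ι R m * (ExteriorAlgebra.ι R ⁅x, m⁆ * w + ExteriorAlgebra.ι R m * fw) = (0 : R) • fw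
      rw [zero_smul, mul_add, ← mul_assoc, ← mul_assoc, ← mul_assoc, h2, zero_mul, add_zero,
        ← add_mul, h1, zero_mul])
    0

variable {R h}

theorem ad_algebraMap (x : h) (r : R) : adLin R h x (algebraMap R (ExteriorAlgebra R h) r) = 0 := by
  refine (CliffordAlgebra.foldr'_algebraMap _ _ _ _ _).trans (smul_zero r)

theorem ad_one (x : h) : adLin R h x 1 = 0 := by simpa using ad_algebraMap (R := R) x 1

theorem ad_ι_mul (x y : h) (w : ExteriorAlgebra R h) :
    adLin R h x (ExteriorAlgebra.ι R y * w) = ExteriorAlgebra.ι R ⁅x, y⁆ * w + ExteriorAlgebra.ι R y * adLin R h x w :=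
  CliffordAlgebra.foldr'_ι_mul _ _ _ _ _ _

theorem ad_ι (x y : h) : adLin R h x (ExteriorAlgebra.ι R y) = ExteriorAlgebra.ι R ⁅x, y⁆ := by
  simpa [ad_one] using ad_ι_mul (R := R) x y 1

theorem ext_induction {P : ExteriorAlgebra R h → Prop} (algebraMap : ∀ r : R, P (algebraMap R (ExteriorAlgebra R h) r))
    (add : ∀ x y, P x → P y → P (x + y)) (ι_mul : ∀ x m, P x → P (ExteriorAlgebra.ι R m * x)) (w : ExteriorAlgebra R h) : P w :=
  CliffordAlgebra.left_induction (0 : QuadraticForm R h) algebraMap add ι_mul w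

theorem ad_mul (x : h) (w w' : ExteriorAlgebra R h) :
    adLin R h x (w * w') = adLin R h x w * w' + w * adLin R h x w' := by
  induction w using ext_induction with
  | algebraMap r =>
    rw [← Algebra.smul_def, map_smul, ad_algebraMap, zero_mul, zero_add, Algebra.smul_def]
  | add a b ha hb => rw [add_mul, map_add, ha, hb, map_add]; noncomm_ring
  | ι_mul a m ha => rw [mul_assoc, ad_ι_mul, ha, ad_ι_mul]; noncomm_ring

theorem ad_add (x y : h) (w : ExteriorAlgebra R h) : adLin R h (x + y) w = adLin R h x w + adLin R h y w := by
  induction w using ext_induction with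
  | algebraMap r => simp [ad_algebraMap]
  | add a b ha hb => simp only [map_add, ha, hb]; abel
  | ι_mul a m ha => simp only [ad_ι_mul, ha, add_lie, map_add]; noncomm_ring

theorem ad_smul (r : R) (x : h) (w : ExteriorAlgebra R h) : adLin R h (r • x) w = r • adLin R h x w := by
  induction w using ext_induction with
  | algebraMap r => simp [ad_algebraMap]
  | add a b ha hb => simp only [map_add, ha, hb, smul_add]
  | ι_mul a m ha => simp [ad_ι_mul, ha]

variable (R h) in
/-- The adjoint action on the exterior algebra. -/
def ad : h →ₗ[R] (ExteriorAlgebra R h) →ₗ[R] (ExteriorAlgebra R h) where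
  toFun := adLin R h
  map_add' x y := LinearMap.ext (ad_add x y)
  map_smul' r x := LinearMap.ext (ad_smul r x)

theorem ad_apply (x : h) (w : ExteriorAlgebra R h) : ad R h x w = adLin R h x w := rfl

theorem ad_lie (x y : h) (w : ExteriorAlgebra R h) :
    adLin R h ⁅x, y⁆ w = adLin R h x (adLin R h y w) - adLin R h y (adLin R h x w) := by
  induction w using ext_induction with
  | algebraMap r => simp [ad_algebraMap]
  | add a b ha hb => simp only [map_add, ha, hb]; abel
  | ι_mul a m ha => simp only [ad_ι_mul, ha, map_add, lie_lie, map_sub]; noncomm_ring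

variable (R h) in
/-- The differential `∂` of the Cartan-Chevalley-Eilenberg coalgebra `Λ'_∂[s𝔥]`, determined by
`∂ 1 = 0` and `∂ (x ∧ w) = - x ∧ ∂ w - ad_x w`. Explicitly, `∂ (x₁ ∧ … ∧ xₙ)` is the sum over
`i < j` of `(-1)^(i+j) [xᵢ, xⱼ] ∧ x₁ ∧ … ∧ xₙ` with `xᵢ` and `xⱼ` omitted on the right; in
particular `∂ (x ∧ y) = [y, x]`. -/
def cceD : ExteriorAlgebra R h →ₗ[R] (ExteriorAlgebra R h) :=
  CliffordAlgebra.foldr' (0 : QuadraticForm R h)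
    (LinearMap.mk₂ R (fun (m : h) (p : ExteriorAlgebra R h × ExteriorAlgebra R h) => -(ExteriorAlgebra.ι R m * p.2) - ad R h m p.1)
      (fun m m' p => by simp [add_mul]; abel) (fun r m p => by simp [smul_sub])
      (fun m p p' => by simp [mul_add]; abel) (fun r m p => by simp [smul_sub]))
    (fun m w fw => by
      have h2 := ExteriorAlgebra.ι_sq_zero (R := R) m
      change -(ExteriorAlgebra.ι R m * (-(ExteriorAlgebra.ι R m * fw) - adLin R h m w)) - adLin R h m (ExteriorAlgebra.ι R m * w) = (0 : R) • fw
      rw [ad_ι_mul, lie_self, map_zero, zero_mul, zero_add, zero_smul, mul_sub, mul_neg,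
        ← mul_assoc, h2, zero_mul]
      simp)
    0

theorem cceD_algebraMap (r : R) : cceD R h (algebraMap R (ExteriorAlgebra R h) r) = 0 := by
  refine (CliffordAlgebra.foldr'_algebraMap _ _ _ _ _).trans (smul_zero r)

theorem cceD_one : cceD R h 1 = 0 := by simpa using cceD_algebraMap (h := h) (1 : R)

theorem cceD_ι_mul (x : h) (w : ExteriorAlgebra R h) :
    cceD R h (ExteriorAlgebra.ι R x * w) = -(ExteriorAlgebra.ι R x * cceD R h w) - adLin R h x w :=
  CliffordAlgebra.foldr'_ι_mul _ _ _ _ _ _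

theorem cceD_ι (x : h) : cceD R h (ExteriorAlgebra.ι R x) = 0 := by
  simpa [cceD_one, ad_one] using cceD_ι_mul (R := R) x 1

theorem cceD_ι_mul_ι (x y : h) : cceD R h (ExteriorAlgebra.ι R x * ExteriorAlgebra.ι R y) = ExteriorAlgebra.ι R ⁅y, x⁆ := by
  rw [cceD_ι_mul, cceD_ι, ad_ι, ← lie_skew x y, map_neg]; simp

theorem cceD_ad (x : h) (w : ExteriorAlgebra R h) : cceD R h (adLin R h x w) = adLin R h x (cceD R h w) := by
  induction w using ext_induction with
  | algebraMap r => simp [ad_algebraMap, cceD_algebraMap]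
  | add a b ha hb => simp only [map_add, ha, hb]
  | ι_mul a m ha =>
    simp only [ad_ι_mul, cceD_ι_mul, map_add, map_sub, map_neg, ha, ad_lie]
    noncomm_ring

theorem cceD_cceD (w : ExteriorAlgebra R h) : cceD R h (cceD R h w) = 0 := by
  induction w using ext_induction with
  | algebraMap r => simp [cceD_algebraMap]
  | add a b ha hb => simp only [map_add, ha, hb, add_zero]
  | ι_mul a m ha => simp [cceD_ι_mul, cceD_ad, ha]

variable (R h) in
/-- The automorphism `w ↦ (-1)^|w| w` of the exterior algebra. -/
def extPar : ExteriorAlgebra R h →ₐ[R] (ExteriorAlgebra R h) := ExteriorAlgebra.map (-LinearMap.id)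

@[simp] theorem extPar_ι (x : h) : extPar R h (ExteriorAlgebra.ι R x) = -ExteriorAlgebra.ι R x := by simp [extPar]

theorem mul_ι (w : ExteriorAlgebra R h) (y : h) : w * ExteriorAlgebra.ι R y = ExteriorAlgebra.ι R y * extPar R h w := by
  induction w using ext_induction with
  | algebraMap r => rw [AlgHom.commutes, Algebra.commutes]
  | add a b ha hb => rw [add_mul, ha, hb, map_add, mul_add]
  | ι_mul a m ha =>
    have := ExteriorAlgebra.ι_add_mul_swap (R := R) m y
    rw [mul_assoc, ha, map_mul, extPar_ι, ← mul_assoc, ← mul_assoc, eq_neg_of_add_eq_zero_left this]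
    simp

theorem extPar_of_mem {k : ℕ} {w : (ExteriorAlgebra R h)} (hw : w ∈ ⋀[R]^k h) :
    extPar R h w = (-1 : R) ^ k • w := by
  induction hw using Submodule.pow_induction_on_left' with
  | algebraMap r => simp
  | add a b i _ _ ha hb => rw [map_add, ha, hb, smul_add]
  | mem_mul m hm i a _ ha =>
    obtain ⟨m, rfl⟩ := hm
    rw [map_mul, ha, extPar_ι, pow_succ]; simp

theorem cceD_mul_ι (w : ExteriorAlgebra R h) (y : h) :
    cceD R h (w * ExteriorAlgebra.ι R y) = cceD R h w * ExteriorAlgebra.ι R y - adLin R h y (extPar R h w) := by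
  induction w using ext_induction with
  | algebraMap r =>
    simp [cceD_algebraMap, ad_algebraMap, ← Algebra.smul_def, cceD_ι]
  | add a b ha hb => simp only [add_mul, map_add, ha, hb]; abel
  | ι_mul a m ha =>
    rw [mul_assoc, cceD_ι_mul, ha, cceD_ι_mul, ad_mul, ad_ι, mul_ι a, map_mul, extPar_ι, neg_mul,
      map_neg, ad_ι_mul, ← lie_skew y m, map_neg]
    noncomm_ring

theorem ι_mul_mem {i : ℕ} (m : h) {a : ExteriorAlgebra R h} (ha : a ∈ ⋀[R]^i h) : ExteriorAlgebra.ι R m * a ∈ ⋀[R]^(i + 1) h := by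
  change _ ∈ LinearMap.range (ExteriorAlgebra.ι R : h →ₗ[R] (ExteriorAlgebra R h)) ^ (i + 1)
  rw [pow_succ']
  exact Submodule.mul_mem_mul ⟨_, rfl⟩ ha

theorem mul_ι_mem {i : ℕ} (m : h) {a : ExteriorAlgebra R h} (ha : a ∈ ⋀[R]^i h) : a * ExteriorAlgebra.ι R m ∈ ⋀[R]^(i + 1) h := by
  change _ ∈ LinearMap.range (ExteriorAlgebra.ι R : h →ₗ[R] (ExteriorAlgebra R h)) ^ (i + 1)
  rw [pow_succ]
  exact Submodule.mul_mem_mul ha ⟨_, rfl⟩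

theorem ad_mem {k : ℕ} (x : h) {w : (ExteriorAlgebra R h)} (hw : w ∈ ⋀[R]^k h) : adLin R h x w ∈ ⋀[R]^k h := by
  induction hw using Submodule.pow_induction_on_left' with
  | algebraMap r => rw [ad_algebraMap]; exact zero_mem _
  | add a b i _ _ ha hb => rw [map_add]; exact add_mem ha hb
  | mem_mul m hm i a ha' ha =>
    obtain ⟨m, rfl⟩ := hm
    rw [ad_ι_mul]
    exact add_mem (ι_mul_mem _ ha') (ι_mul_mem _ ha)

theorem cceD_mem_zero {w : (ExteriorAlgebra R h)} (hw : w ∈ ⋀[R]^0 h) : cceD R h w = 0 := by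
  obtain ⟨r, rfl⟩ := Submodule.mem_one.1 (by simpa using hw)
  exact cceD_algebraMap r

theorem cceD_mem (k : ℕ) : ∀ w ∈ ⋀[R]^(k + 1) h, cceD R h w ∈ ⋀[R]^k h := by
  induction k with
  | zero =>
    intro w hw
    change w ∈ LinearMap.range (ExteriorAlgebra.ι R : h →ₗ[R] (ExteriorAlgebra R h)) ^ (_ + 1) at hw
    rw [pow_succ'] at hw
    induction hw using Submodule.mul_induction_on' with
    | mem_mul_mem m hm a ha =>
      obtain ⟨m, rfl⟩ := hm
      rw [cceD_ι_mul, cceD_mem_zero ha, mul_zero, neg_zero, zero_sub]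
      exact neg_mem (ad_mem m ha)
    | add a _ b _ ha hb => rw [map_add]; exact add_mem ha hb
  | succ k ih =>
    intro w hw
    change w ∈ LinearMap.range (ExteriorAlgebra.ι R : h →ₗ[R] (ExteriorAlgebra R h)) ^ (_ + 1) at hw
    rw [pow_succ'] at hw
    induction hw using Submodule.mul_induction_on' with
    | mem_mul_mem m hm a ha =>
      obtain ⟨m, rfl⟩ := hm
      rw [cceD_ι_mul]
      exact sub_mem (neg_mem (ι_mul_mem _ (ih a ha))) (ad_mem m ha)
    | add a _ b _ ha hb => rw [map_add]; exact add_mem ha hb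

variable (R h) in
/-- The right action of `U[C𝔥]` on the exterior algebra, as a homomorphism to the opposite of the
endomorphism algebra: `x ∈ 𝔥` acts by `w ↦ - ad_x w` and `s y` acts by `w ↦ w ∧ y`. -/
def cceAct : UCone R h →ₐ[R] (Module.End R (ExteriorAlgebra R h))ᵐᵒᵖ :=
  UCone.lift
    ((MulOpposite.opLinearEquiv R).toLinearMap ∘ₗ (-ad R h))
    ((MulOpposite.opLinearEquiv R).toLinearMap ∘ₗ (LinearMap.mul R (ExteriorAlgebra R h)).flip ∘ₗ (ExteriorAlgebra.ι R))
    (fun x y => MulOpposite.unop_injective (LinearMap.ext fun w => by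
      simp [ad_apply, ad_lie]))
    (fun x y => MulOpposite.unop_injective (LinearMap.ext fun w => by
      simp [ad_apply, ad_mul, ad_ι]))
    (fun y => MulOpposite.unop_injective (LinearMap.ext fun w => by
      simp [mul_assoc]))

theorem cceAct_lie (x : h) (w : ExteriorAlgebra R h) :
    (cceAct R h (UCone.lie R h x)).unop w = -adLin R h x w := by
  simp [cceAct, ad_apply]

theorem cceAct_sus (y : h) (w : ExteriorAlgebra R h) :
    (cceAct R h (UCone.sus R h y)).unop w = w * ExteriorAlgebra.ι R y := by
  simp [cceAct]

theorem extPar_ad (x : h) (w : ExteriorAlgebra R h) : extPar R h (adLin R h x w) = adLin R h x (extPar R h w) := by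
  induction w using ext_induction with
  | algebraMap r => simp [ad_algebraMap]
  | add a b ha hb => simp only [map_add, ha, hb]
  | ι_mul a m ha => simp [ad_ι_mul, ha]; abel

theorem extPar_act (w : ExteriorAlgebra R h) (a : UCone R h) :
    extPar R h ((cceAct R h a).unop w) =
      (cceAct R h (UCone.par R h a)).unop (extPar R h w) := by
  induction a using UCone.induction generalizing w with
  | algebraMap r => simp [MulOpposite.algebraMap_apply, Module.algebraMap_end_apply]
  | lie x => simp [cceAct_lie, extPar_ad]
  | sus y => simp [cceAct_sus]
  | mul a b ha hb => simp [ha, hb]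
  | add a b ha hb => simp [ha, hb]

theorem cceD_act (w : ExteriorAlgebra R h) (a : UCone R h) :
    cceD R h ((cceAct R h a).unop w) = (cceAct R h a).unop (cceD R h w) +
      (cceAct R h (UCone.d R h a)).unop (extPar R h w) := by
  induction a using UCone.induction generalizing w with
  | algebraMap r =>
    simp [MulOpposite.algebraMap_apply, Module.algebraMap_end_apply, UCone.d_algebraMap]
  | lie x => simp [cceAct_lie, UCone.d_lie, cceD_ad]
  | sus y => simp [cceAct_sus, UCone.d_sus, cceAct_lie, cceD_mul_ι]; abel
  | mul a b ha hb => simp [ha, hb, UCone.d_mul, extPar_act]; abel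
  | add a b ha hb => simp [ha, hb]; abel

theorem act_mem_ext {i j : ℕ} {w : (ExteriorAlgebra R h)} {a : UCone R h} (hw : w ∈ ⋀[R]^i h)
    (ha : a ∈ UCone.deg R h j) : (cceAct R h a).unop w ∈ ⋀[R]^(i + j) h := by
  induction ha using Submodule.span_induction with
  | mem a ha =>
    obtain ⟨l, rfl, rfl⟩ := ha
    induction l generalizing i w with
    | nil => simpa using hw
    | cons z l ih =>
      rcases z with x | y
      · simpa [cceAct_lie] using ih (ad_mem x hw)
      · have := ih (mul_ι_mem y hw)
        rw [countP_inr]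
        simpa [cceAct_sus, add_assoc, add_comm 1] using this
  | zero => simp
  | add a b _ _ ha hb => simpa using add_mem ha hb
  | smul r a _ ha => simpa using Submodule.smul_mem _ r ha

variable (R h) in
/-- The Cartan-Chevalley-Eilenberg coalgebra `Λ'_∂[s𝔥]` of the Lie algebra `𝔥`, as a right
`U[C𝔥]`-complex. -/
def cce : DGMod R h where
  carrier := ExteriorAlgebra R h
  deg k := ⋀[R]^k h
  isInternal := DirectSum.Decomposition.isInternal (fun k : ℕ => ⋀[R]^k h)
  d := cceD R h
  d_mem := cceD_mem
  d_zero _ hw := cceD_mem_zero hw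
  d_d := cceD_cceD
  act := LinearMap.mk₂ R (fun w a => (cceAct R h a).unop w)
    (by simp) (by simp) (by simp) (by simp)
  act_one := by simp
  act_mul := by simp
  act_mem _ _ _ _ hw ha := act_mem_ext hw ha
  d_act i w a hw := by
    simp only [LinearMap.mk₂_apply]
    rw [cceD_act, extPar_of_mem hw, map_smul]

/-- Restriction of a right `U[C𝔥]`-complex along the map `U[C𝔤] → U[C𝔥]` induced by a morphism
of Lie algebras. -/
def DGMod.restrict {g : Type v} [LieRing g] [LieAlgebra R g] (φ : g →ₗ⁅R⁆ h) (V : DGMod R h) :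
    DGMod R g where
  carrier := V.carrier
  deg := V.deg
  isInternal := V.isInternal
  d := V.d
  d_mem := V.d_mem
  d_zero := V.d_zero
  d_d := V.d_d
  act := V.act.compl₂ (UCone.map φ).toLinearMap
  act_one := by simp [V.act_one]
  act_mul := by simp [V.act_mul]
  act_mem i j x a hx ha := V.act_mem i j x _ hx (UCone.map_mem φ ha)
  d_act i x a hx := by simp [V.d_act i x _ hx, UCone.map_d]

variable {k : Type v} [LieRing k] [LieAlgebra R k]

theorem map_adLin (φ : h →ₗ⁅R⁆ k) (x : h) (w : ExteriorAlgebra R h) :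
    ExteriorAlgebra.map (φ : h →ₗ[R] k) (adLin R h x w) =
      adLin R k (φ x) (ExteriorAlgebra.map (φ : h →ₗ[R] k) w) := by
  induction w using ext_induction with
  | algebraMap r => simp [ad_algebraMap]
  | add a b ha hb => simp only [map_add, ha, hb]
  | ι_mul a m ha => simp [ad_ι_mul, ha]

theorem map_cceD (φ : h →ₗ⁅R⁆ k) (w : ExteriorAlgebra R h) :
    ExteriorAlgebra.map (φ : h →ₗ[R] k) (cceD R h w) =
      cceD R k (ExteriorAlgebra.map (φ : h →ₗ[R] k) w) := by
  induction w using ext_induction with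
  | algebraMap r => simp [cceD_algebraMap]
  | add a b ha hb => simp only [map_add, ha, hb]
  | ι_mul a m ha => simp [cceD_ι_mul, ha, map_adLin]

theorem map_act (φ : h →ₗ⁅R⁆ k) (w : ExteriorAlgebra R h) (a : UCone R h) :
    ExteriorAlgebra.map (φ : h →ₗ[R] k) ((cceAct R h a).unop w) =
      (cceAct R k (UCone.map φ a)).unop (ExteriorAlgebra.map (φ : h →ₗ[R] k) w) := by
  induction a using UCone.induction generalizing w with
  | algebraMap r => simp [MulOpposite.algebraMap_apply, Module.algebraMap_end_apply]
  | lie x => simp [cceAct_lie, map_adLin]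
  | sus y => simp [cceAct_sus]
  | mul a b ha hb => simp [ha, hb]
  | add a b ha hb => simp [ha, hb]

theorem map_mem_ext (φ : h →ₗ[R] k) (i : ℕ) (w : ExteriorAlgebra R h) (hw : w ∈ ⋀[R]^i h) :
    ExteriorAlgebra.map φ w ∈ ⋀[R]^i k := by
  induction hw using Submodule.pow_induction_on_left' with
  | algebraMap r => simp
  | add a b i _ _ ha hb => rw [map_add]; exact add_mem ha hb
  | mem_mul m hm i a ha' ha =>
    obtain ⟨m, rfl⟩ := hm
    rw [map_mul, ExteriorAlgebra.map_apply_ι]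
    exact ι_mul_mem _ ha

end CCE

section Weil

variable (R : Type u) [CommRing R] (g : Type v) [LieRing g] [LieAlgebra R g]

theorem map_diag {I J : Type} (f : I → J) (a : UCone R g) :
    UCone.map (reindexLie R g f) (UCone.map (diagLie R g J) a) = UCone.map (diagLie R g I) a := by
  have : (UCone.map (reindexLie R g f)).comp (UCone.map (diagLie R g J)) =
      UCone.map (diagLie R g I) :=
    UCone.hom_ext (fun x => by simp; rfl) (fun x => by simp; rfl)
  exact DFunLike.congr_fun this a

/-- The Cartan-Chevalley-Eilenberg coalgebra of the power `𝔤^I`, as a right `U[C𝔤]`-complex through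
the diagonal `𝔤 → 𝔤^I`. -/
def powCCE (I : Type) : DGMod R g := (cce R (I → g)).restrict (diagLie R g I)

/-- The morphism induced by the reindexing map `𝔤^J → 𝔤^I` of a map `f : I → J`. -/
def powCCEMap {I J : Type} (f : I → J) : powCCE R g J ⟶ powCCE R g I :=
  { lin := (ExteriorAlgebra.map (reindexLie R g f : (J → g) →ₗ[R] (I → g))).toLinearMap
    map_deg := fun k w hw => map_mem_ext _ k w hw
    map_d := fun w => map_cceD (reindexLie R g f) w
    map_act := fun w a => (map_act (reindexLie R g f) w (UCone.map (diagLie R g J) a)).trans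
      (congrArg (fun b => (cceAct R (I → g) b).unop _) (map_diag R g f a)) }

theorem powCCEMap_id (I : Type) : powCCEMap R g (id : I → I) = 𝟙 _ := by
  have h : (reindexLie R g (id : I → I) : (I → g) →ₗ[R] (I → g)) = LinearMap.id := rfl
  refine DGMod.hom_ext (LinearMap.ext fun w => ?_)
  change ExteriorAlgebra.map (reindexLie R g (id : I → I) : (I → g) →ₗ[R] (I → g)) w = w
  rw [h, ExteriorAlgebra.map_id]; rfl

theorem powCCEMap_comp {I J K : Type} (f : J → I) (f' : K → J) :
    powCCEMap R g f ≫ powCCEMap R g f' = powCCEMap R g (f ∘ f') := by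
  refine DGMod.hom_ext (LinearMap.ext fun w => ?_)
  exact DFunLike.congr_fun (ExteriorAlgebra.map_comp_map
    (reindexLie R g f : (I → g) →ₗ[R] (J → g)) (reindexLie R g f' : (J → g) →ₗ[R] (K → g))) w

/-- The simplicial Weil coalgebra `Λ'_∂[sE𝔤]`, as a simplicial right `U[C𝔤]`-complex. In
simplicial degree `n` it is the Cartan-Chevalley-Eilenberg coalgebra of the Lie algebra
`(E𝔤)ₙ = 𝔤^{n+1}`, the algebra `U[C𝔤]` acts through the diagonal `𝔤 → 𝔤^{n+1}`, and the
simplicial operators are induced by those of the total object `E𝔤` (faces omit a component,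
degeneracies repeat one). -/
def weil : SimplicialObject (DGMod R g) where
  obj n := powCCE R g (Fin (n.unop.len + 1))
  map f := powCCEMap R g f.unop.toOrderHom
  map_id n := powCCEMap_id R g _
  map_comp f f' := (powCCEMap_comp R g f.unop.toOrderHom f'.unop.toOrderHom).symm

end Weil

/-! ### Ordered products -/

section OrderedProducts

theorem prod_ofFn_update_mul {M : Type*} [Monoid M] (b : M) : ∀ {n : ℕ} (u : Fin n → M) (j : Fin n)
    (_ : ∀ l < j, u l = 1),
    (List.ofFn (Function.update u j (b * u j))).prod = b * (List.ofFn u).prod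
  | 0, _, j, _ => j.elim0
  | n + 1, u, j, hu => by
    rw [List.ofFn_succ, List.ofFn_succ, List.prod_cons, List.prod_cons]
    cases j using Fin.cases with
    | zero => simp [mul_assoc]
    | succ j =>
      have h0 : u 0 = 1 := hu 0 (Fin.succ_pos j)
      have h1 : (fun i : Fin n => Function.update u j.succ (b * u j.succ) i.succ) =
          Function.update (fun i : Fin n => u i.succ) j (b * u j.succ) := by
        ext i; simp [Function.update_apply]
      rw [h1, prod_ofFn_update_mul b (fun i : Fin n => u i.succ) j
        (fun l hl => hu l.succ (Fin.succ_lt_succ_iff.2 hl)), h0, one_mul,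
        Function.update_of_ne (Fin.succ_ne_zero j).symm, h0, one_mul]

theorem prod_ofFn_eq_single {M : Type*} [Monoid M] : ∀ {n : ℕ} (u : Fin n → M) (j : Fin n)
    (_ : ∀ l ≠ j, u l = 1), (List.ofFn u).prod = u j
  | 0, _, j, _ => j.elim0
  | n + 1, u, j, hu => by
    rw [List.ofFn_succ, List.prod_cons]
    cases j using Fin.cases with
    | zero =>
      have : (fun i : Fin n => u i.succ) = fun _ => 1 := funext fun i => hu _ (Fin.succ_ne_zero i)
      rw [this]; simp
    | succ j =>
      rw [hu 0 (Fin.succ_ne_zero j).symm, one_mul]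
      exact prod_ofFn_eq_single (fun i : Fin n => u i.succ) j
        (fun l hl => hu l.succ (fun h => hl (Fin.succ_injective _ h)))

theorem prod_ofFn_left {M : Type*} [Monoid M] (b : M) : ∀ {n : ℕ} (u : Fin (n + 1) → M) (j : Fin n),
    (List.ofFn (Function.update u j.castSucc (u j.castSucc * b))).prod =
      ((List.ofFn u).take (j + 1)).prod * b * ((List.ofFn u).drop (j + 1)).prod
  | 0, _, j => j.elim0
  | n + 1, u, j => by
    rw [List.ofFn_succ, List.ofFn_succ (f := u), List.prod_cons]
    cases j using Fin.cases with
    | zero =>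
      have h1 : (fun i : Fin (n + 1) => Function.update u (Fin.castSucc 0)
          (u (Fin.castSucc 0) * b) i.succ) = fun i => u i.succ := by
        ext i; rw [Function.update_of_ne]; simp
      rw [h1]; simp
    | succ j =>
      have h1 : (fun i : Fin (n + 1) => Function.update u j.succ.castSucc
          (u j.succ.castSucc * b) i.succ) =
          Function.update (fun i : Fin (n + 1) => u i.succ) j.castSucc
            (u j.castSucc.succ * b) := by
        ext i; simp [Function.update_apply, ← Fin.succ_castSucc]
      rw [h1, prod_ofFn_left b (fun i : Fin (n + 1) => u i.succ) j,
        Function.update_of_ne (by simp [← Fin.succ_castSucc, (Fin.succ_ne_zero _).symm])]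
      simp [mul_assoc]

theorem prod_ofFn_right {M : Type*} [Monoid M] (b : M) : ∀ {n : ℕ} (u : Fin (n + 1) → M)
    (j : Fin n),
    (List.ofFn (Function.update u j.succ (b * u j.succ))).prod =
      ((List.ofFn u).take (j + 1)).prod * b * ((List.ofFn u).drop (j + 1)).prod
  | 0, _, j => j.elim0
  | n + 1, u, j => by
    rw [List.ofFn_succ, List.ofFn_succ (f := u), List.prod_cons]
    cases j using Fin.cases with
    | zero =>
      have h1 : (fun i : Fin (n + 1) => Function.update u (Fin.succ 0)
          (b * u (Fin.succ 0)) i.succ) =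
          Function.update (fun i : Fin (n + 1) => u i.succ) 0 (b * u (Fin.succ 0)) := by
        ext i; simp only [Function.update_apply, Fin.succ_inj]
      rw [h1, prod_ofFn_update_mul b (fun i : Fin (n + 1) => u i.succ) 0 (by simp)]
      simp [mul_assoc]
    | succ j =>
      have h1 : (fun i : Fin (n + 1) => Function.update u j.succ.succ
          (b * u j.succ.succ) i.succ) =
          Function.update (fun i : Fin (n + 1) => u i.succ) j.succ
            (b * u j.succ.succ) := by
        ext i; simp only [Function.update_apply, Fin.succ_inj]
      rw [h1, prod_ofFn_right b (fun i : Fin (n + 1) => u i.succ) j,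
        Function.update_of_ne (Fin.succ_ne_zero _).symm]
      simp [mul_assoc]

theorem prod_ofFn_matrix {B : Type*} [Ring B] : ∀ {n : ℕ} (x y z : Fin n → B),
    (List.ofFn (fun i => (!![x i, y i; 0, z i] : Matrix (Fin 2) (Fin 2) B))).prod =
      !![(List.ofFn x).prod,
        ∑ i, (List.ofFn (fun j => if j < i then x j else if j = i then y j else z j)).prod;
        0, (List.ofFn z).prod]
  | 0, x, y, z => by
    ext i j; fin_cases i <;> fin_cases j <;> simp
  | n + 1, x, y, z => by
    rw [List.ofFn_succ, List.prod_cons, prod_ofFn_matrix, Fin.sum_univ_succ,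
      List.ofFn_succ (f := x), List.ofFn_succ (f := z), List.prod_cons, List.prod_cons]
    simp only [List.ofFn_succ, List.prod_cons]
    ext i j; fin_cases i <;> fin_cases j <;>
      simp [Matrix.mul_apply, Fin.sum_univ_two, Finset.mul_sum, Fin.succ_ne_zero, add_comm]

theorem prod_ofFn_update_last {M : Type*} [Monoid M] (b : M) {n : ℕ} (u : Fin (n + 1) → M) :
    (List.ofFn (Function.update u (Fin.last n) (u (Fin.last n) * b))).prod =
      (List.ofFn u).prod * b := by
  rw [List.ofFn_succ', List.ofFn_succ' (f := u)]
  simp [mul_assoc, Function.update_apply, (Fin.castSucc_lt_last _).ne]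

end OrderedProducts

/-! ### The relative bar resolution -/

section Bar

variable (R : Type u) [CommRing R] (g : Type v) [LieRing g] [LieAlgebra R g]

/-- The tensor product over `R` of `n + 1` copies of `U[C𝔤]`. -/
abbrev TPow (n : ℕ) : Type max u v := ⨂[R] _ : Fin (n + 1), UCone R g

/-- The relations between `R ⊗ U[C𝔤] ⊗ … ⊗ U[C𝔤]` (tensor product over `R`) and
`R ⊗ U[C𝔤] ⊗ … ⊗ U[C𝔤]` (tensor product over `U[𝔤]`): for `s ∈ U[𝔤]`,
`s a₀ ⊗ a₁ ⊗ … = ε(s) a₀ ⊗ a₁ ⊗ …` and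
`… ⊗ aⱼ s ⊗ aⱼ₊₁ ⊗ … = … ⊗ aⱼ ⊗ s aⱼ₊₁ ⊗ …`. -/
def barRel (n : ℕ) : Submodule R (TPow R g n) :=
  Submodule.span R
    ({t | ∃ (s : UniversalEnvelopingAlgebra R g) (a : Fin (n + 1) → UCone R g),
        t = PiTensorProduct.tprod R (Function.update a 0 (UCone.incl R g s * a 0)) -
          UCone.counit R g (UCone.incl R g s) • PiTensorProduct.tprod R a} ∪
      {t | ∃ (j : Fin n) (s : UniversalEnvelopingAlgebra R g) (a : Fin (n + 1) → UCone R g),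
        t = PiTensorProduct.tprod R
            (Function.update a j.castSucc (a j.castSucc * UCone.incl R g s)) -
          PiTensorProduct.tprod R (Function.update a j.succ (UCone.incl R g s * a j.succ))})

variable {R g}

/-- The linear map `a₀ ⊗ … ⊗ aₙ ↦ θ₀(a₀) ⋯ θₙ(aₙ)`. -/
def ordProd {B : Type*} [Ring B] [Algebra R B] {n : ℕ} (θ : Fin (n + 1) → (UCone R g →ₐ[R] B)) :
    TPow R g n →ₗ[R] B :=
  PiTensorProduct.lift
    ((MultilinearMap.mkPiAlgebraFin R (n + 1) B).compLinearMap (fun i => (θ i).toLinearMap))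

@[simp] theorem ordProd_tprod {B : Type*} [Ring B] [Algebra R B] {n : ℕ}
    (θ : Fin (n + 1) → (UCone R g →ₐ[R] B)) (a : Fin (n + 1) → UCone R g) :
    ordProd θ (PiTensorProduct.tprod R a) = (List.ofFn fun i => θ i (a i)).prod := by
  simp [ordProd]

variable (R g) in
/-- The map `a ↦ 1 ⊗ … ⊗ a ⊗ … ⊗ 1` to the factor `i`. -/
def sing {n : ℕ} (i : Fin (n + 1)) : UCone R g →ₐ[R] TPow R g n :=
  PiTensorProduct.singleAlgHom (R := R) (A := fun _ : Fin (n + 1) => UCone R g) i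

theorem sing_apply {n : ℕ} (i : Fin (n + 1)) (a : UCone R g) :
    sing R g i a = PiTensorProduct.tprod R (Pi.mulSingle i a) := rfl

theorem sing_mul_tprod {n : ℕ} (i : Fin (n + 1)) (a : UCone R g) (c : Fin (n + 1) → UCone R g) :
    sing R g i a * PiTensorProduct.tprod R c =
      PiTensorProduct.tprod R (Function.update c i (a * c i)) := by
  rw [sing_apply, PiTensorProduct.tprod_mul_tprod]
  congr 1; ext j
  by_cases h : j = i
  · subst h; simp
  · simp [h]

theorem tprod_mul_sing {n : ℕ} (i : Fin (n + 1)) (a : UCone R g) (c : Fin (n + 1) → UCone R g) :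
    PiTensorProduct.tprod R c * sing R g i a =
      PiTensorProduct.tprod R (Function.update c i (c i * a)) := by
  rw [sing_apply, PiTensorProduct.tprod_mul_tprod]
  congr 1; ext j
  by_cases h : j = i
  · subst h; simp
  · simp [h]

theorem ordProd_sing {n : ℕ} : ordProd (sing R g (n := n)) = LinearMap.id := by
  refine PiTensorProduct.ext (MultilinearMap.ext fun c => ?_)
  simp only [LinearMap.compMultilinearMap_apply, ordProd_tprod, LinearMap.id_apply]
  have h1 : (List.ofFn fun i => sing R g i (c i)) =
      (List.ofFn fun i => (Pi.mulSingle i (c i) : Fin (n + 1) → UCone R g)).map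
        (PiTensorProduct.tprodMonoidHom R) := by
    rw [List.map_ofFn]; rfl
  rw [h1, ← map_list_prod]
  change PiTensorProduct.tprod R _ = _
  congr 1
  ext l
  rw [Pi.list_prod_apply, List.map_ofFn, prod_ofFn_eq_single _ l]
  · simp
  · intro i hi
    simp [hi.symm]

/-- A family of homomorphisms extended by the augmentation in position `0`. -/
def extend {B : Type*} [Ring B] [Algebra R B] {m : ℕ} (φ : Fin (m + 1) → (UCone R g →ₐ[R] B)) :
    Fin (m + 2) → (UCone R g →ₐ[R] B) :=
  Fin.cases ((Algebra.ofId R B).comp (UCone.counit R g)) φ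

theorem extend_zero {B : Type*} [Ring B] [Algebra R B] {m : ℕ}
    (φ : Fin (m + 1) → (UCone R g →ₐ[R] B)) (a : UCone R g) :
    extend φ 0 a = algebraMap R B (UCone.counit R g a) := rfl

@[simp] theorem extend_succ {B : Type*} [Ring B] [Algebra R B] {m : ℕ}
    (φ : Fin (m + 1) → (UCone R g →ₐ[R] B)) (j : Fin (m + 1)) :
    extend φ j.succ = φ j := rfl

/-- The product of a word. -/
def word {B : Type*} [Ring B] [Algebra R B] {m : ℕ} (φ : Fin (m + 1) → (UCone R g →ₐ[R] B))
    (l : List (Fin (m + 2) × UCone R g)) : B :=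
  (l.map fun p => extend φ p.1 p.2).prod

theorem word_cons {B : Type*} [Ring B] [Algebra R B] {m : ℕ}
    (φ : Fin (m + 1) → (UCone R g →ₐ[R] B)) (p : Fin (m + 2) × UCone R g)
    (l : List (Fin (m + 2) × UCone R g)) : word φ (p :: l) = extend φ p.1 p.2 * word φ l := by
  simp [word]

theorem word_ge {m : ℕ} (k : Fin (m + 2)) (l : List (Fin (m + 2) × UCone R g))
    (hl : ∀ p ∈ l, k ≤ p.1) :
    ∃ (r : R) (c : Fin (m + 1) → UCone R g),
      word (sing R g) l = r • PiTensorProduct.tprod R c ∧ ∀ j : Fin (m + 1), j.succ < k → c j = 1 := by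
  induction l with
  | nil => exact ⟨1, 1, by rw [one_smul]; rfl, fun _ _ => rfl⟩
  | cons p l ih =>
    obtain ⟨r, c, h1, h2⟩ := ih fun q hq => hl q (List.mem_cons_of_mem _ hq)
    obtain ⟨x, a⟩ := p
    have hx : k ≤ x := hl _ List.mem_cons_self
    rw [word_cons, h1]
    cases x using Fin.cases with
    | zero =>
      refine ⟨UCone.counit R g a * r, c, ?_, h2⟩
      rw [extend_zero, ← Algebra.smul_def, smul_smul]
    | succ i =>
      refine ⟨r, Function.update c i (a * c i), ?_, fun j hj => ?_⟩
      · rw [extend_succ, mul_smul_comm, sing_mul_tprod]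
      · rw [Function.update_of_ne, h2 j hj]
        rintro rfl; exact absurd hj (not_lt.2 hx)

theorem word_le {m : ℕ} (k : Fin (m + 2)) (l : List (Fin (m + 2) × UCone R g))
    (hl : ∀ p ∈ l, p.1 ≤ k) :
    ∃ (r : R) (c : Fin (m + 1) → UCone R g),
      word (sing R g) l = r • PiTensorProduct.tprod R c ∧ ∀ j : Fin (m + 1), k < j.succ → c j = 1 := by
  induction l with
  | nil => exact ⟨1, 1, by rw [one_smul]; rfl, fun _ _ => rfl⟩
  | cons p l ih =>
    obtain ⟨r, c, h1, h2⟩ := ih fun q hq => hl q (List.mem_cons_of_mem _ hq)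
    obtain ⟨x, a⟩ := p
    have hx : x ≤ k := hl _ List.mem_cons_self
    rw [word_cons, h1]
    cases x using Fin.cases with
    | zero =>
      refine ⟨UCone.counit R g a * r, c, ?_, h2⟩
      rw [extend_zero, ← Algebra.smul_def, smul_smul]
    | succ i =>
      refine ⟨r, Function.update c i (a * c i), ?_, fun j hj => ?_⟩
      · rw [extend_succ, mul_smul_comm, sing_mul_tprod]
      · rw [Function.update_of_ne, h2 j hj]
        rintro rfl; exact absurd hj (not_lt.2 hx)

theorem ordProd_word {B : Type*} [Ring B] [Algebra R B] {m : ℕ}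
    (φ : Fin (m + 1) → (UCone R g →ₐ[R] B)) (l : List (Fin (m + 2) × UCone R g))
    (hl : l.Pairwise fun p q => p.1 ≤ q.1) : ordProd φ (word (sing R g) l) = word φ l := by
  induction l with
  | nil =>
    change ordProd φ (PiTensorProduct.tprod R 1) = 1
    simp
  | cons p l ih =>
    rw [List.pairwise_cons] at hl
    obtain ⟨r, c, h1, h2⟩ := word_ge p.1 l hl.1
    obtain ⟨x, a⟩ := p
    rw [word_cons, word_cons, ← ih hl.2, h1]
    cases x using Fin.cases with
    | zero =>
      rw [extend_zero, extend_zero, ← Algebra.smul_def, ← Algebra.smul_def, map_smul]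
    | succ i =>
      rw [extend_succ, extend_succ, mul_smul_comm, sing_mul_tprod, map_smul, map_smul,
        mul_smul_comm, ordProd_tprod, ordProd_tprod]
      congr 1
      rw [← prod_ofFn_update_mul (φ i a) (fun j => φ j (c j)) i]
      · congr 2; ext j
        by_cases h : j = i
        · subst h; simp
        · simp [h]
      · intro l hl
        rw [h2 l (Fin.succ_lt_succ_iff.2 hl), map_one]

theorem word_step {m : ℕ} (s : UniversalEnvelopingAlgebra R g) (x x' : Fin (m + 2))
    (hx : (x' : ℕ) = x + 1)
    (l l' : List (Fin (m + 2) × UCone R g)) (hl : ∀ p ∈ l, p.1 ≤ x) (hl' : ∀ p ∈ l', x' ≤ p.1) :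
    word (sing R g) l * extend (sing R g) x (UCone.incl R g s) * word (sing R g) l' -
      word (sing R g) l * extend (sing R g) x' (UCone.incl R g s) * word (sing R g) l' ∈
        barRel R g m := by
  obtain ⟨r, b, h1, h2⟩ := word_le x l hl
  obtain ⟨r', c, h1', h2'⟩ := word_ge x' l' hl'
  rw [h1, h1']
  have key : PiTensorProduct.tprod R b * extend (sing R g) x (UCone.incl R g s) *
        PiTensorProduct.tprod R c -
      PiTensorProduct.tprod R b * extend (sing R g) x' (UCone.incl R g s) *
        PiTensorProduct.tprod R c ∈ barRel R g m := by
    cases x using Fin.cases with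
    | zero =>
      have hx' : x' = Fin.succ 0 := Fin.ext (by simpa using hx)
      subst hx'
      have hb : b = 1 := funext fun j => h2 j (Fin.succ_pos j)
      have hb1 : PiTensorProduct.tprod R b = (1 : TPow R g m) := by rw [hb]; rfl
      rw [hb1, one_mul, one_mul, extend_zero, extend_succ, sing_mul_tprod,
        ← Algebra.smul_def, ← neg_sub]
      exact neg_mem (Submodule.subset_span (Or.inl ⟨s, c, rfl⟩))
    | succ i =>
      have hi : (i : ℕ) < m := by
        have := x'.isLt; rw [hx] at this; simp at this; omega
      obtain ⟨j, rfl⟩ : ∃ j : Fin m, i = j.castSucc := ⟨⟨i, hi⟩, rfl⟩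
      have hx' : x' = j.succ.succ := Fin.ext (by simpa using hx)
      subst hx'
      rw [extend_succ, extend_succ, mul_assoc, mul_assoc, sing_mul_tprod, sing_mul_tprod,
        PiTensorProduct.tprod_mul_tprod, PiTensorProduct.tprod_mul_tprod]
      refine Submodule.subset_span (Or.inr ⟨j, s, b * c, ?_⟩)
      congr 2
      · ext l
        by_cases h : l = j.castSucc
        · subst h
          have : c j.castSucc = 1 := h2' _ (by
            rw [Fin.succ_lt_succ_iff]; exact Fin.castSucc_lt_succ)
          simp [this]
        · simp [h]
      · ext l
        by_cases h : l = j.succ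
        · subst h
          have : b j.succ = 1 := h2 _ (by
            rw [Fin.succ_lt_succ_iff]; exact Fin.castSucc_lt_succ)
          simp [this]
        · simp [h]
  have := Submodule.smul_mem _ (r * r') key
  convert this using 1
  simp only [smul_mul_assoc, mul_smul_comm, smul_sub, smul_smul, mul_comm]

theorem word_telescope {m : ℕ} (s : UniversalEnvelopingAlgebra R g) (k k' : Fin (m + 2))
    (hk : k ≤ k')
    (l l' : List (Fin (m + 2) × UCone R g)) (hl : ∀ p ∈ l, p.1 ≤ k) (hl' : ∀ p ∈ l', k' ≤ p.1) :
    word (sing R g) l * extend (sing R g) k (UCone.incl R g s) * word (sing R g) l' -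
      word (sing R g) l * extend (sing R g) k' (UCone.incl R g s) * word (sing R g) l' ∈
        barRel R g m := by
  have key : ∀ x : ℕ, (k : ℕ) ≤ x → ∀ hx : x ≤ (k' : ℕ),
      word (sing R g) l * extend (sing R g) k (UCone.incl R g s) * word (sing R g) l' -
      word (sing R g) l * extend (sing R g) ⟨x, hx.trans_lt k'.isLt⟩ (UCone.incl R g s) *
        word (sing R g) l' ∈ barRel R g m := by
    intro x hx
    induction x, hx using Nat.le_induction with
    | base => intro _; rw [Fin.eta, sub_self]; exact zero_mem _
    | succ x hx ih =>
      intro hx'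
      have h1 := ih (by omega)
      have h2 := word_step s ⟨x, by omega⟩ ⟨x + 1, by omega⟩ rfl l l'
        (fun p hp => (hl p hp).trans hx) (fun p hp => le_trans (by exact hx') (hl' p hp))
      have := add_mem h1 h2
      rwa [sub_add_sub_cancel] at this
  exact key k' hk le_rfl

theorem map_mem_barRel {n : ℕ} (f : Fin (n + 1) → (UCone R g →ₗ[R] UCone R g))
    (hl : ∀ j s a, f j (UCone.incl R g s * a) = UCone.incl R g s * f j a)
    (hr : ∀ (j : Fin n) s a,
      f j.castSucc (a * UCone.incl R g s) = f j.castSucc a * UCone.incl R g s) :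
    barRel R g n ≤ (barRel R g n).comap (PiTensorProduct.map f) := by
  refine Submodule.span_le.2 ?_
  rintro t (⟨s, a, rfl⟩ | ⟨j, s, a, rfl⟩)
  · refine Submodule.subset_span (Or.inl ⟨s, fun j => f j (a j), ?_⟩)
    rw [map_sub, map_smul, PiTensorProduct.map_tprod, PiTensorProduct.map_tprod]
    congr 2; ext j
    by_cases h : j = 0
    · subst h; simp [hl]
    · simp [h]
  · refine Submodule.subset_span (Or.inr ⟨j, s, fun j => f j (a j), ?_⟩)
    rw [map_sub, PiTensorProduct.map_tprod, PiTensorProduct.map_tprod]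
    congr 2
    · ext l
      by_cases h : l = j.castSucc
      · subst h; simp [hr]
      · simp [h]
    · ext l
      by_cases h : l = j.succ
      · subst h; simp [hl]
      · simp [h]

/-! #### The grading -/

variable (R g) in
/-- The degree `k` part of the tensor power. -/
def tDeg (n k : ℕ) : Submodule R (TPow R g n) :=
  Submodule.span R {t | ∃ (κ : Fin (n + 1) → ℕ) (a : Fin (n + 1) → UCone R g),
    (∀ i, a i ∈ UCone.deg R g (κ i)) ∧ ∑ i, κ i = k ∧ t = PiTensorProduct.tprod R a}

variable (R g) in
/-- The projection of the tensor power to its degree `k` part. -/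
def tProj (n k : ℕ) : TPow R g n →ₗ[R] TPow R g n :=
  ∑ κ ∈ Finset.Nat.antidiagonalTuple (n + 1) k, PiTensorProduct.map fun i => UCone.proj R g (κ i)

theorem tProj_of_mem {n k l : ℕ} {t : TPow R g n} (ht : t ∈ tDeg R g n l) :
    tProj R g n k t = if l = k then t else 0 := by
  induction ht using Submodule.span_induction with
  | mem t h =>
    obtain ⟨κ, a, ha, rfl, rfl⟩ := h
    have h0 : ∀ κ' : Fin (n + 1) → ℕ, κ' ≠ κ →
        PiTensorProduct.map (fun i => UCone.proj R g (κ' i)) (PiTensorProduct.tprod R a) = 0 := by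
      intro κ' hκ
      obtain ⟨i, hi⟩ := Function.ne_iff.1 hκ
      rw [PiTensorProduct.map_tprod]
      exact MultilinearMap.map_coord_zero _ i (UCone.proj_of_mem_ne hi (ha i))
    have h1 : PiTensorProduct.map (fun i => UCone.proj R g (κ i)) (PiTensorProduct.tprod R a) =
        PiTensorProduct.tprod R a := by
      rw [PiTensorProduct.map_tprod]
      congr 1; ext i; exact UCone.proj_of_mem (ha i)
    rw [tProj, LinearMap.sum_apply]
    split_ifs with h
    · rw [Finset.sum_eq_single κ (fun κ' _ h' => h0 κ' h'), h1]
      intro h'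
      exact absurd (Finset.Nat.mem_antidiagonalTuple.2 h) h'
    · refine Finset.sum_eq_zero fun κ' hκ' => h0 κ' ?_
      rintro rfl
      exact h (Finset.Nat.mem_antidiagonalTuple.1 hκ')
  | zero => simp
  | add a b _ _ ha hb => rw [map_add, ha, hb]; split_ifs <;> simp
  | smul r a _ ha => rw [map_smul, ha]; split_ifs <;> simp

theorem tprod_mem_iSup_aux {n : ℕ} (S : Finset (Fin (n + 1))) : ∀ a : Fin (n + 1) → UCone R g,
    (∀ i, i ∉ S → ∃ k, a i ∈ UCone.deg R g k) →
    PiTensorProduct.tprod R a ∈ ⨆ k, tDeg R g n k := by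
  induction S using Finset.induction_on with
  | empty =>
    intro a ha
    choose κ hκ using fun i => ha i (Finset.notMem_empty i)
    exact Submodule.mem_iSup_of_mem (∑ i, κ i) (Submodule.subset_span ⟨κ, a, hκ, rfl, rfl⟩)
  | insert i S hi ih =>
    intro a ha
    have key : ∀ x ∈ ⨆ k, UCone.deg R g k,
        PiTensorProduct.tprod R (Function.update a i x) ∈ ⨆ k, tDeg R g n k := by
      intro x hx
      induction hx using Submodule.iSup_induction' with
      | mem k x hx =>
        refine ih _ fun j hj => ?_
        by_cases h : j = i
        · subst h; exact ⟨k, by simpa using hx⟩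
        · rw [Function.update_of_ne h]
          exact ha j (by simp [h, hj])
      | zero => rw [MultilinearMap.map_update_zero]; exact zero_mem _
      | add x y _ _ hx hy => rw [MultilinearMap.map_update_add]; exact add_mem hx hy
    have := key (a i) (by rw [UCone.iSup_deg]; trivial)
    rwa [Function.update_eq_self] at this

theorem iSup_tDeg (n : ℕ) : ⨆ k, tDeg R g n k = ⊤ := by
  rw [eq_top_iff, ← PiTensorProduct.span_tprod_eq_top, Submodule.span_le]
  rintro _ ⟨a, rfl⟩
  exact tprod_mem_iSup_aux Finset.univ a (fun i hi => absurd (Finset.mem_univ i) hi)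

theorem tProj_barRel (n k : ℕ) : barRel R g n ≤ (barRel R g n).comap (tProj R g n k) := by
  intro t ht
  rw [Submodule.mem_comap, tProj, LinearMap.sum_apply]
  exact sum_mem fun κ _ => map_mem_barRel _ (fun j s a => UCone.proj_incl_mul _ s a)
    (fun j s a => UCone.proj_mul_incl _ s a) ht

theorem sing_mul_mem {n i k : ℕ} (j : Fin (n + 1)) {a : UCone R g} (ha : a ∈ UCone.deg R g i)
    {t : TPow R g n} (ht : t ∈ tDeg R g n k) : sing R g j a * t ∈ tDeg R g n (i + k) := by
  induction ht using Submodule.span_induction with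
  | mem t h =>
    obtain ⟨κ, c, hc, rfl, rfl⟩ := h
    rw [sing_mul_tprod]
    refine Submodule.subset_span ⟨Function.update κ j (i + κ j), _, fun l => ?_, ?_, rfl⟩
    · by_cases h : l = j
      · subst h; simpa using UCone.mul_mem ha (hc l)
      · simpa [h] using hc l
    · rw [Finset.sum_update_of_mem (Finset.mem_univ j), add_assoc,
        ← Finset.sum_eq_add_sum_sdiff_singleton_of_mem (Finset.mem_univ j)]
  | zero => simp
  | add x y _ _ hx hy => rw [mul_add]; exact add_mem hx hy
  | smul r x _ hx => rw [mul_smul_comm]; exact Submodule.smul_mem _ _ hx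

theorem mul_sing_mem {n i k : ℕ} (j : Fin (n + 1)) {a : UCone R g} (ha : a ∈ UCone.deg R g i)
    {t : TPow R g n} (ht : t ∈ tDeg R g n k) : t * sing R g j a ∈ tDeg R g n (k + i) := by
  induction ht using Submodule.span_induction with
  | mem t h =>
    obtain ⟨κ, c, hc, rfl, rfl⟩ := h
    rw [tprod_mul_sing]
    refine Submodule.subset_span ⟨Function.update κ j (κ j + i), _, fun l => ?_, ?_, rfl⟩
    · by_cases h : l = j
      · subst h; simpa using UCone.mul_mem (hc l) ha
      · simpa [h] using hc l
    · rw [Finset.sum_update_of_mem (Finset.mem_univ j),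
        Finset.sum_eq_add_sum_sdiff_singleton_of_mem (Finset.mem_univ j) κ]
      omega
  | zero => simp
  | add x y _ _ hx hy => rw [add_mul]; exact add_mem hx hy
  | smul r x _ hx => rw [smul_mul_assoc]; exact Submodule.smul_mem _ _ hx

theorem one_mem_tDeg {n : ℕ} : (1 : TPow R g n) ∈ tDeg R g n 0 :=
  Submodule.subset_span ⟨0, 1, fun _ => UCone.one_mem, by simp, rfl⟩

/-! #### The differential -/

variable (R g) in
/-- The factors of the `i`-th summand of the differential of the tensor power. -/
def dFun {n : ℕ} (i j : Fin (n + 1)) : UCone R g →ₗ[R] UCone R g :=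
  if j < i then (UCone.par R g).toLinearMap else if j = i then UCone.d R g else LinearMap.id

variable (R g) in
/-- The differential of the tensor power,
`d (a₀ ⊗ … ⊗ aₙ) = Σ_i (-1)^(|a₀| + … + |a_{i-1}|) a₀ ⊗ … ⊗ d aᵢ ⊗ … ⊗ aₙ`. -/
def tD (n : ℕ) : TPow R g n →ₗ[R] TPow R g n :=
  ∑ i : Fin (n + 1), PiTensorProduct.map (dFun R g i)

variable (R g) in
/-- The map `t ↦ (-1)^|t| t`. -/
def tPar (n : ℕ) : TPow R g n →ₗ[R] TPow R g n :=
  PiTensorProduct.map fun _ => (UCone.par R g).toLinearMap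

/-- The homomorphism `a ↦ [[θ((-1)^|a| a), θ(d a)], [0, θ(a)]]`. -/
def mat {B : Type*} [Ring B] [Algebra R B] (θ : UCone R g →ₐ[R] B) :
    UCone R g →ₐ[R] Matrix (Fin 2) (Fin 2) B :=
  (AlgHom.mapMatrix θ).comp (UCone.rho R g)

theorem mat_apply {B : Type*} [Ring B] [Algebra R B] (θ : UCone R g →ₐ[R] B) (a : UCone R g) :
    mat θ a = !![θ (UCone.par R g a), θ (UCone.d R g a); 0, θ a] := by
  rw [mat, AlgHom.comp_apply, UCone.rho_eq]
  ext i j; fin_cases i <;> fin_cases j <;> simp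

theorem ordProd_mat {B : Type*} [Ring B] [Algebra R B] {n : ℕ}
    (θ : Fin (n + 1) → (UCone R g →ₐ[R] B)) (t : TPow R g n) :
    ordProd (fun i => mat (θ i)) t =
      !![ordProd θ (tPar R g n t), ordProd θ (tD R g n t); 0, ordProd θ t] := by
  induction t using PiTensorProduct.induction_on with
  | smul_tprod r c =>
    have : ordProd (fun i => mat (θ i)) (PiTensorProduct.tprod R c) =
        !![ordProd θ (tPar R g n (PiTensorProduct.tprod R c)),
          ordProd θ (tD R g n (PiTensorProduct.tprod R c)); 0,
          ordProd θ (PiTensorProduct.tprod R c)] := by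
      rw [ordProd_tprod]
      simp only [mat_apply]
      rw [prod_ofFn_matrix]
      congr 2
      · rw [tPar, PiTensorProduct.map_tprod, ordProd_tprod]
        congr 1
        rw [tD, LinearMap.sum_apply, map_sum]
        simp only [PiTensorProduct.map_tprod, ordProd_tprod, dFun]
        congr 1
        refine Finset.sum_congr rfl fun i _ => ?_
        congr 2; ext j
        split_ifs <;> rfl
      · simp
    rw [map_smul, this]
    ext i j; fin_cases i <;> fin_cases j <;> simp
  | add x y hx hy =>
    rw [map_add, hx, hy]
    ext i j; fin_cases i <;> fin_cases j <;> simp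

theorem ordProd_mul_sing {B : Type*} [Ring B] [Algebra R B] {n : ℕ}
    (θ : Fin (n + 1) → (UCone R g →ₐ[R] B)) (t : TPow R g n) (a : UCone R g) :
    ordProd θ (t * sing R g (Fin.last n) a) = ordProd θ t * θ (Fin.last n) a := by
  induction t using PiTensorProduct.induction_on with
  | smul_tprod r c =>
    rw [smul_mul_assoc, map_smul, map_smul, smul_mul_assoc, tprod_mul_sing, ordProd_tprod,
      ordProd_tprod, ← prod_ofFn_update_last]
    congr 3; ext j
    by_cases h : j = Fin.last n
    · subst h; simp
    · simp [h]
  | add x y hx hy => rw [add_mul, map_add, hx, hy, map_add, add_mul]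

theorem tD_mul_sing {n : ℕ} (t : TPow R g n) (a : UCone R g) :
    tD R g n (t * sing R g (Fin.last n) a) = tD R g n t * sing R g (Fin.last n) a +
      tPar R g n t * sing R g (Fin.last n) (UCone.d R g a) := by
  have h1 := ordProd_mul_sing (fun i => mat (sing R g (n := n) i)) t a
  rw [ordProd_mat, ordProd_mat, mat_apply, ordProd_sing] at h1
  have := congrFun (congrFun h1 0) 1
  simpa [Matrix.mul_apply, Fin.sum_univ_two, add_comm] using this

theorem tPar_of_mem {n k : ℕ} {t : TPow R g n} (ht : t ∈ tDeg R g n k) :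
    tPar R g n t = (-1 : R) ^ k • t := by
  induction ht using Submodule.span_induction with
  | mem t h =>
    obtain ⟨κ, c, hc, rfl, rfl⟩ := h
    rw [tPar, PiTensorProduct.map_tprod]
    have : (fun i => (UCone.par R g).toLinearMap (c i)) = fun i => ((-1 : R) ^ κ i) • c i :=
      funext fun i => UCone.par_of_mem (hc i)
    rw [this, MultilinearMap.map_smul_univ, Finset.prod_pow_eq_pow_sum]
  | zero => simp
  | add x y _ _ hx hy => rw [map_add, hx, hy, smul_add]
  | smul r x _ hx => rw [map_smul, hx, smul_comm]

theorem tD_tD {n : ℕ} (t : TPow R g n) : tD R g n (tD R g n t) = 0 := by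
  induction t using PiTensorProduct.induction_on with
  | add x y hx hy => rw [map_add, map_add, hx, hy, add_zero]
  | smul_tprod r c =>
    rw [map_smul, map_smul]
    have h1 : tD R g n (tD R g n (PiTensorProduct.tprod R c)) =
        ∑ p : Fin (n + 1) × Fin (n + 1),
          PiTensorProduct.tprod R fun j => dFun R g p.2 j (dFun R g p.1 j (c j)) := by
      rw [Fintype.sum_prod_type]
      simp only [tD, LinearMap.sum_apply, map_sum, PiTensorProduct.map_tprod]
    have hz : ∀ i : Fin (n + 1),
        (PiTensorProduct.tprod R fun j => dFun R g i j (dFun R g i j (c j))) = 0 := fun i =>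
      MultilinearMap.map_coord_zero _ i (by simp [dFun, UCone.d_d])
    have hlt : ∀ i k : Fin (n + 1), i < k →
        (PiTensorProduct.tprod R fun j => dFun R g k j (dFun R g i j (c j))) =
          -PiTensorProduct.tprod R fun j => dFun R g i j (dFun R g k j (c j)) := by
      intro i k hik
      have h2 : (fun j => dFun R g k j (dFun R g i j (c j))) =
          Function.update (fun j => dFun R g i j (dFun R g k j (c j))) i
            (-(dFun R g i i (dFun R g k i (c i)))) := by
        ext j
        by_cases h : j = i
        · subst h; simp [dFun, hik, UCone.d_par]
        · rw [Function.update_of_ne h]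
          rcases lt_trichotomy j i with h1 | h1 | h1
          · simp [dFun, h1, h1.trans hik]
          · exact absurd h1 h
          · rcases lt_trichotomy j k with h3 | h3 | h3
            · simp [dFun, h1.not_gt, h, h3]
            · subst h3; simp [dFun, h1.not_gt, h]
            · simp [dFun, h1.not_gt, h, h3.not_gt, h3.ne']
      rw [h2, MultilinearMap.map_update_neg, Function.update_eq_self]
    rw [h1, Finset.sum_involution (fun p _ => (p.2, p.1)), smul_zero]
    · rintro ⟨i, k⟩ _
      rcases lt_trichotomy i k with h | h | h
      · simp only [hlt i k h, neg_add_cancel]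
      · subst h; simp only [hz, add_zero]
      · simp only [hlt k i h, add_neg_cancel]
    · rintro ⟨i, k⟩ _ h0 h
      have : i = k := (Prod.ext_iff.1 h).2
      subst this
      exact h0 (hz i)
    · intro p _; exact Finset.mem_univ _
    · intro p _; rfl

theorem dFun_incl_mul {n : ℕ} (i j : Fin (n + 1)) (s : UniversalEnvelopingAlgebra R g)
    (a : UCone R g) : dFun R g i j (UCone.incl R g s * a) = UCone.incl R g s * dFun R g i j a := by
  rw [dFun]; split_ifs <;> simp [UCone.par_incl, UCone.d_mul, UCone.d_incl]

theorem dFun_mul_incl {n : ℕ} (i j : Fin (n + 1)) (s : UniversalEnvelopingAlgebra R g)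
    (a : UCone R g) : dFun R g i j (a * UCone.incl R g s) = dFun R g i j a * UCone.incl R g s := by
  rw [dFun]; split_ifs <;> simp [UCone.par_incl, UCone.d_mul, UCone.d_incl]

theorem tD_barRel (n : ℕ) : barRel R g n ≤ (barRel R g n).comap (tD R g n) := by
  intro t ht
  rw [Submodule.mem_comap, tD, LinearMap.sum_apply]
  exact sum_mem fun i _ => map_mem_barRel _ (fun j s a => dFun_incl_mul i j s a)
    (fun j s a => dFun_mul_incl i j.castSucc s a) ht

theorem tD_mem_aux {n k : ℕ} {t : TPow R g n} (ht : t ∈ tDeg R g n k) :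
    (∀ j, k = j + 1 → tD R g n t ∈ tDeg R g n j) ∧ (k = 0 → tD R g n t = 0) := by
  induction ht using Submodule.span_induction with
  | mem t h =>
    obtain ⟨κ, c, hc, rfl, rfl⟩ := h
    have h0 : ∀ i, κ i = 0 → PiTensorProduct.map (dFun R g i) (PiTensorProduct.tprod R c) = 0 := by
      intro i hi
      rw [PiTensorProduct.map_tprod]
      refine MultilinearMap.map_coord_zero _ i ?_
      have := hc i
      rw [hi] at this
      simp [dFun, UCone.d_mem_zero this]
    rw [tD, LinearMap.sum_apply]
    refine ⟨fun j hj => sum_mem fun i _ => ?_, fun hk => Finset.sum_eq_zero fun i _ => h0 i ?_⟩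
    · rcases hκ : κ i with _ | p
      · rw [h0 i hκ]; exact zero_mem _
      · rw [PiTensorProduct.map_tprod]
        refine Submodule.subset_span ⟨Function.update κ i p, _, fun l => ?_, ?_, rfl⟩
        · by_cases h : l = i
          · subst h
            have := hc l
            rw [hκ] at this
            simpa [dFun] using UCone.d_mem this
          · rw [Function.update_of_ne h, dFun]
            split_ifs
            · rw [AlgHom.toLinearMap_apply, UCone.par_of_mem (hc l)]
              exact Submodule.smul_mem _ _ (hc l)
            · exact hc l
        · rw [Finset.sum_update_of_mem (Finset.mem_univ i)]
          rw [Finset.sum_eq_add_sum_sdiff_singleton_of_mem (Finset.mem_univ i) κ, hκ] at hj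
          omega
    · exact (Finset.sum_eq_zero_iff.1 hk) i (Finset.mem_univ i)
  | zero => simp
  | add a b _ _ ha hb =>
    refine ⟨fun j hj => ?_, fun h0 => by simp [ha.2 h0, hb.2 h0]⟩
    rw [map_add]; exact add_mem (ha.1 j hj) (hb.1 j hj)
  | smul r a _ ha =>
    refine ⟨fun j hj => ?_, fun h0 => by simp [ha.2 h0]⟩
    rw [map_smul]; exact Submodule.smul_mem _ _ (ha.1 j hj)

/-! #### The right action -/

variable (R g) in
/-- The right multiplication of `U[C𝔤]` on the last factor of the tensor power. -/
def tAct (n : ℕ) : TPow R g n →ₗ[R] UCone R g →ₗ[R] TPow R g n :=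
  LinearMap.mk₂ R (fun t a => t * sing R g (Fin.last n) a)
    (fun _ _ _ => add_mul _ _ _) (fun _ _ _ => smul_mul_assoc _ _ _)
    (fun t a b => by rw [map_add, mul_add]) (fun r t a => by rw [map_smul, mul_smul_comm])

theorem tAct_apply {n : ℕ} (t : TPow R g n) (a : UCone R g) :
    tAct R g n t a = t * sing R g (Fin.last n) a := rfl

theorem tAct_barRel {n : ℕ} (a : UCone R g) :
    ∀ t ∈ barRel R g n, tAct R g n t a ∈ barRel R g n := by
  have h1 : ∀ t, tAct R g n t a = PiTensorProduct.map (fun j : Fin (n + 1) =>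
      if j = Fin.last n then LinearMap.mulRight R a else LinearMap.id) t := by
    intro t
    induction t using PiTensorProduct.induction_on with
    | smul_tprod r c =>
      rw [map_smul, map_smul, LinearMap.smul_apply, tAct_apply, tprod_mul_sing,
        PiTensorProduct.map_tprod]
      congr 2; ext j
      by_cases h : j = Fin.last n
      · subst h; simp
      · simp [h]
    | add x y hx hy => rw [map_add, LinearMap.add_apply, hx, hy, map_add]
  intro t ht
  rw [h1]
  refine map_mem_barRel _ (fun j s b => ?_) (fun j s b => ?_) ht
  · split_ifs
    · simp [mul_assoc]
    · rfl
  · rw [if_neg (Fin.castSucc_lt_last j).ne]; rfl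

end Bar

section Bar

variable (R : Type u) [CommRing R] (g : Type v) [LieRing g] [LieAlgebra R g]

theorem barDeg_isInternal (n : ℕ) :
    DirectSum.IsInternal fun k => (tDeg R g n k).map (barRel R g n).mkQ := by
  refine isInternal_of_proj _
    (fun k => (barRel R g n).mapQ (barRel R g n) (tProj R g n k) (tProj_barRel n k)) ?_ ?_ ?_
  · rintro k _ ⟨x, hx, rfl⟩
    exact congrArg (barRel R g n).mkQ ((tProj_of_mem hx).trans (if_pos rfl))
  · rintro k l hkl _ ⟨x, hx, rfl⟩
    exact (congrArg (barRel R g n).mkQ ((tProj_of_mem hx).trans (if_neg hkl.symm))).trans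
      (map_zero _)
  · rw [← Submodule.map_iSup, iSup_tDeg, Submodule.map_top, Submodule.range_mkQ]

/-- The right action of `U[C𝔤]` on the last factor. -/
def barAct (n : ℕ) : (TPow R g n ⧸ barRel R g n) →ₗ[R] UCone R g →ₗ[R] (TPow R g n ⧸ barRel R g n) :=
  (barRel R g n).liftQ ((tAct R g n).compr₂ (barRel R g n).mkQ) (by
    intro x hx
    rw [LinearMap.mem_ker]
    refine LinearMap.ext fun a => ?_
    exact (Submodule.Quotient.mk_eq_zero _).2 (tAct_barRel a x hx))

theorem barAct_mk {n : ℕ} (x : TPow R g n) (a : UCone R g) :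
    barAct R g n ((barRel R g n).mkQ x) a =
      (barRel R g n).mkQ (x * sing R g (Fin.last n) a) := rfl

/-- The differential on the quotient. -/
def barD (n : ℕ) : (TPow R g n ⧸ barRel R g n) →ₗ[R] (TPow R g n ⧸ barRel R g n) :=
  (barRel R g n).mapQ (barRel R g n) (tD R g n) (tD_barRel n)

theorem barD_mk {n : ℕ} (x : TPow R g n) :
    barD R g n ((barRel R g n).mkQ x) = (barRel R g n).mkQ (tD R g n x) := rfl

/-- The degree `n` part `R ⊗ U[C𝔤] ⊗ … ⊗ U[C𝔤]` (`n + 1` factors `U[C𝔤]`, tensor products over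
`U[𝔤]`) of the relative bar construction, as a right `U[C𝔤]`-complex: the quotient of the tensor
power over `R` by the relations which define the tensor product over `U[𝔤]`. -/
def barObj (n : ℕ) : DGMod R g where
  carrier := TPow R g n ⧸ barRel R g n
  deg k := (tDeg R g n k).map (barRel R g n).mkQ
  isInternal := barDeg_isInternal R g n
  d := barD R g n
  d_mem := by
    rintro k _ ⟨x, hx, rfl⟩
    exact ⟨_, (tD_mem_aux hx).1 k rfl, rfl⟩
  d_zero := by
    rintro _ ⟨x, hx, rfl⟩
    rw [barD_mk, (tD_mem_aux hx).2 rfl, map_zero]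
  d_d x := by
    obtain ⟨x, rfl⟩ := (barRel R g n).mkQ_surjective x
    rw [barD_mk, barD_mk, tD_tD, map_zero]
  act := barAct R g n
  act_one x := by
    obtain ⟨x, rfl⟩ := (barRel R g n).mkQ_surjective x
    rw [barAct_mk, map_one, mul_one]
  act_mul x a b := by
    obtain ⟨x, rfl⟩ := (barRel R g n).mkQ_surjective x
    rw [barAct_mk, barAct_mk, barAct_mk, map_mul (sing R g (Fin.last n)), mul_assoc]
  act_mem := by
    rintro i j _ a ⟨x, hx, rfl⟩ ha
    exact ⟨_, mul_sing_mem (Fin.last n) ha hx, rfl⟩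
  d_act := by
    rintro i _ a ⟨x, hx, rfl⟩
    rw [barAct_mk, barD_mk, barD_mk, barAct_mk, barAct_mk, tD_mul_sing, tPar_of_mem hx,
      smul_mul_assoc, map_add, map_smul]

variable {R g}

/-- The element `1 ⊗ a₀ ⊗ … ⊗ aₙ` of the relative bar construction. -/
def barMk {n : ℕ} (a : Fin (n + 1) → UCone R g) : (barObj R g n).carrier :=
  (barRel R g n).mkQ (PiTensorProduct.tprod R a)

/-- For a monotone map `f : [m] → [n]` and `i ∈ [n]`, the number of `j ∈ [m]` with `f j ≤ i`. -/
def slot {m n : ℕ} (f : Fin (m + 1) →o Fin (n + 1)) (i : Fin (n + 1)) : Fin (m + 2) :=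
  SimplexCategory.II.map' f i.succ

theorem castSucc_lt_slot_iff {m n : ℕ} (f : Fin (m + 1) →o Fin (n + 1)) (i : Fin (n + 1))
    (j : Fin (m + 1)) : j.castSucc < slot f i ↔ f j ≤ i := by
  rw [slot, SimplexCategory.II.map', Finset.lt_min'_iff]
  constructor
  · intro h
    by_contra hj
    refine lt_irrefl _ (h j.castSucc ?_)
    rw [SimplexCategory.II.castSucc_mem_finset_iff, Fin.succ_le_castSucc_iff]
    exact not_le.1 hj
  · intro h y hy
    obtain ⟨y, rfl⟩ | rfl := y.eq_castSucc_or_eq_last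
    · rw [SimplexCategory.II.castSucc_mem_finset_iff, Fin.succ_le_castSucc_iff] at hy
      rw [Fin.castSucc_lt_castSucc_iff]
      by_contra hc
      exact absurd (f.monotone (not_lt.1 hc)) (not_le.2 (h.trans_lt hy))
    · exact Fin.castSucc_lt_last j

theorem slot_monotone {m n : ℕ} (f : Fin (m + 1) →o Fin (n + 1)) : Monotone (slot f) := by
  intro i i' h
  by_contra hc
  rw [not_le] at hc
  obtain ⟨j, hj⟩ := Fin.eq_castSucc_of_ne_last (Fin.ne_last_of_lt hc)
  rw [← hj] at hc
  have h1 := (castSucc_lt_slot_iff f i j).1 hc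
  have h2 := (castSucc_lt_slot_iff f i' j).2 (h1.trans h)
  rw [← hj] at h2
  exact lt_irrefl _ h2

theorem slot_last {m n : ℕ} (f : Fin (m + 1) →o Fin (n + 1)) :
    slot f (Fin.last n) = Fin.succ (Fin.last m) := by
  rw [slot, Fin.succ_last, SimplexCategory.II.map'_last, Fin.succ_last]

theorem slot_id {n : ℕ} (i : Fin (n + 1)) : slot OrderHom.id i = i.succ := by
  rw [slot, SimplexCategory.II.map'_id]

/-- The map `1 ⊗ a₀ ⊗ … ⊗ aₙ ↦ 1 ⊗ b₀ ⊗ … ⊗ bₘ` of tensor powers induced by `f : [m] → [n]`,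
where `bⱼ` is the product of the `aᵢ` with `f(j) ≤ i < f(j+1)` (`f j ≤ i` for `j = m`) in
increasing order, and where the augmentation is applied to the `aᵢ` with `i < f(0)`. -/
def tMap {m n : ℕ} (f : Fin (m + 1) →o Fin (n + 1)) : TPow R g n →ₗ[R] TPow R g m :=
  ordProd fun i => extend (sing R g) (slot f i)

theorem tMap_tprod {m n : ℕ} (f : Fin (m + 1) →o Fin (n + 1)) (a : Fin (n + 1) → UCone R g) :
    tMap f (PiTensorProduct.tprod R a) =
      word (sing R g) (List.ofFn fun i => (slot f i, a i)) := by
  rw [tMap, ordProd_tprod, word, List.map_ofFn]; rfl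

theorem ofFn_slot_pairwise {m n : ℕ} (f : Fin (m + 1) →o Fin (n + 1))
    (a : Fin (n + 1) → UCone R g) :
    (List.ofFn fun i => (slot f i, a i)).Pairwise fun p q => p.1 ≤ q.1 := by
  rw [List.pairwise_ofFn]
  exact fun i j h => slot_monotone f h.le

theorem ordProd_tMap {B : Type*} [Ring B] [Algebra R B] {m n : ℕ}
    (φ : Fin (m + 1) → (UCone R g →ₐ[R] B)) (f : Fin (m + 1) →o Fin (n + 1)) (t : TPow R g n) :
    ordProd φ (tMap f t) = ordProd (fun i => extend φ (slot f i)) t := by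
  induction t using PiTensorProduct.induction_on with
  | smul_tprod r c =>
    rw [map_smul, map_smul, map_smul, tMap_tprod, ordProd_word _ _ (ofFn_slot_pairwise f c),
      ordProd_tprod, word, List.map_ofFn]
    rfl
  | add x y hx hy => rw [map_add, map_add, hx, hy, map_add]

theorem tMap_id {n : ℕ} (t : TPow R g n) : tMap OrderHom.id t = t := by
  have h : (fun i : Fin (n + 1) => extend (sing R g (n := n)) (slot OrderHom.id i)) =
      sing R g := by
    funext i; rw [slot_id, extend_succ]
  rw [tMap, h, ordProd_sing]; rfl

theorem extend_extend_slot {B : Type*} [Ring B] [Algebra R B] {l m : ℕ}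
    (φ : Fin (l + 1) → (UCone R g →ₐ[R] B)) (f : Fin (l + 1) →o Fin (m + 1)) (x : Fin (m + 2)) :
    extend (fun i => extend φ (slot f i)) x = extend φ (SimplexCategory.II.map' f x) := by
  cases x using Fin.cases with
  | zero => rw [SimplexCategory.II.map'_zero]; rfl
  | succ i => rfl

theorem tMap_tMap {l m n : ℕ} (f : Fin (m + 1) →o Fin (n + 1)) (f' : Fin (l + 1) →o Fin (m + 1))
    (t : TPow R g n) : tMap f' (tMap f t) = tMap (f.comp f') t := by
  rw [tMap, ordProd_tMap, tMap]
  congr 1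
  congr 1; funext i
  rw [extend_extend_slot, slot, slot, SimplexCategory.II.map'_map']

theorem take_ofFn_slot {m n : ℕ} (f : Fin (m + 1) →o Fin (n + 1)) (a : Fin (n + 1) → UCone R g)
    (j : Fin n) : ∀ p ∈ (List.ofFn fun i => (slot f i, a i)).take (j + 1),
      p.1 ≤ slot f j.castSucc := by
  intro p hp
  obtain ⟨i, hi, rfl⟩ := List.mem_iff_getElem.1 hp
  simp only [List.getElem_take, List.getElem_ofFn]
  refine slot_monotone f (Fin.le_def.2 ?_)
  simp at hi ⊢; omega

theorem drop_ofFn_slot {m n : ℕ} (f : Fin (m + 1) →o Fin (n + 1)) (a : Fin (n + 1) → UCone R g)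
    (j : Fin n) : ∀ p ∈ (List.ofFn fun i => (slot f i, a i)).drop (j + 1),
      slot f j.succ ≤ p.1 := by
  intro p hp
  obtain ⟨i, hi, rfl⟩ := List.mem_iff_getElem.1 hp
  simp only [List.getElem_drop, List.getElem_ofFn]
  refine slot_monotone f (Fin.le_def.2 ?_)
  simp

theorem ofFn_extend_update {m n : ℕ} (f : Fin (m + 1) →o Fin (n + 1))
    (a : Fin (n + 1) → UCone R g) (j : Fin (n + 1)) (b : UCone R g) :
    (fun i => extend (sing R g) (slot f i) (Function.update a j b i)) =
      Function.update (fun i => extend (sing R g) (slot f i) (a i)) j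
        (extend (sing R g) (slot f j) b) := by
  funext i
  by_cases h : i = j
  · subst h; simp
  · simp [h]

theorem word_eq_prod {m n : ℕ} (f : Fin (m + 1) →o Fin (n + 1)) (a : Fin (n + 1) → UCone R g)
    (j : ℕ) :
    word (sing R g) ((List.ofFn fun i => (slot f i, a i)).take j) =
        ((List.ofFn fun i => extend (sing R g) (slot f i) (a i)).take j).prod ∧
      word (sing R g) ((List.ofFn fun i => (slot f i, a i)).drop j) =
        ((List.ofFn fun i => extend (sing R g) (slot f i) (a i)).drop j).prod := by
  constructor
  · rw [word, List.map_take, List.map_ofFn]; rfl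
  · rw [word, List.map_drop, List.map_ofFn]; rfl

theorem tMap_barRel {m n : ℕ} (f : Fin (m + 1) →o Fin (n + 1)) :
    barRel R g n ≤ (barRel R g m).comap (tMap f) := by
  refine Submodule.span_le.2 ?_
  rintro t (⟨s, a, rfl⟩ | ⟨j, s, a, rfl⟩)
  · have h1 : tMap f (PiTensorProduct.tprod R (Function.update a 0 (UCone.incl R g s * a 0))) =
        extend (sing R g (n := m)) (slot f 0) (UCone.incl R g s) *
          tMap f (PiTensorProduct.tprod R a) := by
      rw [tMap, ordProd_tprod, ordProd_tprod, ofFn_extend_update, map_mul,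
        prod_ofFn_update_mul _ _ 0 (by simp)]
    have h2 := word_telescope s 0 (slot f 0) (Fin.zero_le _) []
      (List.ofFn fun i => (slot f i, a i)) (by simp) (by
        intro p hp
        obtain ⟨i, rfl⟩ := List.mem_ofFn.1 hp
        exact slot_monotone f (Fin.zero_le i))
    rw [SetLike.mem_coe, Submodule.mem_comap, map_sub, h1, map_smul, tMap_tprod, ← neg_sub]
    refine neg_mem ?_
    simpa [word, extend_zero, ← Algebra.smul_def] using h2
  · have h2 := word_telescope s (slot f j.castSucc) (slot f j.succ)
      (slot_monotone f Fin.castSucc_lt_succ.le) _ _ (take_ofFn_slot f a j) (drop_ofFn_slot f a j)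
    rw [(word_eq_prod f a _).1, (word_eq_prod f a _).2, ← prod_ofFn_left, ← prod_ofFn_right,
      ← map_mul, ← map_mul, ← ofFn_extend_update, ← ofFn_extend_update] at h2
    rw [SetLike.mem_coe, Submodule.mem_comap, map_sub, tMap, ordProd_tprod, ordProd_tprod]
    exact h2

theorem word_mem_tDeg {m : ℕ} (l : List (Fin (m + 2) × UCone R g)) (κ : List ℕ)
    (h : List.Forall₂ (fun p k => p.2 ∈ UCone.deg R g k) l κ) :
    word (sing R g) l ∈ tDeg R g m κ.sum := by
  induction h with
  | nil => exact one_mem_tDeg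
  | @cons p k l κ hp _ ih =>
    obtain ⟨x, a⟩ := p
    rw [word_cons, List.sum_cons]
    cases x using Fin.cases with
    | zero =>
      rw [extend_zero, ← Algebra.smul_def]
      by_cases hk : k = 0
      · subst hk; rw [zero_add]; exact Submodule.smul_mem _ _ ih
      · rw [UCone.counit_of_mem hk hp, zero_smul]; exact zero_mem _
    | succ i => exact sing_mul_mem i hp ih

theorem tMap_mem {m n k : ℕ} (f : Fin (m + 1) →o Fin (n + 1)) {t : TPow R g n}
    (ht : t ∈ tDeg R g n k) : tMap f t ∈ tDeg R g m k := by
  induction ht using Submodule.span_induction with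
  | mem t h =>
    obtain ⟨κ, a, ha, rfl, rfl⟩ := h
    rw [tMap_tprod, ← List.sum_ofFn (f := κ)]
    refine word_mem_tDeg _ _ ?_
    rw [List.forall₂_iff_get]
    refine ⟨by simp, fun i h1 h2 => ?_⟩
    rw [List.get_ofFn, List.get_ofFn]
    exact ha _
  | zero => simp
  | add a b _ _ ha hb => rw [map_add]; exact add_mem ha hb
  | smul r a _ ha => rw [map_smul]; exact Submodule.smul_mem _ _ ha

theorem extend_mat {B : Type*} [Ring B] [Algebra R B] {m : ℕ}
    (φ : Fin (m + 1) → (UCone R g →ₐ[R] B)) (x : Fin (m + 2)) :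
    extend (fun i => mat (φ i)) x = mat (extend φ x) := by
  cases x using Fin.cases with
  | zero =>
    ext a i j
    rw [mat_apply, extend_zero, extend_zero, extend_zero, extend_zero, UCone.counit_par,
      UCone.counit_d]
    fin_cases i <;> fin_cases j <;> simp [Matrix.algebraMap_matrix_apply]
  | succ i => rfl

theorem tMap_tD {m n : ℕ} (f : Fin (m + 1) →o Fin (n + 1)) (t : TPow R g n) :
    tMap f (tD R g n t) = tD R g m (tMap f t) := by
  have h := ordProd_tMap (fun i => mat (sing R g (n := m) i)) f t
  have h' : (fun i => extend (fun i => mat (sing R g (n := m) i)) (slot f i)) =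
      fun i => mat (extend (sing R g) (slot f i)) := funext fun i => extend_mat _ _
  rw [h', ordProd_mat, ordProd_mat, ordProd_sing] at h
  have := congrFun (congrFun h 0) 1
  simpa [tMap] using this.symm

theorem tMap_mul_sing {m n : ℕ} (f : Fin (m + 1) →o Fin (n + 1)) (t : TPow R g n)
    (a : UCone R g) : tMap f (t * sing R g (Fin.last n) a) =
      tMap f t * sing R g (Fin.last m) a := by
  rw [tMap, ordProd_mul_sing, slot_last, extend_succ]

/-- The simplicial operator of the relative bar construction induced by `f : [m] → [n]`. -/
def barMap {m n : ℕ} (f : Fin (m + 1) →o Fin (n + 1)) : barObj R g n ⟶ barObj R g m :=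
  { lin := (barRel R g n).mapQ (barRel R g m) (tMap f) (tMap_barRel f)
    map_deg := by
      rintro k _ ⟨x, hx, rfl⟩
      exact ⟨_, tMap_mem f hx, rfl⟩
    map_d := by
      intro x
      obtain ⟨x, rfl⟩ := (barRel R g n).mkQ_surjective x
      exact congrArg (barRel R g m).mkQ (tMap_tD f x)
    map_act := by
      intro x a
      obtain ⟨x, rfl⟩ := (barRel R g n).mkQ_surjective x
      exact congrArg (barRel R g m).mkQ (tMap_mul_sing f x a) }

theorem barMap_id (n : ℕ) : barMap OrderHom.id = 𝟙 (barObj R g n) := by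
  refine DGMod.hom_ext (LinearMap.ext fun x => ?_)
  obtain ⟨x, rfl⟩ := (barRel R g n).mkQ_surjective x
  exact congrArg (barRel R g n).mkQ (tMap_id x)

theorem barMap_comp {l m n : ℕ} (f : Fin (m + 1) →o Fin (n + 1))
    (f' : Fin (l + 1) →o Fin (m + 1)) :
    barMap f ≫ barMap f' = barMap (R := R) (g := g) (f.comp f') := by
  refine DGMod.hom_ext (LinearMap.ext fun x => ?_)
  obtain ⟨x, rfl⟩ := (barRel R g n).mkQ_surjective x
  exact congrArg (barRel R g l).mkQ (tMap_tMap f f' x)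

variable (R g) in
/-- The simplicial relative bar resolution `β_{U[𝔤]}(R, U[C𝔤], U[C𝔤])`, as a simplicial right
`U[C𝔤]`-complex. In simplicial degree `n` it is `R ⊗ U[C𝔤] ⊗ … ⊗ U[C𝔤]` with `n + 1` factors
`U[C𝔤]` and tensor products over `U[𝔤]`; the face `d₀` applies the augmentation to the first
factor `U[C𝔤]`, the face `dⱼ`, `j ≥ 1`, multiplies the factors with indices `j - 1` and `j`, and
the degeneracy `sⱼ` inserts `1` as the factor with index `j`. -/
def relBar : SimplicialObject (DGMod R g) where
  obj n := barObj R g n.unop.len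
  map f := barMap f.unop.toOrderHom
  map_id n := barMap_id n.unop.len
  map_comp f f' := (barMap_comp f.unop.toOrderHom f'.unop.toOrderHom).symm

end Bar

/-! ### The homogeneous and the nonhomogeneous form of `E𝔤` -/

section TotalObject

variable (R : Type u) [CommRing R] (g : Type v) [LieRing g] [LieAlgebra R g]

/-- The homogeneous form of the total object `E𝔤`, as a simplicial `R`-module: in degree `n` it
is `𝔤^{n+1}`, and the operator induced by `f : [m] → [n]` is `x ↦ (x_{f(0)}, …, x_{f(m)})`. -/
def eg : SimplicialObject (ModuleCat.{v} R) where
  obj n := ModuleCat.of R (Fin (n.unop.len + 1) → g)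
  map f := ModuleCat.ofHom (LinearMap.funLeft R g f.unop.toOrderHom)
  map_id _ := rfl
  map_comp _ _ := rfl

variable {g} in
/-- The nonhomogeneous operator `𝔤^{n+1} → 𝔤^{m+1}` induced by `f : [m] → [n]`: the component
with index `j` is the sum of the `xᵢ` with `f(j) ≤ i < f(j+1)` (`f j ≤ i` for `j = m`). -/
def rightMap {m n : ℕ} (f : Fin (m + 1) →o Fin (n + 1)) :
    (Fin (n + 1) → g) →ₗ[R] (Fin (m + 1) → g) :=
  LinearMap.pi fun j => ∑ i : Fin (n + 1), if slot f i = j.succ then LinearMap.proj i else 0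

variable {g} in
theorem rightMap_apply {m n : ℕ} (f : Fin (m + 1) →o Fin (n + 1)) (x : Fin (n + 1) → g)
    (j : Fin (m + 1)) : rightMap R f x j = ∑ i, if slot f i = j.succ then x i else 0 := by
  rw [rightMap, LinearMap.pi_apply, LinearMap.sum_apply]
  refine Finset.sum_congr rfl fun i _ => ?_
  split_ifs <;> rfl

/-- The linear map `Φ (x₀, …, xₙ) = (x₀ + x₁ + … + xₙ, …, x_{n-1} + xₙ, xₙ)`. -/
def sumLin (n : ℕ) : (Fin (n + 1) → g) →ₗ[R] (Fin (n + 1) → g) :=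
  LinearMap.pi fun k => ∑ i : Fin (n + 1), if k ≤ i then LinearMap.proj i else 0

variable {g} in
theorem sumLin_apply {n : ℕ} (x : Fin (n + 1) → g) (k : Fin (n + 1)) :
    sumLin R g n x k = ∑ i, if k ≤ i then x i else 0 := by
  rw [sumLin, LinearMap.pi_apply, LinearMap.sum_apply]
  refine Finset.sum_congr rfl fun i _ => ?_
  split_ifs <;> rfl

variable {g} in
/-- The map `(y₀, …, yₙ) ↦ (y₀ - y₁, …, y_{n-1} - yₙ, yₙ)`. -/
def diff {n : ℕ} (y : Fin (n + 1) → g) : Fin (n + 1) → g :=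
  fun i => Fin.lastCases (motive := fun _ => g) (y (Fin.last n))
    (fun j => y j.castSucc - y j.succ) i

variable {g}

theorem diff_last {n : ℕ} (y : Fin (n + 1) → g) : diff y (Fin.last n) = y (Fin.last n) := by
  simp [diff]

theorem diff_castSucc {n : ℕ} (y : Fin (n + 1) → g) (j : Fin n) :
    diff y j.castSucc = y j.castSucc - y j.succ := by
  simp [diff]

theorem diff_injective {n : ℕ} : Function.Injective (diff : (Fin (n + 1) → g) → _) := by
  intro y z h
  funext i
  induction i using Fin.reverseInduction with
  | last => simpa only [diff_last] using congrFun h (Fin.last n)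
  | cast j ih =>
    have := congrFun h j.castSucc
    rw [diff_castSucc, diff_castSucc, ih] at this
    exact sub_left_injective this

theorem diff_sumLin {n : ℕ} (x : Fin (n + 1) → g) : diff (sumLin R g n x) = x := by
  funext i
  induction i using Fin.lastCases with
  | last =>
    rw [diff_last, sumLin_apply, Finset.sum_eq_single (Fin.last n)]
    · simp
    · intro i _ hi
      rw [if_neg]
      exact fun h => hi (le_antisymm (Fin.le_last i) h)
    · simp
  | cast j =>
    rw [diff_castSucc, sumLin_apply, sumLin_apply, ← Finset.sum_sub_distrib,
      Finset.sum_eq_single j.castSucc]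
    · rw [if_pos le_rfl, if_neg (not_le.2 Fin.castSucc_lt_succ), sub_zero]
    · intro i _ hi
      have : j.castSucc ≤ i ↔ j.succ ≤ i := by
        rw [← Fin.castSucc_lt_iff_succ_le, lt_iff_le_and_ne]
        exact ⟨fun h => ⟨h, hi.symm⟩, fun h => h.1⟩
      simp [this]
    · simp

theorem sumLin_diff {n : ℕ} (y : Fin (n + 1) → g) : sumLin R g n (diff y) = y :=
  diff_injective (diff_sumLin R (diff y))

theorem sumLin_rightMap {m n : ℕ} (f : Fin (m + 1) →o Fin (n + 1)) (x : Fin (n + 1) → g) :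
    sumLin R g m (rightMap R f x) = fun k => sumLin R g n x (f k) := by
  funext k
  rw [sumLin_apply, sumLin_apply]
  simp only [rightMap_apply]
  have h1 : ∀ j : Fin (m + 1), (if k ≤ j then ∑ i, (if slot f i = j.succ then x i else 0) else 0) =
      ∑ i, if k ≤ j ∧ slot f i = j.succ then x i else 0 := by
    intro j
    split_ifs with h <;> simp [h]
  rw [Finset.sum_congr rfl fun j _ => h1 j, Finset.sum_comm]
  refine Finset.sum_congr rfl fun i _ => ?_
  rw [← if_congr (castSucc_lt_slot_iff f i k) rfl rfl]
  generalize slot f i = y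
  cases y using Fin.cases with
  | zero => simp [(Fin.succ_ne_zero _).symm]
  | succ y =>
    rw [Finset.sum_eq_single y]
    · simp [Fin.castSucc_lt_succ_iff]
    · intro b _ hb
      rw [if_neg]
      exact fun h => hb (Fin.succ_injective _ h.2).symm
    · simp

theorem sumLin_injective (n : ℕ) : Function.Injective (sumLin R g n) :=
  Function.LeftInverse.injective (diff_sumLin R)

variable (g)

/-- The nonhomogeneous form `(E𝔤)^right` of the total object, as a simplicial `R`-module. The
face `d₀` omits `x₀`, the face `dⱼ`, `j ≥ 1`, replaces `x_{j-1}, xⱼ` by `x_{j-1} + xⱼ`, and the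
degeneracy `sⱼ` inserts `0` in position `j`. -/
def egRight : SimplicialObject (ModuleCat.{v} R) where
  obj n := ModuleCat.of R (Fin (n.unop.len + 1) → g)
  map f := ModuleCat.ofHom (rightMap R f.unop.toOrderHom)
  map_id n := ModuleCat.hom_ext (LinearMap.ext fun x =>
    sumLin_injective R n.unop.len (sumLin_rightMap R OrderHom.id x))
  map_comp {n m l} f f' := ModuleCat.hom_ext (LinearMap.ext fun x => by
    refine sumLin_injective R l.unop.len ?_
    refine (sumLin_rightMap R (f.unop.toOrderHom.comp f'.unop.toOrderHom) x).trans ?_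
    refine Eq.trans ?_ (sumLin_rightMap R f'.unop.toOrderHom _).symm
    funext k
    exact (congrFun (sumLin_rightMap R f.unop.toOrderHom x) (f'.unop.toOrderHom k)).symm)

/-- The isomorphism `Φ : (E𝔤)^right → E𝔤` of simplicial `R`-modules,
`Φ (x₀, …, xₙ) = (x₀ + x₁ + … + xₙ, …, x_{n-1} + xₙ, xₙ)`. -/
def phi : egRight R g ≅ eg R g :=
  NatIso.ofComponents (fun n => LinearEquiv.toModuleIso
      { sumLin R g n.unop.len with
        invFun := diff
        left_inv := diff_sumLin R
        right_inv := sumLin_diff R })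
    (fun f => ModuleCat.hom_ext (LinearMap.ext fun x => sumLin_rightMap R f.unop.toOrderHom x))

/-- The degree `n` part of `Φ`. -/
def phiLin (n : ℕ) : (Fin (n + 1) → g) →ₗ[R] (Fin (n + 1) → g) :=
  ((phi R g).hom.app (op (SimplexCategory.mk n))).hom

theorem phiLin_apply {n : ℕ} (x : Fin (n + 1) → g) (k : Fin (n + 1)) :
    phiLin R g n x k = ∑ i, if k ≤ i then x i else 0 := sumLin_apply R x k

end TotalObject

end

end WeilBar

/-! Write `A` for `U[C𝔤]` and `S` for `U[𝔤]`. The complex `Λ'_∂[s𝔥]` is cyclic over `U[C𝔥]`,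
generated by its unit. The orbit map `a ↦ 1 · a` (`actOne`) commutes with the differentials because
the unit is a cycle, it is the identity on the exterior algebra (`actOne_inclExt`), and it turns
left multiplication by an element of `U[𝔥]` into multiplication by its augmentation, because `ad`
kills the unit (`actOne_map_incl_mul`). This is the case `n = 0`.

For general `n` the map `Φₙ` need not respect brackets, but its restriction to a single component
does: `Φₙ ∘ inᵢ` is the morphism of Lie algebras `δᵢ(x) = (x, …, x, 0, …, 0)`, with `x` in the
components `0, …, i` (`stairLie`, `phiLin_comp_single`). Each `δᵢ` induces a morphism of
differential graded algebras from `A` to `U[C(𝔤^{n+1})]`, and the comparison map is `1 ⊗ a₀ ⊗ … ⊗ aₙ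
↦ 1 · δ₀(a₀) ⋯ δₙ(aₙ)`. In this form most of the structure is immediate. Degrees and differentials
are respected since the `δᵢ` respect them; the right action is respected since `δₙ` is the diagonal;
the simplicial operator of `f` carries `δᵢ` either to some `δⱼ` or to zero, in the same pattern in
which it multiplies factors of the bar construction or augments them (`map_reindexLie_stairLie`);
and on exterior factors the orbit map disappears and the stated formula with `Λ(sΦₙ)` remains
(`psiHom_barMk_inclExt`).

Two points have content. The first is balancing over `S` (`tPsi_barRel`): `δⱼ(s)` and `δⱼ₊₁(s)` must
act alike on `1 · δ₀(a₀) ⋯ δⱼ(aⱼ)`. For `x` in `𝔤` the difference `δⱼ(x) - δⱼ₊₁(x)` lives in the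
component `j + 1` alone, where all of `δ₀, …, δⱼ` vanish. Its adjoint action therefore kills the
unit and commutes with everything applied to it so far.

The second is bijectivity (`psiHom_bijective`). In the sequence `Λ[𝔤^{n+1}] → Λ[𝔤]^{⊗(n+1)} → (bar
construction) → Λ[𝔤^{n+1}]` the first two maps are surjective and the composite is `Λ(Φₙ)`, which is
invertible; hence the last map is bijective. Surjectivity of the second map uses only that `A` is
spanned by `S · Λ[s𝔤]`: elements of `S` are pushed through the tensor signs to the left until the
augmentation absorbs them. The first map comes from an action of `Λ[𝔤^{n+1}]` on the tensor power by
sign-twisted left multiplications, and it is a right inverse of the ordered product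
(`tensorToExt_extToTensor`). -/

namespace WeilBar

noncomputable section

/-! ### The orbit of the unit of the Cartan-Chevalley-Eilenberg coalgebra -/

section Orbit

variable {R : Type u} [CommRing R] {h : Type v} [LieRing h] [LieAlgebra R h]

variable (R h) in
/-- The map `a ↦ 1 · a` from `U[C𝔥]` to the Cartan-Chevalley-Eilenberg coalgebra. -/
def actOne : UCone R h →ₗ[R] ExteriorAlgebra R h where
  toFun a := (cceAct R h a).unop 1
  map_add' _ _ := by simp
  map_smul' _ _ := by simp

theorem actOne_apply (a : UCone R h) : actOne R h a = (cceAct R h a).unop 1 := rfl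

theorem actOne_one : actOne R h 1 = 1 := by simp [actOne]

theorem actOne_mul (a b : UCone R h) :
    actOne R h (a * b) = (cceAct R h b).unop (actOne R h a) := by
  simp [actOne]

/-- In the Leibniz rule `cceD_act` at `w = 1` the term with `∂ 1` vanishes and the sign automorphism
fixes `1`. -/
theorem cceD_actOne (a : UCone R h) : cceD R h (actOne R h a) = actOne R h (UCone.d R h a) := by
  simp [actOne, cceD_act, cceD_one]

theorem actOne_mem {k : ℕ} {a : UCone R h} (ha : a ∈ UCone.deg R h k) :
    actOne R h a ∈ ⋀[R]^k h := by
  have h1 : (1 : ExteriorAlgebra R h) ∈ ⋀[R]^0 h := by simp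
  simpa [actOne_apply] using act_mem_ext h1 ha

theorem cceAct_inclExt (w v : ExteriorAlgebra R h) :
    (cceAct R h (UCone.inclExt R h v)).unop w = w * v := by
  induction v using ext_induction generalizing w with
  | algebraMap r =>
    rw [AlgHom.commutes, ← Algebra.commutes, ← Algebra.smul_def]
    simp [MulOpposite.algebraMap_apply, Module.algebraMap_end_apply]
  | add a b ha hb => simp [ha, hb, mul_add]
  | ι_mul a m ha => simp [ha, cceAct_sus, mul_assoc]

theorem algebraMapInv_adLin (x : h) (w : ExteriorAlgebra R h) :
    ExteriorAlgebra.algebraMapInv (adLin R h x w) = 0 := by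
  induction w using ext_induction with
  | algebraMap r => simp [ad_algebraMap]
  | add a b ha hb => simp [ha, hb]
  | ι_mul a m ha => simp [ad_ι_mul, ExteriorAlgebra.algebraMapInv]

/-- Both kinds of generators act by zero after projection to `R`: `ad_x` has no component in degree
`0`, and `w ∧ y` has none either. So the projection is linear over the augmentation. -/
theorem algebraMapInv_cceAct (w : ExteriorAlgebra R h) (a : UCone R h) :
    ExteriorAlgebra.algebraMapInv ((cceAct R h a).unop w) =
      ExteriorAlgebra.algebraMapInv w * UCone.counit R h a := by
  induction a using UCone.induction generalizing w with
  | algebraMap r => simp [MulOpposite.algebraMap_apply, Module.algebraMap_end_apply, mul_comm]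
  | lie x => simp [cceAct_lie, algebraMapInv_adLin]
  | sus y => simp [cceAct_sus, ExteriorAlgebra.algebraMapInv]
  | mul a b ha hb => simp [ha, hb, mul_assoc]
  | add a b ha hb => simp [ha, hb, mul_add]

theorem algebraMapInv_actOne (a : UCone R h) :
    ExteriorAlgebra.algebraMapInv (actOne R h a) = UCone.counit R h a := by
  have := algebraMapInv_cceAct (1 : ExteriorAlgebra R h) a
  rwa [map_one (ExteriorAlgebra.algebraMapInv (R := R) (M := h)), one_mul] at this

variable {g : Type v} [LieRing g] [LieAlgebra R g]

theorem map_actOne (φ : g →ₗ⁅R⁆ h) (a : UCone R g) :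
    ExteriorAlgebra.map (φ : g →ₗ[R] h) (actOne R g a) = actOne R h (UCone.map φ a) := by
  simpa [actOne_apply] using map_act φ 1 a

theorem counit_map (φ : g →ₗ⁅R⁆ h) (a : UCone R g) :
    UCone.counit R h (UCone.map φ a) = UCone.counit R g a := by
  have : (UCone.counit R h).comp (UCone.map φ) = UCone.counit R g :=
    UCone.hom_ext (by simp) (by simp)
  exact DFunLike.congr_fun this a

theorem map_inclExt (φ : g →ₗ⁅R⁆ h) (w : ExteriorAlgebra R g) :
    UCone.map φ (UCone.inclExt R g w) =
      UCone.inclExt R h (ExteriorAlgebra.map (φ : g →ₗ[R] h) w) := by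
  have : (UCone.map φ).comp (UCone.inclExt R g) =
      (UCone.inclExt R h).comp (ExteriorAlgebra.map (φ : g →ₗ[R] h)) := by
    ext x; simp
  exact DFunLike.congr_fun this w

/-- The elements `s y` act by right exterior multiplication, so acting on the unit by an element of
the exterior algebra returns that element. The orbit map is thus split surjective. -/
theorem actOne_inclExt (w : ExteriorAlgebra R h) : actOne R h (UCone.inclExt R h w) = w := by
  simpa [actOne_apply] using cceAct_inclExt 1 w

/-- An element of `𝔥` acts on the unit through `ad`, hence by zero, which is its augmentation;
multiplicativity does the rest. The morphism `φ` is present because the first factor of the bar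
construction is sent to `U[C(𝔤^{n+1})]` by `δ₀` and not by the diagonal. -/
theorem actOne_map_incl_mul (φ : g →ₗ⁅R⁆ h) (s : UniversalEnvelopingAlgebra R g)
    (b : UCone R h) : actOne R h (UCone.map φ (UCone.incl R g s) * b) =
      UCone.counit R g (UCone.incl R g s) • actOne R h b := by
  induction s using UCone.env_induction generalizing b with
  | algebraMap r => simp [← Algebra.smul_def]
  | ι x => rw [UCone.incl_ι, actOne_mul, UCone.map_lie, actOne_apply, cceAct_lie, ad_one]; simp
  | mul a b ha hb => simp [mul_assoc, ha, hb, mul_smul]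
  | add a b ha hb => simp [add_mul, ha, hb, add_smul]

/-- If `z` commutes with the image of `φ`, then `ad_z` commutes with the action of `U[C𝔤]` through
`φ`: `[ad_z, ad_{φ x}] = ad_{[z, φ x]} = 0`, and `ad_z (w ∧ φ y)` has no term with `[z, φ y]`. So
the kernel of `ad_z` is stable under this action. -/
theorem adLin_cceAct_map (φ : g →ₗ⁅R⁆ h) {z : h} (hz : ∀ y, ⁅z, φ y⁆ = 0) (a : UCone R g)
    {w : ExteriorAlgebra R h} (hw : adLin R h z w = 0) :
    adLin R h z ((cceAct R h (UCone.map φ a)).unop w) = 0 := by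
  induction a using UCone.induction generalizing w with
  | algebraMap r => simp [MulOpposite.algebraMap_apply, Module.algebraMap_end_apply, hw]
  | lie x =>
    have h1 := ad_lie (R := R) z (φ x) w
    have h2 : adLin R h 0 w = 0 := by rw [← ad_apply, map_zero, LinearMap.zero_apply]
    rw [hz, h2, hw, map_zero, sub_zero] at h1
    simp [cceAct_lie, ← h1]
  | sus y => simp [cceAct_sus, ad_mul, hw, ad_ι, hz]
  | mul a b ha hb => simpa using hb (ha hw)
  | add a b ha hb => simp [ha hw, hb hw]

/-- On a vector killed by all `ad_{φ x - ψ x}` the elements of `𝔤` act alike through `φ` and `ψ`.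
For products the hypothesis must survive one action, which is the stability of `adLin_cceAct_map`.
-/
theorem cceAct_map_incl_congr (φ ψ : g →ₗ⁅R⁆ h) (hφ : ∀ x y, ⁅φ x - ψ x, φ y⁆ = 0)
    (s : UniversalEnvelopingAlgebra R g) {w : ExteriorAlgebra R h}
    (hw : ∀ x, adLin R h (φ x - ψ x) w = 0) :
    (cceAct R h (UCone.map φ (UCone.incl R g s))).unop w =
      (cceAct R h (UCone.map ψ (UCone.incl R g s))).unop w := by
  induction s using UCone.env_induction generalizing w with
  | algebraMap r => simp
  | ι x =>
    have h1 := hw x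
    rw [← ad_apply, map_sub, LinearMap.sub_apply, sub_eq_zero] at h1
    simp only [ad_apply] at h1
    rw [UCone.incl_ι, UCone.map_lie, UCone.map_lie, cceAct_lie, cceAct_lie, h1]
  | mul a b ha hb =>
    -- In a right action `a` acts first, so the induction hypothesis for `b` is needed at the vector
    -- `w · φ(a)`.
    have h1 := hb fun x => adLin_cceAct_map φ (hφ x) (UCone.incl R g a) (hw x)
    simpa [ha hw] using h1
  | add a b ha hb => simp [ha hw, hb hw]

/-- Needed for the degree of an ordered product of homogeneous factors in `stairProd_mem`. -/
instance : SetLike.GradedMonoid (UCone.deg R h) where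
  one_mem := UCone.one_mem
  mul_mem _ _ _ _ ha hb := UCone.mul_mem ha hb

end Orbit

/-! ### The comparison map -/

section Comparison

variable {R : Type u} [CommRing R] {g : Type v} [LieRing g] [LieAlgebra R g]

variable (R g) in
/-- The morphism `x ↦ (x, …, x, 0, …, 0)` from `𝔤` to `𝔤^{n+1}`, with `x` in the components with
index at most `i`. -/
def stairLie {n : ℕ} (i : Fin (n + 1)) : g →ₗ⁅R⁆ (Fin (n + 1) → g) where
  toFun x := fun k => if k ≤ i then x else 0
  map_add' x y := by ext k; by_cases h : k ≤ i <;> simp [h]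
  map_smul' r x := by ext k; by_cases h : k ≤ i <;> simp [h]
  map_lie' {x y} := by ext k; by_cases h : k ≤ i <;> simp [h, pow_lie_apply]

theorem stairLie_apply {n : ℕ} (i : Fin (n + 1)) (x : g) (k : Fin (n + 1)) :
    stairLie R g i x k = if k ≤ i then x else 0 := rfl

/-- This matches the right multiplication on the last factor with the action on the coalgebra of
`𝔤^{n+1}`, which goes through the diagonal. -/
theorem stairLie_last (n : ℕ) : stairLie R g (Fin.last n) = diagLie R g (Fin (n + 1)) := by
  ext x k; simp [stairLie_apply, Fin.le_last]

/-- `Φₙ` itself need not preserve brackets, since different components commute while the images of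
`δᵢ` and `δⱼ` overlap. Its restriction to each component does preserve them, and this is what lets
`Φ` induce maps of enveloping algebras factor by factor. -/
theorem phiLin_comp_single {n : ℕ} (i : Fin (n + 1)) :
    phiLin R g n ∘ₗ LinearMap.single R (fun _ : Fin (n + 1) => g) i = stairLie R g i := by
  refine LinearMap.ext fun x => funext fun k => ?_
  rw [LinearMap.comp_apply, phiLin_apply, Finset.sum_eq_single i]
  · simp [stairLie_apply]
  · intro j _ hj; simp [hj]
  · simp

/-- The difference on the left is concentrated in the component `j + 1`, where `δᵢ` vanishes for `i
≤ j`. -/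
theorem lie_stairLie_sub {n : ℕ} (j : Fin n) {i : Fin (n + 1)} (hi : i ≤ j.castSucc) (x y : g) :
    ⁅stairLie R g j.castSucc x - stairLie R g j.succ x, stairLie R g i y⁆ = 0 := by
  ext k
  rw [pow_lie_apply, Pi.sub_apply, stairLie_apply, stairLie_apply, stairLie_apply]
  by_cases hk : k ≤ i
  · rw [if_pos (hk.trans hi), if_pos ((hk.trans hi).trans Fin.castSucc_lt_succ.le), sub_self,
      zero_lie]; rfl
  · rw [if_neg hk, lie_zero]; rfl

variable (R g) in
/-- The map `a₀ ⊗ … ⊗ aₙ ↦ δ₀(a₀) ⋯ δₙ(aₙ)` to `U[C(𝔤^{n+1})]`, where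
`δᵢ(x) = (x, …, x, 0, …, 0)`. -/
def stairProd (n : ℕ) : TPow R g n →ₗ[R] UCone R (Fin (n + 1) → g) :=
  ordProd fun i => UCone.map (stairLie R g i)

theorem stairProd_mem {n k : ℕ} {t : TPow R g n} (ht : t ∈ tDeg R g n k) :
    stairProd R g n t ∈ UCone.deg R (Fin (n + 1) → g) k := by
  induction ht using Submodule.span_induction with
  | mem t h =>
    obtain ⟨κ, a, ha, rfl, rfl⟩ := h
    rw [stairProd, ordProd_tprod, ← List.sum_ofFn (f := κ)]
    exact SetLike.list_prod_ofFn_mem_graded κ _ fun i => UCone.map_mem _ (ha i)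
  | zero => simp
  | add a b _ _ ha hb => rw [map_add]; exact add_mem ha hb
  | smul r a _ ha => rw [map_smul]; exact Submodule.smul_mem _ _ ha

theorem map_ordProd {B C : Type*} [Ring B] [Algebra R B] [Ring C] [Algebra R C] {n : ℕ}
    (f : B →ₐ[R] C) (θ : Fin (n + 1) → (UCone R g →ₐ[R] B)) (t : TPow R g n) :
    f (ordProd θ t) = ordProd (fun i => f.comp (θ i)) t := by
  induction t using PiTensorProduct.induction_on with
  | smul_tprod r c =>
    rw [map_smul, map_smul, map_smul, ordProd_tprod, ordProd_tprod, map_list_prod, List.map_ofFn]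
    rfl
  | add x y hx hy => rw [map_add, map_add, hx, hy, map_add]

/-- The differential of an ordered product is the upper right entry of the product of the matrices
`[[±a, d a], [0, a]]`. Since `δᵢ` commutes with signs and differentials, forming these matrices
before or after applying `δᵢ` gives the same homomorphism, and comparing upper right entries gives
the claim without any signs to track. -/
theorem stairProd_tD {n : ℕ} (t : TPow R g n) :
    stairProd R g n (tD R g n t) = UCone.d R _ (stairProd R g n t) := by
  have h1 := ordProd_mat (fun i => UCone.map (stairLie R g (n := n) i)) t
  have h2 : (fun i => mat (UCone.map (stairLie R g (n := n) i))) =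
      fun i => (UCone.rho R (Fin (n + 1) → g)).comp (UCone.map (stairLie R g i)) := by
    funext i
    refine AlgHom.ext fun a => ?_
    rw [mat_apply, AlgHom.comp_apply, UCone.rho_eq, UCone.map_par, UCone.map_d]
  rw [h2, ← map_ordProd, UCone.rho_eq] at h1
  exact (congrFun (congrFun h1 0) 1).symm

variable (R g) in
/-- The map `a₀ ⊗ … ⊗ aₙ ↦ 1 · δ₀(a₀) ⋯ δₙ(aₙ)`. -/
def tPsi (n : ℕ) : TPow R g n →ₗ[R] ExteriorAlgebra R (Fin (n + 1) → g) :=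
  actOne R _ ∘ₗ stairProd R g n

/-- Start from the unit, which every `ad` kills, and apply the factors one after the other; each
comes from some `δᵢ` with `i ≤ j`, with which the difference commutes. The last factor acts last, so
the induction removes factors from the right end. -/
theorem adLin_actOne_prod {n : ℕ} (j : Fin n) (x : g)
    (l : List (UCone R (Fin (n + 1) → g)))
    (hl : ∀ b ∈ l, ∃ i ≤ j.castSucc, ∃ c, b = UCone.map (stairLie R g i) c) :
    adLin R _ (stairLie R g j.castSucc x - stairLie R g j.succ x) (actOne R _ l.prod) = 0 := by
  induction l using List.reverseRecOn with
  | nil => rw [List.prod_nil, actOne_one, ad_one]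
  | append_singleton l b ih =>
    obtain ⟨i, hi, c, rfl⟩ := hl b (by simp)
    rw [List.prod_append, List.prod_singleton, actOne_mul]
    exact adLin_cceAct_map _ (fun y => lie_stairLie_sub j hi x y) c
      (ih fun b hb => hl b (by simp [hb]))

/-- The relation at the left end holds because `𝔤` annihilates the unit. The relation at the tensor
sign between the factors `j` and `j + 1` holds because everything to the left of it has produced a
vector on which `δⱼ(s)` and `δⱼ₊₁(s)` act alike. -/
theorem tPsi_barRel (n : ℕ) : barRel R g n ≤ LinearMap.ker (tPsi R g n) := by
  have hup : ∀ (a : Fin (n + 1) → UCone R g) (j : Fin (n + 1)) (b : UCone R g),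
      (fun i => UCone.map (stairLie R g i) (Function.update a j b i)) =
        Function.update (fun i => UCone.map (stairLie R g i) (a i)) j
          (UCone.map (stairLie R g j) b) := by
    intro a j b
    funext i
    by_cases h : i = j
    · subst h; simp
    · simp [h]
  refine Submodule.span_le.2 ?_
  rintro _ (⟨s, a, rfl⟩ | ⟨j, s, a, rfl⟩) <;>
    rw [SetLike.mem_coe, LinearMap.mem_ker, map_sub, sub_eq_zero, tPsi, LinearMap.comp_apply,
      LinearMap.comp_apply, stairProd]
  · rw [map_smul, map_smul, ordProd_tprod, ordProd_tprod, hup, map_mul,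
      prod_ofFn_update_mul _ (fun i => UCone.map (stairLie R g i) (a i)) 0 (by simp),
      actOne_map_incl_mul]
  · rw [ordProd_tprod, ordProd_tprod, hup, hup, map_mul, map_mul,
      prod_ofFn_left _ (fun i => UCone.map (stairLie R g i) (a i)),
      prod_ofFn_right _ (fun i => UCone.map (stairLie R g i) (a i)), actOne_mul, actOne_mul,
      actOne_mul, actOne_mul]
    -- The factors to the right of `s` are common to both sides and act last. Without them the claim
    -- compares `δⱼ(s)` and `δⱼ₊₁(s)` on `1 · δ₀(a₀) ⋯ δⱼ(aⱼ)`.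
    congr 1
    refine cceAct_map_incl_congr _ _ (fun x y => lie_stairLie_sub j le_rfl x y) s fun x =>
      adLin_actOne_prod j x _ ?_
    intro b hb
    obtain ⟨i, hi, rfl⟩ := List.mem_iff_getElem.1 hb
    simp only [List.length_take, List.length_ofFn] at hi
    simp only [List.getElem_take, List.getElem_ofFn]
    exact ⟨_, Fin.le_def.2 (by simp; omega), _, rfl⟩

variable (R g) in
/-- The comparison map in simplicial degree `n`, a morphism of right `U[C𝔤]`-complexes. -/
def psiHom (n : ℕ) : barObj R g n ⟶ powCCE R g (Fin (n + 1)) :=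
  { lin := (barRel R g n).liftQ (tPsi R g n) (tPsi_barRel n)
    map_deg := by
      rintro k _ ⟨x, hx, rfl⟩
      exact actOne_mem (stairProd_mem hx)
    map_d := by
      intro x
      obtain ⟨x, rfl⟩ := (barRel R g n).mkQ_surjective x
      exact (congrArg (actOne R _) (stairProd_tD x)).trans (cceD_actOne _).symm
    map_act := by
      intro x a
      obtain ⟨x, rfl⟩ := (barRel R g n).mkQ_surjective x
      refine (congrArg (actOne R _) (ordProd_mul_sing _ x a)).trans ((actOne_mul _ _).trans ?_)
      -- The last factor is embedded by `δₙ`, which is the diagonal used to define the action on the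
      -- target.
      rw [stairLie_last]
      rfl }

theorem psiHom_mk {n : ℕ} (t : TPow R g n) :
    (psiHom R g n).lin ((barRel R g n).mkQ t) = actOne R _ (stairProd R g n t) := rfl

/-- The component `k` of the reindexed `δᵢ(x)` is `x` exactly when `f k ≤ i`, that is, when `k` is
less than `slot f i`. So the result is a staircase again: if the slot is `j + 1` it is `δⱼ`, and if
the slot is `0` it is the zero morphism, which induces the augmentation on enveloping algebras. -/
theorem map_reindexLie_stairLie {m n : ℕ} (f : Fin (m + 1) →o Fin (n + 1)) (i : Fin (n + 1)) :
    (UCone.map (reindexLie R g f)).comp (UCone.map (stairLie R g i)) =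
      extend (fun j => UCone.map (stairLie R g (n := m) j)) (slot f i) := by
  have key : ∀ x, reindexLie R g f (stairLie R g i x) =
      fun k => if k.castSucc < slot f i then x else 0 := fun x => funext fun k => by
    rw [reindexLie_apply, stairLie_apply, if_congr (castSucc_lt_slot_iff f i k) rfl rfl]
  generalize slot f i = y at key
  cases y using Fin.cases with
  | zero =>
    have h0 : ∀ x, reindexLie R g f (stairLie R g i x) = 0 := fun x => by
      rw [key]; funext k; simp
    refine UCone.hom_ext (fun x => ?_) fun x => ?_
    · rw [AlgHom.comp_apply, UCone.map_lie, UCone.map_lie, h0, extend_zero]; simp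
    · rw [AlgHom.comp_apply, UCone.map_sus, UCone.map_sus, h0, extend_zero]; simp
  | succ j =>
    have h0 : ∀ x, reindexLie R g f (stairLie R g i x) = stairLie R g j x := fun x => by
      rw [key]; funext k; simp [stairLie_apply, Fin.castSucc_lt_succ_iff]
    refine UCone.hom_ext (fun x => ?_) fun x => ?_
    · rw [AlgHom.comp_apply, UCone.map_lie, UCone.map_lie, h0, extend_succ, UCone.map_lie]
    · rw [AlgHom.comp_apply, UCone.map_sus, UCone.map_sus, h0, extend_succ, UCone.map_sus]

/-- The orbit map is natural, so both composites are orbit maps of ordered products; the two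
families of homomorphisms in these products agree by `map_reindexLie_stairLie`. -/
theorem psiHom_naturality {m n : ℕ} (f : Fin (m + 1) →o Fin (n + 1)) :
    barMap f ≫ psiHom R g m = psiHom R g n ≫ powCCEMap R g f := by
  refine DGMod.hom_ext (LinearMap.ext fun x => ?_)
  obtain ⟨x, rfl⟩ := (barRel R g n).mkQ_surjective x
  change actOne R _ (stairProd R g m (tMap f x)) = ExteriorAlgebra.map
    (reindexLie R g f : (Fin (n + 1) → g) →ₗ[R] (Fin (m + 1) → g)) (actOne R _ (stairProd R g n x))
  rw [map_actOne, stairProd, stairProd, ordProd_tMap, map_ordProd]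
  simp only [map_reindexLie_stairLie]

/-- When all factors are exterior, the product of the `δᵢ(wᵢ)` lies in the image of `Λ[𝔤^{n+1}]`,
where the orbit map is the identity. Each `Λ(δᵢ)` factors as `Λ(Φₙ)` after `inᵢ`, and `Λ(Φₙ)` is
multiplicative. -/
theorem psiHom_barMk_inclExt {n : ℕ} (w : Fin (n + 1) → ExteriorAlgebra R g) :
    (psiHom R g n).lin (barMk fun i => UCone.inclExt R g (w i)) =
      ExteriorAlgebra.map (phiLin R g n)
        (List.ofFn fun i =>
          ExteriorAlgebra.map (LinearMap.single R (fun _ : Fin (n + 1) => g) i) (w i)).prod := by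
  refine (psiHom_mk _).trans ?_
  have h1 : (List.ofFn fun i => UCone.map (stairLie R g i) (UCone.inclExt R g (w i))) =
      (List.ofFn fun i => ExteriorAlgebra.map
        (stairLie R g i : g →ₗ[R] (Fin (n + 1) → g)) (w i)).map (UCone.inclExt R _) := by
    rw [List.map_ofFn]
    congr 1; funext i
    exact map_inclExt _ _
  rw [stairProd, ordProd_tprod, h1, ← map_list_prod, actOne_inclExt,
    map_list_prod (ExteriorAlgebra.map (phiLin R g n)), List.map_ofFn]
  congr 2; funext i
  rw [← phiLin_comp_single, Function.comp_apply, ← AlgHom.comp_apply, ExteriorAlgebra.map_comp_map]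

end Comparison

/-! ### The exterior algebra of a power -/

section ExteriorPower

/-- The element `b` is carried past the factors before the index `i`, changing each `u l` to `u' l`,
and is absorbed by the factor `i`. Below, `u'` differs from `u` by the Koszul sign. -/
theorem mul_prod_ofFn_of_swap {B : Type*} [Monoid B] (b : B) : ∀ {n : ℕ} (u u' : Fin n → B)
    (i : Fin n) (_ : ∀ l < i, b * u l = u' l * b),
    b * (List.ofFn u).prod =
      (List.ofFn fun l => if l < i then u' l else if l = i then b * u l else u l).prod
  | 0, _, _, i, _ => i.elim0
  | n + 1, u, u', i, hu => by
    rw [List.ofFn_succ, List.ofFn_succ, List.prod_cons, List.prod_cons]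
    cases i using Fin.cases with
    | zero => simp [mul_assoc, Fin.succ_ne_zero]
    | succ i =>
      rw [← mul_assoc, hu 0 (Fin.succ_pos i), if_pos (Fin.succ_pos i), mul_assoc,
        mul_prod_ofFn_of_swap b (fun l => u l.succ) (fun l => u' l.succ) i
          (fun l hl => hu _ (Fin.succ_lt_succ_iff.2 hl))]
      simp only [Fin.succ_lt_succ_iff, Fin.succ_inj]

variable (R : Type u) [CommRing R] (g : Type v) [LieRing g] [LieAlgebra R g]

/-- The tensor product over `R` of `n + 1` copies of the exterior algebra. -/
abbrev ExtPow (n : ℕ) : Type max u v := ⨂[R] _ : Fin (n + 1), ExteriorAlgebra R g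

/-- The operator `w₀ ⊗ … ⊗ wₙ ↦ (-1)^(|w₀| + … + |w_{i-1}|) w₀ ⊗ … ⊗ y wᵢ ⊗ … ⊗ wₙ`. -/
def extLeft {n : ℕ} (i : Fin (n + 1)) : g →ₗ[R] Module.End R (ExtPow R g n) :=
  -- A tensor product of endomorphisms is multilinear in its factors. All factors but the one with
  -- index `i` are frozen, and the entry of the frozen family at `i` is overwritten by the left
  -- multiplication, so linearity in `y` comes for free.
  (PiTensorProduct.mapMultilinear R (fun _ : Fin (n + 1) => ExteriorAlgebra R g)
      (fun _ : Fin (n + 1) => ExteriorAlgebra R g)).toLinearMap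
    (fun l => if l < i then (extPar R g).toLinearMap else LinearMap.id) i ∘ₗ
    LinearMap.mul R (ExteriorAlgebra R g) ∘ₗ ExteriorAlgebra.ι R

variable {R g}

theorem extLeft_tprod {n : ℕ} (i : Fin (n + 1)) (y : g) (c : Fin (n + 1) → ExteriorAlgebra R g) :
    extLeft R g i y (PiTensorProduct.tprod R c) = PiTensorProduct.tprod R fun l =>
      if l < i then extPar R g (c l) else if l = i then ExteriorAlgebra.ι R y * c l else c l := by
  refine (PiTensorProduct.map_tprod _ c).trans ?_
  congr 1; funext l
  by_cases h : l = i
  · subst h; simp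
  · rw [Function.update_of_ne h]
    split_ifs <;> rfl

theorem extLeft_sq {n : ℕ} (i : Fin (n + 1)) (y : g) :
    extLeft R g i y * extLeft R g i y = 0 := by
  refine PiTensorProduct.ext (MultilinearMap.ext fun c => ?_)
  rw [LinearMap.compMultilinearMap_apply, LinearMap.compMultilinearMap_apply,
    Module.End.mul_apply, extLeft_tprod, extLeft_tprod, LinearMap.zero_apply]
  refine MultilinearMap.map_coord_zero _ i ?_
  rw [if_neg (lt_irrefl i), if_pos rfl, if_neg (lt_irrefl i), if_pos rfl, ← mul_assoc,
    ExteriorAlgebra.ι_sq_zero, zero_mul]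

/-- The two orders differ only in the slot `i`: there the operator at `k` applies the sign
automorphism, and applying it after left multiplication by `y` produces one more sign than applying
it before. -/
theorem extLeft_anticomm {n : ℕ} {i k : Fin (n + 1)} (h : i < k) (y z : g) :
    extLeft R g i y * extLeft R g k z = -(extLeft R g k z * extLeft R g i y) := by
  refine PiTensorProduct.ext (MultilinearMap.ext fun c => ?_)
  rw [LinearMap.compMultilinearMap_apply, LinearMap.compMultilinearMap_apply, LinearMap.neg_apply,
    Module.End.mul_apply, Module.End.mul_apply, extLeft_tprod, extLeft_tprod, extLeft_tprod,
    -- The minus sign is moved into the slot `i`, so that the two pure tensors can be compared slot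
    -- by slot.
    extLeft_tprod, ← neg_one_smul R, eq_comm,
    ← Function.update_eq_self i (fun l => if l < k then extPar R g _ else _),
    ← MultilinearMap.map_update_smul]
  congr 1; funext l
  by_cases hl : l = i
  · subst hl; simp [h]
  · rw [Function.update_of_ne hl]
    rcases lt_or_gt_of_ne hl with h1 | h1
    · simp [h1, h1.trans h]
    · simp [hl, h1.not_gt]

variable (R g) in
/-- The sum of the operators `extLeft`. -/
def extLeftSum (n : ℕ) : (Fin (n + 1) → g) →ₗ[R] Module.End R (ExtPow R g n) :=
  ∑ i, extLeft R g i ∘ₗ LinearMap.proj i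

theorem extLeftSum_apply {n : ℕ} (y : Fin (n + 1) → g) :
    extLeftSum R g n y = ∑ i, extLeft R g i (y i) := by
  simp [extLeftSum]

theorem extLeftSum_single {n : ℕ} (i : Fin (n + 1)) (y : g) :
    extLeftSum R g n (Pi.single i y) = extLeft R g i y := by
  rw [extLeftSum_apply, Finset.sum_eq_single i]
  · simp
  · intro j _ hj; simp [hj]
  · simp

/-- In the expanded square the terms at `(i, k)` and `(k, i)` cancel. The diagonal terms are the
fixed points of this pairing and vanish by `extLeft_sq`; anticommutation alone would not give this,
since `2` need not be invertible. The lemma is what the universal property of the exterior algebra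
asks for. -/
theorem extLeftSum_sq {n : ℕ} (y : Fin (n + 1) → g) :
    extLeftSum R g n y * extLeftSum R g n y = 0 := by
  rw [extLeftSum_apply, Finset.sum_mul_sum, ← Fintype.sum_prod_type',
    Finset.sum_involution (fun p _ => (p.2, p.1))]
  · rintro ⟨i, k⟩ _
    rcases lt_trichotomy i k with h | h | h
    · simp only [extLeft_anticomm h, neg_add_cancel]
    · subst h; simp only [extLeft_sq, add_zero]
    · simp only [extLeft_anticomm h, add_neg_cancel]
  · rintro ⟨i, k⟩ _ h0 h
    have : i = k := (Prod.ext_iff.1 h).2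
    subst this
    exact h0 (extLeft_sq i _)
  · intro p _; exact Finset.mem_univ _
  · intro p _; rfl

variable (R g) in
/-- The action of the exterior algebra of `𝔤^{n+1}` on the tensor power of the exterior algebra
of `𝔤`. -/
def extAct (n : ℕ) :
    ExteriorAlgebra R (Fin (n + 1) → g) →ₐ[R] Module.End R (ExtPow R g n) :=
  ExteriorAlgebra.lift R ⟨extLeftSum R g n, extLeftSum_sq⟩

theorem extAct_ι {n : ℕ} (y : Fin (n + 1) → g) :
    extAct R g n (ExteriorAlgebra.ι R y) = extLeftSum R g n y := by
  simp [extAct]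

variable (R g) in
/-- The map from the exterior algebra of `𝔤^{n+1}` to the tensor power of the exterior algebra
of `𝔤` given by the action on `1 ⊗ … ⊗ 1`. -/
def extToTensor (n : ℕ) : ExteriorAlgebra R (Fin (n + 1) → g) →ₗ[R] ExtPow R g n :=
  LinearMap.applyₗ (PiTensorProduct.tprod R fun _ => 1) ∘ₗ (extAct R g n).toLinearMap

theorem extToTensor_apply {n : ℕ} (w : ExteriorAlgebra R (Fin (n + 1) → g)) :
    extToTensor R g n w = extAct R g n w (PiTensorProduct.tprod R fun _ => 1) := rfl

variable (R g) in
/-- The inclusion `Λ[𝔤] → Λ[𝔤^{n+1}]` of the component with index `i`. -/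
def extIn {n : ℕ} (i : Fin (n + 1)) :
    ExteriorAlgebra R g →ₐ[R] ExteriorAlgebra R (Fin (n + 1) → g) :=
  ExteriorAlgebra.map (LinearMap.single R (fun _ : Fin (n + 1) => g) i)

theorem extIn_ι {n : ℕ} (i : Fin (n + 1)) (y : g) :
    extIn R g i (ExteriorAlgebra.ι R y) = ExteriorAlgebra.ι R (Pi.single i y) := by
  simp [extIn]

/-- Acting in the slot `i` applies the sign automorphism to the earlier slots. These contain `1`,
which it fixes, so no signs appear. -/
theorem extAct_extIn_tprod {n : ℕ} (i : Fin (n + 1)) (w : ExteriorAlgebra R g)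
    (c : Fin (n + 1) → ExteriorAlgebra R g) (hc : ∀ l < i, c l = 1) :
    extAct R g n (extIn R g i w) (PiTensorProduct.tprod R c) =
      PiTensorProduct.tprod R (Function.update c i (w * c i)) := by
  induction w using ext_induction with
  | algebraMap r =>
    rw [AlgHom.commutes, AlgHom.commutes, Module.algebraMap_end_apply, ← Algebra.smul_def,
      MultilinearMap.map_update_smul, Function.update_eq_self]
  | add a b ha hb =>
    rw [map_add, map_add, LinearMap.add_apply, ha, hb, add_mul, MultilinearMap.map_update_add]
  | ι_mul a m ha =>
    rw [map_mul, map_mul, Module.End.mul_apply, ha, extIn_ι, extAct_ι, extLeftSum_single,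
      extLeft_tprod]
    congr 1; funext l
    by_cases h : l = i
    · subst h; simp [mul_assoc]
    · rw [Function.update_of_ne h, Function.update_of_ne h, if_neg h]
      split_ifs with h1
      · rw [hc l h1, map_one]
      · rfl

/-- In an ordered product the rightmost factor acts first. When the factor with index `i` acts, the
slots before `i` still contain `1`, so `extAct_extIn_tprod` applies each time. -/
theorem extToTensor_prod {n : ℕ} (w : Fin (n + 1) → ExteriorAlgebra R g) :
    extToTensor R g n (List.ofFn fun i => extIn R g i (w i)).prod = PiTensorProduct.tprod R w := by
  -- The product of the factors with index at least `k` fills exactly the slots from `k` on. The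
  -- induction descends from `k = n + 1`, the empty product.
  have key : ∀ k ≤ n + 1, extToTensor R g n
      ((List.ofFn fun i => extIn R g i (w i)).drop k).prod =
        PiTensorProduct.tprod R fun l : Fin (n + 1) => if k ≤ l then w l else 1 := by
    intro k hk
    induction hk using Nat.decreasingInduction with
    | self =>
      rw [List.drop_of_length_le (by simp), List.prod_nil, extToTensor_apply, map_one,
        Module.End.one_apply]
      congr 1; funext l
      rw [if_neg (not_le.2 l.isLt)]
    | of_succ k hk ih =>
      rw [List.drop_eq_getElem_cons (by simpa using hk), List.prod_cons, extToTensor_apply, map_mul,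
        Module.End.mul_apply, ← extToTensor_apply, ih, List.getElem_ofFn, extAct_extIn_tprod]
      · congr 1; funext l
        by_cases h : l = ⟨k, hk⟩
        · subst h; simp
        · rw [Function.update_of_ne h]
          refine if_congr ?_ rfl rfl
          have : (l : ℕ) ≠ k := fun h' => h (Fin.ext h')
          omega
      · intro l hl
        rw [if_neg]
        rw [Fin.lt_def] at hl
        simp at hl ⊢; omega
  simpa using key 0 (Nat.zero_le _)

theorem extToTensor_surjective (n : ℕ) : Function.Surjective (extToTensor R g n) := by
  rw [← LinearMap.range_eq_top, eq_top_iff, ← PiTensorProduct.span_tprod_eq_top, Submodule.span_le]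
  rintro _ ⟨w, rfl⟩
  exact ⟨_, extToTensor_prod w⟩

variable (R g) in
/-- The ordered product `w₀ ⊗ … ⊗ wₙ ↦ in₀(w₀) ∧ … ∧ inₙ(wₙ)`. -/
def tensorToExt (n : ℕ) : ExtPow R g n →ₗ[R] ExteriorAlgebra R (Fin (n + 1) → g) :=
  PiTensorProduct.lift ((MultilinearMap.mkPiAlgebraFin R (n + 1) _).compLinearMap
    fun i => (extIn R g i).toLinearMap)

theorem tensorToExt_tprod {n : ℕ} (w : Fin (n + 1) → ExteriorAlgebra R g) :
    tensorToExt R g n (PiTensorProduct.tprod R w) =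
      (List.ofFn fun i => extIn R g i (w i)).prod := by
  simp [tensorToExt]

theorem ι_mul_extIn {n : ℕ} (y : Fin (n + 1) → g) (l : Fin (n + 1)) (w : ExteriorAlgebra R g) :
    ExteriorAlgebra.ι R y * extIn R g l w = extIn R g l (extPar R g w) * ExteriorAlgebra.ι R y := by
  induction w using ext_induction with
  | algebraMap r => simp only [AlgHom.commutes, Algebra.commutes]
  | add a b ha hb => simp only [map_add, mul_add, add_mul, ha, hb]
  | ι_mul a m ha =>
    have := ExteriorAlgebra.ι_add_mul_swap (R := R) y (Pi.single l m)
    rw [map_mul, map_mul, map_mul, extPar_ι, map_neg, extIn_ι, ← mul_assoc,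
      eq_neg_of_add_eq_zero_left this, neg_mul, mul_assoc, ha, neg_mul, neg_mul, mul_assoc]

/-- The sign built into `extLeft` is the one that arises when `inᵢ(y)` is moved past `in₀(w₀) ∧ … ∧
inᵢ₋₁(wᵢ₋₁)`. -/
theorem tensorToExt_extLeft {n : ℕ} (i : Fin (n + 1)) (y : g) (t : ExtPow R g n) :
    tensorToExt R g n (extLeft R g i y t) =
      ExteriorAlgebra.ι R (Pi.single i y) * tensorToExt R g n t := by
  induction t using PiTensorProduct.induction_on with
  | smul_tprod r c =>
    rw [map_smul, map_smul, map_smul, mul_smul_comm, extLeft_tprod, tensorToExt_tprod,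
      tensorToExt_tprod, mul_prod_ofFn_of_swap _ _ (fun l => extIn R g l (extPar R g (c l))) i
        (fun l _ => ι_mul_extIn _ l _)]
    congr 3; funext l
    split_ifs with h1 h2
    · rfl
    · subst h2; rw [map_mul, extIn_ι]
    · rfl
  | add a b ha hb => rw [map_add, map_add, ha, hb, map_add, mul_add]

/-- The ordered product intertwines the action on the tensor power with left multiplication and
sends `1 ⊗ … ⊗ 1` to `1`. So it sends the orbit of that tensor under `w` back to `w`. -/
theorem tensorToExt_extToTensor {n : ℕ} (w : ExteriorAlgebra R (Fin (n + 1) → g)) :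
    tensorToExt R g n (extToTensor R g n w) = w := by
  induction w using ext_induction with
  | algebraMap r =>
    rw [extToTensor_apply, AlgHom.commutes, Module.algebraMap_end_apply, map_smul,
      tensorToExt_tprod]
    simp [Algebra.algebraMap_eq_smul_one]
  | add a b ha hb => rw [map_add, map_add, ha, hb]
  | ι_mul a m ha =>
    rw [extToTensor_apply, map_mul, Module.End.mul_apply, ← extToTensor_apply, extAct_ι,
      extLeftSum_apply, LinearMap.sum_apply, map_sum]
    simp only [tensorToExt_extLeft, ha]
    rw [← Finset.sum_mul, ← map_sum, Finset.univ_sum_single]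

end ExteriorPower

/-! ### Surjectivity of the map from the tensor power of the exterior algebra -/

section Spanning

variable {R : Type u} [CommRing R] {g : Type v} [LieRing g] [LieAlgebra R g]

/-- The relation `(s y) x = x (s y) - s[x, y]` moves one element of `𝔤` to the left at the cost of
another element of `s𝔤`; repetition handles all of `U[𝔤]`. -/
theorem sus_mul_incl_mem (s : UniversalEnvelopingAlgebra R g) (y : g) :
    UCone.sus R g y * UCone.incl R g s ∈ Submodule.span R
      {a | ∃ s' y', a = UCone.incl R g s' * UCone.sus R g y'} := by
  induction s using UCone.env_induction generalizing y with
  | algebraMap r =>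
    rw [AlgHom.commutes, ← Algebra.commutes, ← Algebra.smul_def]
    exact Submodule.smul_mem _ _ (Submodule.subset_span ⟨1, y, by simp⟩)
  | ι x =>
    rw [UCone.incl_ι, eq_sub_of_add_eq (UCone.lie_mul_sus x y).symm]
    exact sub_mem (Submodule.subset_span ⟨UniversalEnvelopingAlgebra.ι R x, y, by rw [UCone.incl_ι]⟩)
      (Submodule.subset_span ⟨1, ⁅x, y⁆, by simp⟩)
  | add a b ha hb => rw [map_add, mul_add]; exact add_mem (ha y) (hb y)
  | mul a b ha hb =>
    rw [map_mul, ← mul_assoc]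
    -- First `s y` is moved past `a`, giving a combination of terms `s' · (s y')`; then each `s y'`
    -- is moved past `b`.
    have h1 := ha y
    generalize UCone.sus R g y * UCone.incl R g a = c at h1
    induction h1 using Submodule.span_induction with
    | mem c hc =>
      obtain ⟨s', y', rfl⟩ := hc
      have h2 := hb y'
      rw [mul_assoc]
      generalize UCone.sus R g y' * UCone.incl R g b = d at h2
      induction h2 using Submodule.span_induction with
      | mem d hd =>
        obtain ⟨s'', y'', rfl⟩ := hd
        exact Submodule.subset_span ⟨s' * s'', y'', by rw [map_mul, mul_assoc]⟩
      | zero => simp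
      | add _ _ _ _ h h' => rw [mul_add]; exact add_mem h h'
      | smul r _ _ h => rw [mul_smul_comm]; exact Submodule.smul_mem _ _ h
    | zero => simp
    | add _ _ _ _ h h' => rw [add_mul]; exact add_mem h h'
    | smul r _ _ h => rw [smul_mul_assoc]; exact Submodule.smul_mem _ _ h

-- The span contains `1` and is stable under left multiplication by `𝔤`, trivially, and by `s𝔤`, by
-- `sus_mul_incl_mem`. Only spanning is claimed; independence plays no part in the argument.
variable (R g) in
theorem span_incl_mul_inclExt :
    Submodule.span R {a | ∃ s w, a = UCone.incl R g s * UCone.inclExt R g w} = ⊤ := by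
  rw [eq_top_iff]
  rintro a -
  -- The claim is strengthened to stability under left multiplication by `a`, a property that passes
  -- to products, so that it need be checked on generators only.
  suffices h : ∀ b ∈ Submodule.span R {a | ∃ s w, a = UCone.incl R g s * UCone.inclExt R g w},
      a * b ∈ Submodule.span R {a | ∃ s w, a = UCone.incl R g s * UCone.inclExt R g w} by
    simpa using h 1 (Submodule.subset_span ⟨1, 1, by simp⟩)
  induction a using UCone.induction with
  | algebraMap r =>
    intro b hb
    rw [← Algebra.smul_def]
    exact Submodule.smul_mem _ _ hb
  | mul a a' ha ha' => intro b hb; rw [mul_assoc]; exact ha _ (ha' _ hb)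
  | add a a' ha ha' => intro b hb; rw [add_mul]; exact add_mem (ha _ hb) (ha' _ hb)
  | lie x =>
    intro b hb
    induction hb using Submodule.span_induction with
    | mem b hb =>
      obtain ⟨s, w, rfl⟩ := hb
      exact Submodule.subset_span ⟨UniversalEnvelopingAlgebra.ι R x * s, w, by
        rw [map_mul, UCone.incl_ι, mul_assoc]⟩
    | zero => simp
    | add _ _ _ _ h h' => rw [mul_add]; exact add_mem h h'
    | smul r _ _ h => rw [mul_smul_comm]; exact Submodule.smul_mem _ _ h
  | sus y =>
    intro b hb
    induction hb using Submodule.span_induction with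
    | mem b hb =>
      obtain ⟨s, w, rfl⟩ := hb
      rw [← mul_assoc]
      have h1 := sus_mul_incl_mem s y
      generalize UCone.sus R g y * UCone.incl R g s = c at h1
      induction h1 using Submodule.span_induction with
      | mem c hc =>
        obtain ⟨s', y', rfl⟩ := hc
        exact Submodule.subset_span ⟨s', ExteriorAlgebra.ι R y' * w, by
          rw [map_mul, UCone.inclExt_ι, mul_assoc]⟩
      | zero => simp
      | add _ _ _ _ h h' => rw [add_mul]; exact add_mem h h'
      | smul r _ _ h => rw [smul_mul_assoc]; exact Submodule.smul_mem _ _ h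
    | zero => simp
    | add _ _ _ _ h h' => rw [mul_add]; exact add_mem h h'
    | smul r _ _ h => rw [mul_smul_comm]; exact Submodule.smul_mem _ _ h

variable (R g) in
/-- The map `w₀ ⊗ … ⊗ wₙ ↦ 1 ⊗ w₀ ⊗ … ⊗ wₙ` to the relative bar construction. -/
def extToBar (n : ℕ) : ExtPow R g n →ₗ[R] (barObj R g n).carrier :=
  (barRel R g n).mkQ ∘ₗ PiTensorProduct.map fun _ => (UCone.inclExt R g).toLinearMap

theorem extToBar_tprod {n : ℕ} (w : Fin (n + 1) → ExteriorAlgebra R g) :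
    extToBar R g n (PiTensorProduct.tprod R w) = barMk fun i => UCone.inclExt R g (w i) :=
  congrArg (barRel R g n).mkQ (PiTensorProduct.map_tprod _ w)

theorem barMk_incl_mul_zero {n : ℕ} (s : UniversalEnvelopingAlgebra R g)
    (a : Fin (n + 1) → UCone R g) :
    barMk (Function.update a 0 (UCone.incl R g s * a 0)) =
      UCone.counit R g (UCone.incl R g s) • barMk a :=
  (Submodule.Quotient.eq _).2 (Submodule.subset_span (Or.inl ⟨s, a, rfl⟩))

theorem barMk_mul_incl {n : ℕ} (j : Fin n) (s : UniversalEnvelopingAlgebra R g)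
    (a : Fin (n + 1) → UCone R g) :
    barMk (Function.update a j.castSucc (a j.castSucc * UCone.incl R g s)) =
      barMk (Function.update a j.succ (UCone.incl R g s * a j.succ)) :=
  (Submodule.Quotient.eq _).2 (Submodule.subset_span (Or.inr ⟨j, s, a, rfl⟩))

variable (R g) in
/-- The class in the relative bar construction, as a multilinear map. -/
def barMultilinear (n : ℕ) :
    MultilinearMap R (fun _ : Fin (n + 1) => UCone R g) (barObj R g n).carrier :=
  (barRel R g n).mkQ.compMultilinearMap (PiTensorProduct.tprod R)

theorem barMultilinear_apply {n : ℕ} (a : Fin (n + 1) → UCone R g) :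
    barMultilinear R g n a = barMk a := rfl

/-- The number `k` counts the leading factors that are still arbitrary. The last of these is a
combination of products `s w`; its part `s` crosses the tensor sign into the preceding factor, which
is arbitrary anyway, or leaves through the augmentation if there is none. What stays behind is
exterior, and `k` drops by one. -/
theorem barMk_mem_range {n : ℕ} (k : ℕ) (hk : k ≤ n + 1) (a : Fin (n + 1) → UCone R g)
    (ha : ∀ j : Fin (n + 1), k ≤ j → ∃ w, a j = UCone.inclExt R g w) :
    barMk a ∈ LinearMap.range (extToBar R g n) := by
  induction k generalizing a with
  | zero =>
    choose w hw using fun j => ha j (Nat.zero_le _)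
    exact ⟨PiTensorProduct.tprod R w, by rw [extToBar_tprod]; congr 1; exact (funext hw).symm⟩
  | succ k ih =>
    have hk' : k < n + 1 := hk
    have key : ∀ x ∈ Submodule.span R {a | ∃ s w, a = UCone.incl R g s * UCone.inclExt R g w},
        barMultilinear R g n (Function.update a ⟨k, hk'⟩ x) ∈
          LinearMap.range (extToBar R g n) := by
      intro x hx
      induction hx using Submodule.span_induction with
      | mem x hx =>
        obtain ⟨s, w, rfl⟩ := hx
        have ha' : ∀ j : Fin (n + 1), k ≤ j →
            ∃ w', Function.update a ⟨k, hk'⟩ (UCone.inclExt R g w) j = UCone.inclExt R g w' := by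
          intro j hj
          by_cases h : j = ⟨k, hk'⟩
          · subst h; exact ⟨w, by simp⟩
          · rw [Function.update_of_ne h]
            exact ha j (Nat.lt_of_le_of_ne hj fun h' => h (Fin.ext h'.symm))
        rw [barMultilinear_apply]
        -- At index `0` the factor `s` becomes the scalar `ε(s)`; at any other index it is moved to
        -- the preceding factor.
        rcases k with _ | k
        · have := barMk_incl_mul_zero s (Function.update a 0 (UCone.inclExt R g w))
          rw [Function.update_idem, Function.update_self] at this
          change barMk (Function.update a 0 _) ∈ _
          rw [this]
          exact Submodule.smul_mem _ _ (ih (by omega) _ ha')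
        · have h1 := barMk_mul_incl ⟨k, by omega⟩ s
            (Function.update a ⟨k + 1, hk'⟩ (UCone.inclExt R g w))
          have h2 : Fin.succ ⟨k, by omega⟩ = (⟨k + 1, hk'⟩ : Fin (n + 1)) := rfl
          rw [h2, Function.update_idem, Function.update_self] at h1
          rw [← h1]
          refine ih (by omega) _ fun j hj => ?_
          rw [Function.update_of_ne]
          · exact ha' j hj
          · rintro rfl; simp at hj
      | zero => rw [MultilinearMap.map_update_zero]; exact zero_mem _
      | add _ _ _ _ h h' => rw [MultilinearMap.map_update_add]; exact add_mem h h'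
      | smul r _ _ h => rw [MultilinearMap.map_update_smul]; exact Submodule.smul_mem _ _ h
    have := key (a ⟨k, hk'⟩) (by rw [span_incl_mul_inclExt]; trivial)
    rwa [Function.update_eq_self] at this

theorem extToBar_surjective (n : ℕ) : Function.Surjective (extToBar R g n) := by
  intro x
  obtain ⟨t, rfl⟩ := (barRel R g n).mkQ_surjective x
  change _ ∈ LinearMap.range (extToBar R g n)
  induction t using PiTensorProduct.induction_on with
  | smul_tprod r a =>
    rw [map_smul]
    -- With `n + 1` arbitrary leading factors the condition on the remaining ones is empty.
    exact Submodule.smul_mem _ _ (barMk_mem_range (n + 1) le_rfl a fun j hj =>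
      absurd j.isLt (not_lt.2 hj))
  | add x y hx hy => rw [map_add]; exact add_mem hx hy

end Spanning

/-! ### Bijective morphisms of right `U[C𝔤]`-complexes -/

namespace DGMod

variable {R : Type u} [CommRing R] {g : Type v} [LieRing g] [LieAlgebra R g] {V W : DGMod R g}

theorem proj_mem (k : ℕ) (x : V.carrier) : V.proj k x ∈ V.deg k := by
  rw [proj, LinearMap.comp_apply]; exact Subtype.prop _

/-- A map that preserves degrees commutes with the projections to homogeneous parts. This makes the
inverse of a bijective morphism preserve degrees as well. -/
theorem proj_lin (f : V ⟶ W) (k : ℕ) (x : V.carrier) :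
    f.lin (V.proj k x) = W.proj k (f.lin x) := by
  have hx : x ∈ ⨆ k, V.deg k := by rw [V.isInternal.submodule_iSup_eq_top]; trivial
  induction hx using Submodule.iSup_induction' with
  | mem l x hx =>
    rw [proj_of_mem_aux hx, proj_of_mem_aux (f.map_deg l x hx)]
    split_ifs <;> simp
  | zero => simp
  | add x y _ _ hx hy => simp only [map_add, hx, hy]

/-- A bijective morphism of right `U[C𝔤]`-complexes is an isomorphism. -/
def isoOfBijective (f : V ⟶ W) (hf : Function.Bijective f.lin) : V ≅ W where
  hom := f
  inv :=
    { lin := (LinearEquiv.ofBijective f.lin hf).symm.toLinearMap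
      map_deg := by
        intro k x hx
        obtain ⟨x, rfl⟩ := hf.2 x
        -- If `f x` has degree `k`, then `x` and its degree `k` part have the same image, so
        -- injectivity makes `x` homogeneous.
        have h1 : V.proj k x = x := hf.1 (by rw [proj_lin, proj_of_mem_aux hx, if_pos rfl])
        have h2 : (LinearEquiv.ofBijective f.lin hf).symm (f.lin x) = x :=
          (LinearEquiv.ofBijective f.lin hf).symm_apply_apply x
        rw [LinearEquiv.coe_coe, h2, ← h1]
        exact proj_mem k x
      map_d := by
        intro x
        obtain ⟨x, rfl⟩ := (LinearEquiv.ofBijective f.lin hf).surjective x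
        rw [LinearEquiv.coe_coe, LinearEquiv.symm_apply_apply, LinearEquiv.symm_apply_eq]
        exact (f.map_d x).symm
      map_act := by
        intro x a
        obtain ⟨x, rfl⟩ := (LinearEquiv.ofBijective f.lin hf).surjective x
        rw [LinearEquiv.coe_coe, LinearEquiv.symm_apply_apply, LinearEquiv.symm_apply_eq]
        exact (f.map_act x a).symm }
  hom_inv_id := hom_ext (LinearMap.ext fun x =>
    (LinearEquiv.ofBijective f.lin hf).symm_apply_apply x)
  inv_hom_id := hom_ext (LinearMap.ext fun x =>
    (LinearEquiv.ofBijective f.lin hf).apply_symm_apply x)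

end DGMod

/-! ### The isomorphism between the bar resolution and the Weil coalgebra. -/

section Isomorphism

variable (R : Type u) [CommRing R] (g : Type v) [LieRing g] [LieAlgebra R g]

/-- Precomposed with the surjection `Λ[𝔤^{n+1}] → Λ[𝔤]^{⊗(n+1)} → (bar construction)`, the
comparison map becomes the automorphism `Λ(Φₙ)` of `Λ[𝔤^{n+1}]`. A map that becomes injective after
a surjection is injective, and surjectivity is inherited from the composite. -/
theorem psiHom_bijective (n : ℕ) : Function.Bijective (psiHom R g n).lin := by
  have h1 : ∀ t, (psiHom R g n).lin (extToBar R g n t) =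
      ExteriorAlgebra.map (phiLin R g n) (tensorToExt R g n t) := by
    intro t
    induction t using PiTensorProduct.induction_on with
    | smul_tprod r w =>
      rw [map_smul, map_smul, map_smul, map_smul, extToBar_tprod, psiHom_barMk_inclExt,
        tensorToExt_tprod]
      rfl
    | add x y hx hy => simp only [map_add, hx, hy]; rfl
  have h2 : ∀ w, (psiHom R g n).lin (extToBar R g n (extToTensor R g n w)) =
      ExteriorAlgebra.map (phiLin R g n) w := fun w => by
    rw [h1, tensorToExt_extToTensor]
  have h3 : Function.Surjective (extToBar R g n ∘ extToTensor R g n) :=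
    (extToBar_surjective n).comp (extToTensor_surjective n)
  -- The partial sums that define `Φₙ` are inverted by consecutive differences.
  have hphi : Function.Bijective (phiLin R g n) :=
    ⟨sumLin_injective R n, fun y => ⟨diff y, sumLin_diff R y⟩⟩
  let e : (Fin (n + 1) → g) ≃ₗ[R] (Fin (n + 1) → g) := LinearEquiv.ofBijective _ hphi
  have he : ∀ w, ExteriorAlgebra.map e.symm.toLinearMap (ExteriorAlgebra.map (phiLin R g n) w) = w := by
    intro w
    have h : e.symm.toLinearMap ∘ₗ phiLin R g n = LinearMap.id :=
      LinearMap.ext fun x => e.symm_apply_apply x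
    rw [← AlgHom.comp_apply, ExteriorAlgebra.map_comp_map, h, ExteriorAlgebra.map_id]; rfl
  have he' : ∀ w, ExteriorAlgebra.map (phiLin R g n) (ExteriorAlgebra.map e.symm.toLinearMap w) = w := by
    intro w
    have h : phiLin R g n ∘ₗ e.symm.toLinearMap = LinearMap.id :=
      LinearMap.ext fun x => e.apply_symm_apply x
    rw [← AlgHom.comp_apply, ExteriorAlgebra.map_comp_map, h, ExteriorAlgebra.map_id]; rfl
  constructor
  -- Both elements are lifted to `Λ[𝔤^{n+1}]`, where `Λ(Φₙ)` separates them.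
  · intro x y hxy
    obtain ⟨w, rfl⟩ := h3 x
    obtain ⟨w', rfl⟩ := h3 y
    have h4 : ExteriorAlgebra.map (phiLin R g n) w = ExteriorAlgebra.map (phiLin R g n) w' :=
      (h2 w).symm.trans (hxy.trans (h2 w'))
    rw [← he w, h4, he]
  · intro w
    exact ⟨_, (h2 (ExteriorAlgebra.map e.symm.toLinearMap w)).trans (he' w)⟩

/-- The isomorphism from the simplicial relative bar resolution to the simplicial Weil
coalgebra. -/
def psi : relBar R g ≅ weil R g :=
  NatIso.ofComponents (fun n => DGMod.isoOfBijective (psiHom R g n.unop.len)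
      (psiHom_bijective R g n.unop.len))
    (fun f => psiHom_naturality f.unop.toOrderHom)

end Isomorphism

end

end WeilBar

theorem theorem4p5 {R : Type u} [CommRing R] {g : Type v} [LieRing g] [LieAlgebra R g]
    [Module.Projective R g] :
    ∃ Ψ : WeilBar.relBar R g ≅ WeilBar.weil R g,
      (∀ (n : ℕ) (w : Fin (n + 1) → ExteriorAlgebra R g),
        (Ψ.hom.app (op (SimplexCategory.mk n))).lin
            (WeilBar.barMk fun i => WeilBar.UCone.inclExt R g (w i)) =
          ExteriorAlgebra.map (WeilBar.phiLin R g n)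
            (List.ofFn fun i =>
              ExteriorAlgebra.map (LinearMap.single R (fun _ : Fin (n + 1) => g) i) (w i)).prod) ∧
      (∀ a : WeilBar.UCone R g,
        ExteriorAlgebra.algebraMapInv (R := R) (M := Fin 1 → g)
            ((Ψ.hom.app (op (SimplexCategory.mk 0))).lin (WeilBar.barMk fun _ => a)) =
          WeilBar.UCone.counit R g a) ∧
      ∃ Θ : (WeilBar.normalization R g).obj (WeilBar.relBar R g) ≅
          (WeilBar.normalization R g).obj (WeilBar.weil R g),
        Θ.hom = (WeilBar.normalization R g).map Ψ.hom := by
  refine ⟨WeilBar.psi R g, fun n w => WeilBar.psiHom_barMk_inclExt w, fun a => ?_,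
    (WeilBar.normalization R g).mapIso (WeilBar.psi R g), rfl⟩
  -- In simplicial degree `0` the class of `a` goes to `1 · δ₀(a)`. Its projection to `R` is the
  -- augmentation of `δ₀(a)`, which equals that of `a`.
  refine (congrArg _ (WeilBar.psiHom_mk (n := 0) _)).trans ?_
  rw [WeilBar.algebraMapInv_actOne, WeilBar.stairProd, WeilBar.ordProd_tprod, List.ofFn_succ,
    List.ofFn_zero, List.prod_singleton, WeilBar.counit_map]
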